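/- Let $\nu>1$ and $0\le r_-<r_+$, put $\ell=1$ and $q=\sqrt{r_+r_-(\nu^2+3)}$, and let $$R(r)^2=\tfrac r4\big[3(\nu^2-1)r+(\nu^2+3)(r_++r_-)-4\nu q\big],\quad N(r)^2=\frac{(\nu^2+3)(r-r_+)(r-r_-)}{4R(r)^2},\quad N^\theta(r)=\frac{2\nu r-q}{2R(r)^2}.$$ The exterior region of the spacelike stretched black hole is $r>r_+$ with metric $ds^2=dt^2+\frac{dr^2}{4R^2N^2}+2R^2N^\theta\,dt\,d\theta+R^2d\theta^2$. Let $m^2\ge-\frac{\nu^2+3}{4}$ be real (the effective squared mass) and $k\in\mathbb Z$. A mode solution of frequency $\omega\in\mathbb C$ is a $C^2$ function $\phi$ on $(r_+,\infty)$ such that $\Phi=e^{-i\omega t+ik\theta}\phi(r)$ satisfies $(\nabla^2-m^2)\Phi=0$ for $r>r_+$; put $\varphi=R^{1/2}\phi$. Let $r_*$ be a tortoise coordinate, $dr_*/dr=1/(2RN^2)$, and $$\tilde\omega=\omega+kN^\theta(r_+),\quad \omega_m=\frac12\frac{\nu^2+3}{\sqrt{3(\nu^2-1)}}\sqrt{1+\frac{4m^2}{\nu^2+3}},\quad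 \hat\varpi=\sqrt{\omega_m^2-\omega^2},\quad \hat\omega=-i\hat\varpi,$$ where $\operatorname{Re}\hat\varpi\ge0$ and, when $\operatorname{Re}\hat\varpi=0$ (i.e. $\omega$ is real and $|\omega|\ge\omega_m$), $\hat\omega$ has the sign of $\omega$ or is $0$. We write $\varphi\sim e^{\lambda r_*}$ at the horizon (resp. at infinity) if, near it, $\varphi=e^{\lambda r_*}g$ where $g$ is a function of $r$ (resp. of $1/r$) extending analytically to $r=r_+$ (resp. to $1/r=0$) with a non-zero value there. A mode solution is a *quasinormal mode* if $\varphi\sim e^{-i\tilde\omega r_*}$ at the horizon and $\varphi\sim e^{i\hat\omega r_*}$ at infinity; it is a *bound state mode* if $\varphi\sim e^{-i\tilde\omega r_*}$ at the horizon, $\operatorname{Re}\hat\varpi>0$, and $\varphi\sim e^{-\hat\varpi r_*}$ at infinity. Then $\omega$ is called a quasinormal (resp. bound state) eigenfrequency. Put $a=\alpha+\beta+\gamma$, $b=\alpha+\beta-\gamma$, $c=2\alpha+1$ with $$\alpha=-i\tilde\omega\,\frac{2\nu r_+-q}{(\nu^2+3)(r_+-r_-)},\qquad \beta=\frac12-\hat\varpi\,\frac{\sqrt{3(\nu^2-1)}}{\nu^2+3},\qquad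 \gamma=-i\,\frac{(2\nu r_--q)\,\omega+2k}{(\nu^2+3)(r_+-r_-)}.$$ (When $R(r_-)\ne0$, $(2\nu r_--q)\,\omega+2k=(2\nu r_--q)(\omega+kN^\theta(r_-))$.) Let $d=\frac1{r_+-r_-}$, $\delta=2\nu(r_++r_-)-2q$, and assume $d^2\delta^2\ne3(\nu^2-1)$. For $n\in\mathbb N_0$ define the "right" frequencies $$(\omega_\pm)^{(R)}_n=\frac{\nu^2+3}{d^2\delta^2-3(\nu^2-1)}\Big\{-d\delta\Big(\frac{4kd}{\nu^2+3}+i\big(n+\tfrac12\big)\Big)\pm i\,(e-i\,\mathrm{sgn}(k)f)\Big\},$$ $$e=\sqrt{\tfrac{\sqrt{E^2+F^2}+E}2},\quad f=\sqrt{\tfrac{\sqrt{E^2+F^2}-E}2},\quad F=-3(\nu^2-1)\big(n+\tfrac12\big)\frac{8kd}{\nu^2+3},$$ $$E=\tfrac14\Big(1+\frac{4m^2}{\nu^2+3}\Big)d^2\delta^2-3(\nu^2-1)\Big[\tfrac14\Big(1+\frac{4m^2}{\nu^2+3}\Big)+\Big(\frac{4kd}{\nu^2+3}\Big)^2-\big(n+\tfrac12\big)^2\Big],$$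 and the "left" frequencies $$(\omega_\pm)^{(L)}_n=-i\Big[(2n+1)\nu\mp\sqrt{3(\nu^2-1)\big(n+\tfrac12\big)^2+\tfrac{\nu^2+3}4\Big(1+\frac{4m^2}{\nu^2+3}\Big)}\Big].$$ Then: 1. For every $\omega\in\mathbb C$ with $c\notin\{0,-1,-2,\dots\}$ and $c-a-b\notin\{1,2,3,\dots\}$: $\omega$ is a quasinormal eigenfrequency if and only if $a=-n$ or $b=-n$ for some $n\in\mathbb N_0$, and if and only if $\omega=(\omega_+)^{(R)}_n$ or $\omega=(\omega_+)^{(L)}_n$ for some $n\in\mathbb N_0$. 2. For every $\omega\in\mathbb C$ with $c\notin\{0,-1,-2,\dots\}$: $\omega$ is a bound state eigenfrequency if and only if $c-a=-n$ or $c-b=-n$ for some $n\in\mathbb N_0$, and if and only if $\omega=(\omega_-)^{(R)}_n$ or $\omega=(\omega_-)^{(L)}_n$ for some $n\in\mathbb N_0$. 3. For all $\omega\in\mathbb C$ and $n\in\mathbb N_0$: $a=-n\iff\omega=(\omega_+)^{(R)}_n$; $\;b=-n\iff\omega=(\omega_+)^{(L)}_n$; $\;c-b=-n\iff\omega=(\omega_-)^{(R)}_n$;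 $\;c-a=-n\iff\omega=(\omega_-)^{(L)}_n$. -/

import Mathlib

open Filter Topology

noncomputable section

/-- Parameters of a non-extremal spacelike stretched black hole (length unit `ℓ = 1`):
warp factor `ν > 1` and horizon radii `0 ≤ r₋ < r₊`. -/
structure StretchedBlackHole where
  ν : ℝ
  rp : ℝ
  rm : ℝ
  one_lt_ν : 1 < ν
  rm_nonneg : 0 ≤ rm
  rm_lt_rp : rm < rp

namespace StretchedBlackHole

variable (B : StretchedBlackHole)

/-! ### The metric -/

/-- `√(r₊ r₋ (ν² + 3))`. -/
def q : ℝ := √(B.rp * B.rm * (B.ν ^ 2 + 3))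

/-- The metric function `R(r)²`. -/
def Rsq (r : ℝ) : ℝ :=
  r / 4 * (3 * (B.ν ^ 2 - 1) * r + (B.ν ^ 2 + 3) * (B.rp + B.rm) - 4 * B.ν * B.q)

/-- The metric function `R(r)`. -/
def R (r : ℝ) : ℝ := √(B.Rsq r)

/-- The squared lapse `N(r)²`. -/
def Nsq (r : ℝ) : ℝ := (B.ν ^ 2 + 3) * (r - B.rp) * (r - B.rm) / (4 * B.Rsq r)

/-- The shift `N^θ(r)`. -/
def Nθ (r : ℝ) : ℝ := (2 * B.ν * r - B.q) / (2 * B.Rsq r)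

/-- The metric `ds² = dt² + dr² / (4 R² N²) + 2 R² N^θ dt dθ + R² dθ²` in the coordinates
`x = (t, r, θ)`. -/
def metric (x : Fin 3 → ℝ) : Matrix (Fin 3) (Fin 3) ℝ :=
  !![1, 0, B.Rsq (x 1) * B.Nθ (x 1);
     0, 1 / (4 * B.Rsq (x 1) * B.Nsq (x 1)), 0;
     B.Rsq (x 1) * B.Nθ (x 1), 0, B.Rsq (x 1)]

/-- The coordinate partial derivative `∂_μ f`. -/
def partialD (μ : Fin 3) (f : (Fin 3 → ℝ) → ℂ) (x : Fin 3 → ℝ) : ℂ :=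
  deriv (fun s : ℝ => f (Function.update x μ s)) (x μ)

/-- The d'Alembertian `∇² Φ = |det g|^{-1/2} ∑_{μ,ν} ∂_μ (|det g|^{1/2} g^{μν} ∂_ν Φ)`. -/
def box (Φ : (Fin 3 → ℝ) → ℂ) (x : Fin 3 → ℝ) : ℂ :=
  ((1 / √|(B.metric x).det| : ℝ) : ℂ) *
    ∑ μ : Fin 3, ∑ ρ : Fin 3,
      partialD μ (fun y => ((√|(B.metric y).det| * (B.metric y)⁻¹ μ ρ : ℝ) : ℂ) *
        partialD ρ Φ y) x

/-! ### Mode solutions -/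

/-- The field `Φ(t, r, θ) = e^{-iωt + ikθ} φ(r)`. -/
def modeField (k : ℤ) (ω : ℂ) (φ : ℝ → ℂ) (x : Fin 3 → ℝ) : ℂ :=
  Complex.exp (-Complex.I * ω * (x 0 : ℂ) + Complex.I * (k : ℂ) * (x 2 : ℂ)) * φ (x 1)

/-- `φ` is the radial function of a mode solution, with frequency `ω` and angular momentum
number `k`, of the Klein-Gordon equation `(∇² - m²) Φ = 0` in the exterior region `r > r₊`.
Here `msq` is the effective squared mass `m²`, which may be negative. -/
def IsModeSolution (msq : ℝ) (k : ℤ) (ω : ℂ) (φ : ℝ → ℂ) : Prop :=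
  ContDiffOn ℝ 2 φ (Set.Ioi B.rp) ∧
    ∀ x : Fin 3 → ℝ, B.rp < x 1 →
      B.box (modeField k ω φ) x - (msq : ℂ) * modeField k ω φ x = 0

/-- The tortoise coordinate, `dr_*/dr = 1 / (2 R N²)` on `(r₊, ∞)`; the additive constant,
which plays no role, is fixed by `r_*(r₊ + 1) = 0`. -/
def tortoise (r : ℝ) : ℝ := ∫ s in (B.rp + 1)..r, 1 / (2 * B.R s * B.Nsq s)

/-- The rescaled radial function `R(r)^{1/2} φ(r)`, which satisfies the Schrödinger-like equation
in the tortoise coordinate. -/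
def rescaled (φ : ℝ → ℂ) (r : ℝ) : ℂ := ((√(B.R r) : ℝ) : ℂ) * φ r

/-- The frequency at the horizon `ω̃ = ω̃₊ = ω + k N^θ(r₊)`. -/
def omegaTilde (k : ℤ) (ω : ℂ) : ℂ := ω + (k : ℂ) * (B.Nθ B.rp : ℂ)

/-- `ω_m`, the square root of the limit of the effective potential at infinity. -/
def omegaM (msq : ℝ) : ℝ :=
  1 / 2 * ((B.ν ^ 2 + 3) / √(3 * (B.ν ^ 2 - 1))) * √(1 + 4 * msq / (B.ν ^ 2 + 3))

/-- `ϖ̂ = √(ω_m² - ω²)`, with non-negative real part. Where the real part vanishes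
(`ω` real and `|ω| ≥ ω_m`) the sign is such that `ω̂ = -i ϖ̂` has the sign of `ω`. -/
def varpiHat (msq : ℝ) (ω : ℂ) : ℂ :=
  open Classical in
  if ω.im = 0 ∧ ω.re < -B.omegaM msq then
    -(((B.omegaM msq : ℂ) ^ 2 - ω ^ 2) ^ (1 / 2 : ℂ))
  else ((B.omegaM msq : ℂ) ^ 2 - ω ^ 2) ^ (1 / 2 : ℂ)

/-- The frequency at infinity, `i ω̂ = ϖ̂`, so that `ω̂² = ω² - ω_m²`. -/
def omegaHat (msq : ℝ) (ω : ℂ) : ℂ := -Complex.I * B.varpiHat msq ω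

/-- `f ∼ e^{λ r_*}` at the horizon `r_* → -∞`: `f` is purely of the form `e^{λ r_*}`, that is,
`e^{λ r_*}` times a function that extends analytically and without zero to `r = r₊`. (The mere
leading asymptotics would not see an admixture of a subdominant second solution.) -/
def PureAtHorizon (lam : ℂ) (f : ℝ → ℂ) : Prop :=
  ∃ g : ℝ → ℂ, AnalyticAt ℝ g B.rp ∧ g B.rp ≠ 0 ∧
    ∀ᶠ r in 𝓝[>] B.rp, f r = Complex.exp (lam * (B.tortoise r : ℂ)) * g r

/-- `f ∼ e^{λ r_*}` at infinity `r_* → ∞`: `f` is purely of the form `e^{λ r_*}`, that is,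
`e^{λ r_*}` times a function of `1 / r` that extends analytically and without zero to
`1 / r = 0`. -/
def PureAtInfinity (lam : ℂ) (f : ℝ → ℂ) : Prop :=
  ∃ g : ℝ → ℂ, AnalyticAt ℝ g 0 ∧ g 0 ≠ 0 ∧
    ∀ᶠ r in atTop, f r = Complex.exp (lam * (B.tortoise r : ℂ)) * g (1 / r)

/-- Quasinormal modes: ingoing at the horizon, outgoing at infinity. -/
def IsQuasinormalMode (msq : ℝ) (k : ℤ) (ω : ℂ) (φ : ℝ → ℂ) : Prop :=
  B.IsModeSolution msq k ω φ ∧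
    B.PureAtHorizon (-Complex.I * B.omegaTilde k ω) (B.rescaled φ) ∧
    B.PureAtInfinity (Complex.I * B.omegaHat msq ω) (B.rescaled φ)

/-- Bound state modes: ingoing at the horizon, exponentially decreasing at infinity. -/
def IsBoundStateMode (msq : ℝ) (k : ℤ) (ω : ℂ) (φ : ℝ → ℂ) : Prop :=
  B.IsModeSolution msq k ω φ ∧
    B.PureAtHorizon (-Complex.I * B.omegaTilde k ω) (B.rescaled φ) ∧
    0 < (B.varpiHat msq ω).re ∧
    B.PureAtInfinity (-B.varpiHat msq ω) (B.rescaled φ)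

/-- `ω` is a quasinormal eigenfrequency. -/
def IsQuasinormalFreq (msq : ℝ) (k : ℤ) (ω : ℂ) : Prop :=
  ∃ φ : ℝ → ℂ, B.IsQuasinormalMode msq k ω φ

/-- `ω` is a bound state eigenfrequency. -/
def IsBoundStateFreq (msq : ℝ) (k : ℤ) (ω : ℂ) : Prop :=
  ∃ φ : ℝ → ℂ, B.IsBoundStateMode msq k ω φ

/-! ### Hypergeometric parameters -/

/-- `α = -i ω̃₊ (2νr₊ - √(r₊r₋(ν²+3))) / ((ν²+3)(r₊-r₋))`. -/
def α (k : ℤ) (ω : ℂ) : ℂ :=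
  -Complex.I * B.omegaTilde k ω *
    (((2 * B.ν * B.rp - B.q) / ((B.ν ^ 2 + 3) * (B.rp - B.rm)) : ℝ) : ℂ)

/-- `β = 1/2 - ϖ̂ √(3(ν²-1)) / (ν²+3)`. -/
def β (msq : ℝ) (ω : ℂ) : ℂ :=
  1 / 2 - B.varpiHat msq ω * ((√(3 * (B.ν ^ 2 - 1)) / (B.ν ^ 2 + 3) : ℝ) : ℂ)

/-- `γ = -i ω̃₋ (2νr₋ - √(r₊r₋(ν²+3))) / ((ν²+3)(r₊-r₋))` with `ω̃₋ = ω + k N^θ(r₋)`, written in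
the form that also makes sense when `R(r₋) = 0`; see `γ_eq`. -/
def γ (k : ℤ) (ω : ℂ) : ℂ :=
  -Complex.I * (ω * ((2 * B.ν * B.rm - B.q : ℝ) : ℂ) + 2 * (k : ℂ)) /
    (((B.ν ^ 2 + 3) * (B.rp - B.rm) : ℝ) : ℂ)

theorem Rsq_rm : B.Rsq B.rm = ((2 * B.ν * B.rm - B.q) / 2) ^ 2 := by
  have h1 := B.rm_nonneg
  have h2 := B.rm_lt_rp
  have hq : B.q ^ 2 = B.rp * B.rm * (B.ν ^ 2 + 3) := by
    unfold q
    exact Real.sq_sqrt (mul_nonneg (mul_nonneg (by linarith) h1) (by positivity))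
  unfold Rsq
  linear_combination (-1 / 4) * hq

theorem γ_eq (k : ℤ) (ω : ℂ) (h : B.Rsq B.rm ≠ 0) :
    B.γ k ω = -Complex.I * (ω + (k : ℂ) * (B.Nθ B.rm : ℂ)) *
      (((2 * B.ν * B.rm - B.q) / ((B.ν ^ 2 + 3) * (B.rp - B.rm)) : ℝ) : ℂ) := by
  have h0 : 2 * B.ν * B.rm - B.q ≠ 0 := by
    intro h0
    apply h
    rw [B.Rsq_rm, h0]
    norm_num
  have h1 : B.Nθ B.rm * (2 * B.ν * B.rm - B.q) = 2 := by
    unfold Nθ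
    rw [B.Rsq_rm]
    field_simp
  have h2 : (B.Nθ B.rm : ℂ) * ((2 * B.ν * B.rm - B.q : ℝ) : ℂ) = 2 := by
    rw [← Complex.ofReal_mul, h1]
    norm_num
  unfold γ
  rw [Complex.ofReal_div]
  linear_combination (Complex.I * (k : ℂ) / (((B.ν ^ 2 + 3) * (B.rp - B.rm) : ℝ) : ℂ)) * h2

/-- The hypergeometric parameter `a = α + β + γ`. -/
def a (msq : ℝ) (k : ℤ) (ω : ℂ) : ℂ := B.α k ω + B.β msq ω + B.γ k ω

/-- The hypergeometric parameter `b = α + β - γ`. -/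
def b (msq : ℝ) (k : ℤ) (ω : ℂ) : ℂ := B.α k ω + B.β msq ω - B.γ k ω

/-- The hypergeometric parameter `c = 2α + 1`. -/
def c (k : ℤ) (ω : ℂ) : ℂ := 2 * B.α k ω + 1

/-! ### Explicit frequencies -/

/-- `d = 1 / (r₊ - r₋)`. -/
def d : ℝ := 1 / (B.rp - B.rm)

/-- `δ = 2ν(r₊ + r₋) - 2√((ν²+3) r₊ r₋)`. -/
def δ : ℝ := 2 * B.ν * (B.rp + B.rm) - 2 * √((B.ν ^ 2 + 3) * B.rp * B.rm)

/-- The quantity `E`. -/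
def capE (msq : ℝ) (k : ℤ) (n : ℕ) : ℝ :=
  1 / 4 * (1 + 4 * msq / (B.ν ^ 2 + 3)) * B.d ^ 2 * B.δ ^ 2 -
    3 * (B.ν ^ 2 - 1) * (1 / 4 * (1 + 4 * msq / (B.ν ^ 2 + 3)) +
      (4 * (k : ℝ) * B.d / (B.ν ^ 2 + 3)) ^ 2 - ((n : ℝ) + 1 / 2) ^ 2)

/-- The quantity `F`. -/
def capF (k : ℤ) (n : ℕ) : ℝ :=
  -3 * (B.ν ^ 2 - 1) * ((n : ℝ) + 1 / 2) * (8 * (k : ℝ) * B.d / (B.ν ^ 2 + 3))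

/-- `e = √((√(E² + F²) + E) / 2)`. -/
def smallE (msq : ℝ) (k : ℤ) (n : ℕ) : ℝ :=
  √((√(B.capE msq k n ^ 2 + B.capF k n ^ 2) + B.capE msq k n) / 2)

/-- `f = √((√(E² + F²) - E) / 2)`. -/
def smallF (msq : ℝ) (k : ℤ) (n : ℕ) : ℝ :=
  √((√(B.capE msq k n ^ 2 + B.capF k n ^ 2) - B.capE msq k n) / 2)

/-- The right frequencies `(ω_±)_n^{(R)}`, where `s = 1` for `ω_+` and `s = -1` for `ω_-`. -/
def rightFreq (s : ℤ) (msq : ℝ) (k : ℤ) (n : ℕ) : ℂ :=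
  (((B.ν ^ 2 + 3) / (B.d ^ 2 * B.δ ^ 2 - 3 * (B.ν ^ 2 - 1)) : ℝ) : ℂ) *
    (-((B.d * B.δ : ℝ) : ℂ) * (((4 * (k : ℝ) * B.d / (B.ν ^ 2 + 3) : ℝ) : ℂ) +
        Complex.I * ((n : ℂ) + 1 / 2)) +
      (s : ℂ) * Complex.I *
        ((B.smallE msq k n : ℂ) - Complex.I * (Int.sign k : ℂ) * (B.smallF msq k n : ℂ)))

/-- The left frequencies `(ω_±)_n^{(L)}`, where `s = 1` for `ω_+` and `s = -1` for `ω_-`. -/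
def leftFreq (s : ℤ) (msq : ℝ) (n : ℕ) : ℂ :=
  -Complex.I * ((2 * (n : ℂ) + 1) * (B.ν : ℂ) -
    (s : ℂ) * ((√(3 * (B.ν ^ 2 - 1) * ((n : ℝ) + 1 / 2) ^ 2 +
      (B.ν ^ 2 + 3) / 4 * (1 + 4 * msq / (B.ν ^ 2 + 3))) : ℝ) : ℂ))

end StretchedBlackHole

end

/-!
In the coordinate `z = (r - r₊) / (r - r₋)`, which maps the exterior region onto `(0, 1)`, the
radial equation has three regular singular points: the horizons `z = 0`, `z = ∞` and infinity,
`z = 1`. The exponents are `± α`, `± γ` and `β`, `1 - β` respectively, because `4 R²` is a perfect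
square at each horizon (`modePot_eq`) and because `ϖ̂² = ω_m² - ω²` (`β_mul_one_sub_β`). Hence
`φ = z ^ α (1 - z) ^ β u`, where `u` solves the hypergeometric equation with parameters
`a = α + β + γ`, `b = α + β - γ`, `c = 2 α + 1`.

The tortoise coordinate is a logarithm of `z`, or of `1 - z`, plus an analytic function
(`powerAtZero_exp`), so the boundary conditions say exactly that `φ` is `z ^ α` times an analytic
nonvanishing function at the horizon, and `(1 - z) ^ β` times one at infinity; for bound states,
`β` is replaced by `1 - β`, which turns `a`, `b` into `c - b`, `c - a`. So `u` has to be analytic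
and nonzero at both ends of `[0, 1]`.

* If `a = -n` or `b = -n`, the hypergeometric polynomial is such a solution. It cannot vanish at
  `z = 1`: an analytic solution at a singular point whose exponents are `0` and something outside
  `{1, 2, …}` is determined by its value there (`hyperPoly_eval_one_ne_zero`).
* Otherwise `u`, being analytic at `0`, is a multiple of the series `₂F₁(a, b; c; z)`, first near
  `0` and then on `(0, 1)` by uniqueness for linear equations. Its `k`-th derivative is a multiple
  of `₂F₁(a + k, b + k; c + k; z)`, and for large `k` the coefficients of the latter are, by Euler's
  limit formula for the Gamma function, asymptotic to a nonzero multiple of those of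
  `(1 - z) ^ (c - a - b - k)`. So that derivative is unbounded at `z = 1`, and `u` is not analytic
  there (`not_analyticAt_one_hyperF`).

The explicit frequencies come from squaring. Each of the four conditions reads `W = V` or `W = -V`
with `W = √(3 (ν² - 1)) ϖ̂`, `Re W ≥ 0`, and `V` affine in `ω`. The equation `V² = W²` is quadratic
in `ω`, with roots `ω₊` and `ω₋`. One finds `Re V(ω₊) > 0 > Re V(ω₋)`, which assigns one root to
each sign (`eq_iff_of_sq_eq_sq_iff`). For the right frequencies this rests on
`d² δ² > 3 (ν² - 1)`.
-/

/-! ### Germs of analytic functions of a real variable -/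

theorem AnalyticAt.eventuallyEq_of_iteratedDeriv_eq {E : Type*} [NormedAddCommGroup E]
    [NormedSpace ℝ E] [CompleteSpace E] {f g : ℝ → E} {x : ℝ}
    (hf : AnalyticAt ℝ f x) (hg : AnalyticAt ℝ g x)
    (h : ∀ n, iteratedDeriv n f x = iteratedDeriv n g x) : f =ᶠ[𝓝 x] g := by
  have hfg : AnalyticAt ℝ (f - g) x := hf.sub hg
  have htop : analyticOrderAt (f - g) x = ⊤ := by
    rw [ENat.eq_top_iff_forall_ge]
    intro n
    rw [natCast_le_analyticOrderAt_iff_iteratedDeriv_eq_zero hfg]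
    intro i _
    rw [iteratedDeriv_sub hf.contDiffAt hg.contDiffAt, h i, sub_self]
  filter_upwards [analyticOrderAt_eq_top.mp htop] with y hy
  exact sub_eq_zero.mp hy

/-- The sum of a power series with coefficients in a real Banach space. -/
noncomputable def powerSeriesSum {E : Type*} [NormedAddCommGroup E] [NormedSpace ℝ E]
    (t : ℕ → E) (x : ℝ) : E := ∑' n, x ^ n • t n

section PowerSeries

variable {E : Type*} [NormedAddCommGroup E] [NormedSpace ℝ E] [CompleteSpace E]

theorem hasFPowerSeriesOnBall_powerSeriesSum {t : ℕ → E} {ρ C : ℝ} (hρ : 0 < ρ)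
    (h : ∀ n, ‖t n‖ * ρ ^ n ≤ C) :
    HasFPowerSeriesOnBall (powerSeriesSum t)
      (fun n => ContinuousMultilinearMap.mkPiRing ℝ (Fin n) (t n)) 0 (ENNReal.ofReal ρ) := by
  have hr : ENNReal.ofReal ρ ≤ FormalMultilinearSeries.radius
      (fun n => ContinuousMultilinearMap.mkPiRing ℝ (Fin n) (t n)) := by
    refine FormalMultilinearSeries.le_radius_of_bound _ C fun n => ?_
    rw [Real.coe_toNNReal _ hρ.le, ContinuousMultilinearMap.norm_mkPiRing]
    exact h n
  have h1 := (FormalMultilinearSeries.hasFPowerSeriesOnBall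
    (fun n => ContinuousMultilinearMap.mkPiRing ℝ (Fin n) (t n))
    (lt_of_lt_of_le (by simpa using hρ) hr)).mono (by simpa using hρ) hr
  exact h1.congr fun x _ => by simp [FormalMultilinearSeries.sum, powerSeriesSum]

theorem analyticAt_powerSeriesSum_zero {t : ℕ → E} {ρ C : ℝ} (hρ : 0 < ρ)
    (h : ∀ n, ‖t n‖ * ρ ^ n ≤ C) : AnalyticAt ℝ (powerSeriesSum t) 0 :=
  (hasFPowerSeriesOnBall_powerSeriesSum hρ h).analyticAt

theorem iteratedDeriv_powerSeriesSum_zero {t : ℕ → E} {ρ C : ℝ} (hρ : 0 < ρ)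
    (h : ∀ n, ‖t n‖ * ρ ^ n ≤ C) (n : ℕ) :
    iteratedDeriv n (powerSeriesSum t) 0 = (n.factorial : ℝ) • t n := by
  have h1 := (hasFPowerSeriesOnBall_powerSeriesSum hρ h).factorial_smul 1 n
  rw [iteratedDeriv_eq_iteratedFDeriv, ← h1]
  simp [Nat.cast_smul_eq_nsmul]

/-- A power series with radius of convergence at least `1` is analytic on `(-1, 1)`. -/
theorem analyticOnNhd_powerSeriesSum {t : ℕ → E}
    (h : ∀ ρ : ℝ, 0 < ρ → ρ < 1 → Summable fun n => ‖t n‖ * ρ ^ n) :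
    AnalyticOnNhd ℝ (powerSeriesSum t) (Set.Ioo (-1) 1) := by
  intro x hx
  obtain ⟨ρ, h1, h2⟩ := exists_between (abs_lt.mpr hx)
  have hρ : 0 < ρ := lt_of_le_of_lt (abs_nonneg x) h1
  obtain ⟨C, hC⟩ := (h ρ hρ h2).tendsto_atTop_zero.bddAbove_range
  refine (hasFPowerSeriesOnBall_powerSeriesSum hρ (C := C)
    fun n => hC ⟨n, rfl⟩).analyticAt_of_mem ?_
  simpa [Metric.mem_eball, edist_dist, ENNReal.ofReal_lt_ofReal_iff hρ] using h1

/-- Analytic functions of a real variable have analytic local primitives. -/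
theorem AnalyticAt.exists_primitive {f : ℝ → E} {x : ℝ} (hf : AnalyticAt ℝ f x) :
    ∃ F : ℝ → E, AnalyticAt ℝ F x ∧ ∀ᶠ y in 𝓝 x, HasDerivAt F (f y) y := by
  wlog hx : x = 0 generalizing f x
  · have h0 : AnalyticAt ℝ (fun y => f (y + x)) 0 :=
      AnalyticAt.fun_comp (by simpa using hf) (by fun_prop)
    obtain ⟨F, hF, hd⟩ := this h0 rfl
    refine ⟨fun y => F (y - x), AnalyticAt.fun_comp (by simpa using hF) (by fun_prop), ?_⟩
    have ht : Tendsto (fun y : ℝ => y - x) (𝓝 x) (𝓝 0) := by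
      simpa using (continuous_id.sub continuous_const).tendsto (x := x) (f := fun y : ℝ => y - x)
    filter_upwards [ht.eventually hd] with y hy
    simpa using hy.comp_sub_const y x
  subst hx
  obtain ⟨p, r, hp⟩ := hf
  obtain ⟨ρ, hρ0, hρr⟩ := ENNReal.lt_iff_exists_nnreal_btwn.mp hp.r_pos
  have hρ : (0 : ℝ) < ρ := by simpa using hρ0
  obtain ⟨C, hC0, hC⟩ := p.norm_mul_pow_le_of_lt_radius (hρr.trans_le hp.r_le)
  set t : ℕ → E := fun n => ((n : ℝ)⁻¹) • p.coeff (n - 1) with ht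
  have hb : ∀ n, ‖t n‖ * (ρ : ℝ) ^ n ≤ C * ρ := by
    intro n
    rcases n with _ | n
    · simpa [ht] using mul_nonneg hC0.le hρ.le
    · have h1 := hC n
      rw [FormalMultilinearSeries.norm_apply_eq_norm_coef] at h1
      have h2 : ‖t (n + 1)‖ ≤ ‖p.coeff n‖ := by
        simp only [ht, norm_smul, Nat.add_sub_cancel]
        refine mul_le_of_le_one_left (norm_nonneg _) ?_
        rw [norm_inv, Real.norm_natCast]
        refine inv_le_one_of_one_le₀ ?_
        exact_mod_cast Nat.succ_pos n
      calc ‖t (n + 1)‖ * (ρ : ℝ) ^ (n + 1) ≤ ‖p.coeff n‖ * (ρ : ℝ) ^ (n + 1) := by gcongr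
        _ = (‖p.coeff n‖ * (ρ : ℝ) ^ n) * ρ := by ring
        _ ≤ C * ρ := by gcongr
  have hF := analyticAt_powerSeriesSum_zero hρ hb
  refine ⟨powerSeriesSum t, hF, ?_⟩
  have heq : deriv (powerSeriesSum t) =ᶠ[𝓝 0] f := by
    refine hF.deriv.eventuallyEq_of_iteratedDeriv_eq hp.analyticAt fun n => ?_
    rw [← iteratedDeriv_succ', iteratedDeriv_powerSeriesSum_zero hρ hb,
      iteratedDeriv_eq_iteratedFDeriv, ← hp.factorial_smul 1 n]
    simp only [ht, smul_smul, FormalMultilinearSeries.coeff]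
    rw [← Nat.cast_smul_eq_nsmul ℝ, Nat.factorial_succ]
    congr 1
    push_cast
    field_simp
  filter_upwards [heq, hF.eventually_analyticAt] with y h1 h2
  rw [← h1]
  exact h2.differentiableAt.hasDerivAt

end PowerSeries

/-! ### Uniqueness for linear second-order equations -/

/-- Solutions of `w'' = p w' + q w` on an open interval that agree, with their first derivatives,
at one point, agree everywhere. -/
theorem eqOn_of_hasDerivAt_linear_second_order {p q f f' g g' : ℝ → ℂ} {a b x₀ : ℝ}
    (hp : ContinuousOn p (Set.Ioo a b)) (hq : ContinuousOn q (Set.Ioo a b))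
    (hf : ∀ x ∈ Set.Ioo a b, HasDerivAt f (f' x) x)
    (hf' : ∀ x ∈ Set.Ioo a b, HasDerivAt f' (p x * f' x + q x * f x) x)
    (hg : ∀ x ∈ Set.Ioo a b, HasDerivAt g (g' x) x)
    (hg' : ∀ x ∈ Set.Ioo a b, HasDerivAt g' (p x * g' x + q x * g x) x)
    (hx₀ : x₀ ∈ Set.Ioo a b) (h0 : f x₀ = g x₀) (h1 : f' x₀ = g' x₀) :
    Set.EqOn f g (Set.Ioo a b) := by
  intro y hy
  obtain ⟨a', ha, ha'⟩ := exists_between (lt_min hx₀.1 hy.1)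
  obtain ⟨b', hb', hb⟩ := exists_between (max_lt hx₀.2 hy.2)
  have hsub : Set.Icc a' b' ⊆ Set.Ioo a b := fun t ht => ⟨ha.trans_le ht.1, ht.2.trans_lt hb⟩
  have hsub' : Set.Ioo a' b' ⊆ Set.Ioo a b := Set.Ioo_subset_Icc_self.trans hsub
  obtain ⟨P, hP⟩ := isCompact_Icc.exists_bound_of_continuousOn (hp.mono hsub)
  obtain ⟨Q, hQ⟩ := isCompact_Icc.exists_bound_of_continuousOn (hq.mono hsub)
  have hlip : ∀ t ∈ Set.Ioo a' b', LipschitzOnWith (Real.toNNReal (1 + |P| + |Q|))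
      (fun v : ℂ × ℂ => (v.2, p t * v.2 + q t * v.1)) Set.univ := by
    intro t ht
    refine LipschitzOnWith.of_dist_le_mul fun v _ w _ => ?_
    rw [Real.coe_toNNReal _ (by positivity), dist_eq_norm, dist_eq_norm]
    have e1 : ‖v.1 - w.1‖ ≤ ‖v - w‖ := norm_fst_le (v - w)
    have e2 : ‖v.2 - w.2‖ ≤ ‖v - w‖ := norm_snd_le (v - w)
    have hPt : ‖p t‖ ≤ |P| := (hP t (Set.Ioo_subset_Icc_self ht)).trans (le_abs_self P)
    have hQt : ‖q t‖ ≤ |Q| := (hQ t (Set.Ioo_subset_Icc_self ht)).trans (le_abs_self Q)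
    rw [Prod.mk_sub_mk, Prod.norm_mk]
    have hN := norm_nonneg (v - w)
    refine max_le ?_ ?_
    · nlinarith [abs_nonneg P, abs_nonneg Q, mul_nonneg (abs_nonneg P) hN,
        mul_nonneg (abs_nonneg Q) hN]
    · calc ‖p t * v.2 + q t * v.1 - (p t * w.2 + q t * w.1)‖
          = ‖p t * (v.2 - w.2) + q t * (v.1 - w.1)‖ := by ring_nf
        _ ≤ ‖p t‖ * ‖v.2 - w.2‖ + ‖q t‖ * ‖v.1 - w.1‖ := by
            refine (norm_add_le _ _).trans ?_
            rw [norm_mul, norm_mul]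
        _ ≤ |P| * ‖v - w‖ + |Q| * ‖v - w‖ := by gcongr
        _ ≤ (1 + |P| + |Q|) * ‖v - w‖ := by nlinarith
  have key := ODE_solution_unique_of_mem_Ioo (f := fun t => (f t, f' t)) (g := fun t => (g t, g' t))
    hlip (t₀ := x₀) ⟨ha'.trans_le (min_le_left _ _), (le_max_left _ _).trans_lt hb'⟩
    (fun t ht => ⟨(hf t (hsub' ht)).prodMk (hf' t (hsub' ht)), Set.mem_univ _⟩)
    (fun t ht => ⟨(hg t (hsub' ht)).prodMk (hg' t (hsub' ht)), Set.mem_univ _⟩)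
    (by simp [h0, h1])
  have := key ⟨ha'.trans_le (min_le_right _ _), (le_max_right _ _).trans_lt hb'⟩
  exact (Prod.ext_iff.mp this).1

/-! ### The hypergeometric equation near a singular point -/

/-- `(s)_n = s (s + 1) ⋯ (s + n - 1)`. -/
noncomputable def risingProd (s : ℂ) (n : ℕ) : ℂ := ∏ j ∈ Finset.range n, (s + j)

theorem risingProd_succ (s : ℂ) (n : ℕ) : risingProd s (n + 1) = risingProd s n * (s + n) :=
  Finset.prod_range_succ _ _

theorem risingProd_succ' (s : ℂ) (n : ℕ) : risingProd s (n + 1) = s * risingProd (s + 1) n := by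
  unfold risingProd
  rw [Finset.prod_range_succ', mul_comm]
  congr 1
  · simp
  · refine Finset.prod_congr rfl fun j _ => ?_
    push_cast
    ring

theorem risingProd_ne_zero {s : ℂ} (hs : ∀ j : ℕ, s ≠ -(j : ℂ)) (n : ℕ) : risingProd s n ≠ 0 :=
  Finset.prod_ne_zero_iff.mpr fun j _ h => hs j (eq_neg_of_add_eq_zero_left h)

theorem risingProd_neg_natCast {n m : ℕ} (h : n < m) : risingProd (-(n : ℂ)) m = 0 :=
  Finset.prod_eq_zero (Finset.mem_range.mpr h) (by simp)

/-- The parameters `a + 1`, … of derivatives avoid the poles if `a`, … do. -/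
theorem add_one_ne_neg_natCast {s : ℂ} (hs : ∀ j : ℕ, s ≠ -(j : ℂ)) (j : ℕ) :
    s + 1 ≠ -(j : ℂ) := fun h => hs (j + 1) (by push_cast; linear_combination h)

/-- The left-hand side `x (1 - x) g'' + (c - (a + b + 1) x) g' - a b g` of the hypergeometric
equation. -/
noncomputable def hypergeometricOp (a b c : ℂ) (g : ℝ → ℂ) (x : ℝ) : ℂ :=
  x * (1 - x) * deriv (deriv g) x + (c - (a + b + 1) * x) * deriv g x - a * b * g x

theorem analyticAt_hypergeometricOp {a b c : ℂ} {g : ℝ → ℂ} {x : ℝ} (hg : AnalyticAt ℝ g x) :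
    AnalyticAt ℝ (hypergeometricOp a b c g) x := by
  have h1 := hg.deriv
  have h2 := h1.deriv
  have h0 : AnalyticAt ℝ (fun x : ℝ => (x : ℂ)) x := Complex.ofRealCLM.analyticAt x
  unfold hypergeometricOp
  fun_prop

theorem Filter.EventuallyEq.hypergeometricOp {a b c : ℂ} {f g : ℝ → ℂ} {x : ℝ}
    (h : f =ᶠ[𝓝 x] g) : hypergeometricOp a b c f =ᶠ[𝓝 x] hypergeometricOp a b c g := by
  filter_upwards [h, h.deriv, h.deriv.deriv] with y h0 h1 h2
  simp only [_root_.hypergeometricOp, h0, h1, h2]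

theorem hypergeometricOp_const_mul {a b c k : ℂ} {g : ℝ → ℂ} (x : ℝ) :
    hypergeometricOp a b c (fun y => k * g y) x = k * hypergeometricOp a b c g x := by
  have h1 : deriv (fun y => k * g y) = fun y => k * deriv g y := by
    ext y; exact deriv_const_mul_field k
  simp only [hypergeometricOp, h1, deriv_const_mul_field]
  ring

/-- The derivative of a solution of the hypergeometric equation solves the equation with all
parameters raised by one. -/
theorem hypergeometricOp_deriv_eventuallyEq_zero {a b c : ℂ} {g : ℝ → ℂ} (hg : AnalyticAt ℝ g 0)
    (h : hypergeometricOp a b c g =ᶠ[𝓝 0] 0) :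
    hypergeometricOp (a + 1) (b + 1) (c + 1) (deriv g) =ᶠ[𝓝 0] 0 := by
  filter_upwards [h.deriv, hg.eventually_analyticAt] with x hx hgx
  have d0 := hgx.differentiableAt.hasDerivAt
  have d1 := hgx.deriv.differentiableAt.hasDerivAt
  have d2 := hgx.deriv.deriv.differentiableAt.hasDerivAt
  have dx : HasDerivAt (fun x : ℝ => (x : ℂ)) 1 x := Complex.ofRealCLM.hasDerivAt
  have key : HasDerivAt (hypergeometricOp a b c g) _ x :=
    (((dx.mul (dx.const_sub 1)).mul d2).add
      (((dx.const_mul (a + b + 1)).const_sub c).mul d1)).sub (d0.const_mul (a * b))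
  have h0 : deriv (0 : ℝ → ℂ) x = 0 := by simp
  rw [key.deriv, h0] at hx
  simp only [Pi.mul_apply] at hx
  simp only [hypergeometricOp, Pi.zero_apply]
  linear_combination hx

/-- An analytic solution has the derivatives at `0` that the hypergeometric series prescribes; by
`hypergeometricOp_deriv_eventuallyEq_zero`, each follows from the equation at the point `0`. -/
theorem risingProd_mul_iteratedDeriv {a b c : ℂ} {g : ℝ → ℂ} (hg : AnalyticAt ℝ g 0)
    (h : hypergeometricOp a b c g =ᶠ[𝓝 0] 0) (n : ℕ) :
    risingProd c n * iteratedDeriv n g 0 = risingProd a n * risingProd b n * g 0 := by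
  induction n generalizing a b c g with
  | zero => simp [risingProd]
  | succ n ih =>
    have h1 := ih hg.deriv (hypergeometricOp_deriv_eventuallyEq_zero hg h)
    have h2 : c * deriv g 0 = a * b * g 0 := by
      have := h.self_of_nhds
      simp only [hypergeometricOp, Pi.zero_apply, Complex.ofReal_zero] at this
      linear_combination this
    rw [iteratedDeriv_succ', risingProd_succ', risingProd_succ' a, risingProd_succ' b]
    linear_combination c * h1 + risingProd (a + 1) n * risingProd (b + 1) n * h2

theorem eventuallyEq_zero_of_hypergeometricOp {a b c : ℂ} {g : ℝ → ℂ}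
    (hc : ∀ j : ℕ, c ≠ -(j : ℂ)) (hg : AnalyticAt ℝ g 0)
    (h : hypergeometricOp a b c g =ᶠ[𝓝 0] 0) (h0 : g 0 = 0) : g =ᶠ[𝓝 0] 0 := by
  refine hg.eventuallyEq_of_iteratedDeriv_eq analyticAt_const fun n => ?_
  have h1 := risingProd_mul_iteratedDeriv hg h n
  rw [h0, mul_zero] at h1
  rw [(mul_eq_zero.mp h1).resolve_left (risingProd_ne_zero hc n)]
  change 0 = iteratedDeriv n (fun _ => (0 : ℂ)) 0
  simp

/-! ### The hypergeometric series -/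

/-- The coefficient `(a)_n (b)_n / ((c)_n n!)` of the hypergeometric series. -/
noncomputable def hyperCoeff (a b c : ℂ) (n : ℕ) : ℂ :=
  risingProd a n * risingProd b n / (risingProd c n * n.factorial)

theorem hyperCoeff_ne_zero {a b c : ℂ} (ha : ∀ j : ℕ, a ≠ -(j : ℂ)) (hb : ∀ j : ℕ, b ≠ -(j : ℂ))
    (hc : ∀ j : ℕ, c ≠ -(j : ℂ)) (n : ℕ) : hyperCoeff a b c n ≠ 0 :=
  div_ne_zero (mul_ne_zero (risingProd_ne_zero ha n) (risingProd_ne_zero hb n))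
    (mul_ne_zero (risingProd_ne_zero hc n) (by exact_mod_cast n.factorial_ne_zero))

theorem hyperCoeff_succ {a b c : ℂ} (hc : ∀ j : ℕ, c ≠ -(j : ℂ)) (n : ℕ) :
    (c + n) * (n + 1) * hyperCoeff a b c (n + 1) = (a + n) * (b + n) * hyperCoeff a b c n := by
  have h1 := risingProd_ne_zero hc n
  have h2 : c + n ≠ 0 := fun h => hc n (eq_neg_of_add_eq_zero_left h)
  have h3 : (n.factorial : ℂ) ≠ 0 := by exact_mod_cast n.factorial_ne_zero
  have h4 : (n : ℂ) + 1 ≠ 0 := by exact_mod_cast n.succ_ne_zero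
  simp only [hyperCoeff, risingProd_succ, Nat.factorial_succ]
  push_cast
  field_simp

/-- The Gauss hypergeometric series `₂F₁(a, b; c; x)` at a real argument. -/
noncomputable def hyperF (a b c : ℂ) : ℝ → ℂ := powerSeriesSum (hyperCoeff a b c)

theorem summable_hyperCoeff {a b c : ℂ} (ha : ∀ j : ℕ, a ≠ -(j : ℂ))
    (hb : ∀ j : ℕ, b ≠ -(j : ℂ)) (hc : ∀ j : ℕ, c ≠ -(j : ℂ)) {ρ : ℝ} (hρ : 0 < ρ) (hρ1 : ρ < 1) :
    Summable fun n => ‖hyperCoeff a b c n‖ * ρ ^ n := by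
  refine summable_of_ratio_test_tendsto_lt_one hρ1 (Eventually.of_forall fun n => ?_) ?_
  · exact mul_ne_zero (norm_ne_zero_iff.mpr (hyperCoeff_ne_zero ha hb hc n)) (by positivity)
  · have e1 : Tendsto (fun n : ℕ => (a + 1 * n) / (c + 1 * n)) atTop (𝓝 (1 / 1)) :=
      tendsto_add_mul_div_add_mul_atTop_nhds a c 1 one_ne_zero
    have e2 : Tendsto (fun n : ℕ => (b + 1 * n) / (1 + 1 * n)) atTop (𝓝 (1 / 1)) :=
      tendsto_add_mul_div_add_mul_atTop_nhds b 1 1 one_ne_zero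
    have e3 := ((e1.mul e2).norm.mul_const ρ)
    simp only [div_one, mul_one, norm_one, one_mul] at e3
    refine e3.congr fun n => ?_
    have h1 := hyperCoeff_ne_zero ha hb hc n
    have h2 : c + n ≠ 0 := fun h => hc n (eq_neg_of_add_eq_zero_left h)
    have h4 : (1 : ℂ) + n ≠ 0 := by
      rw [add_comm]; exact_mod_cast n.succ_ne_zero
    have h5 : hyperCoeff a b c (n + 1)
        = (a + n) / (c + n) * ((b + n) / (1 + n)) * hyperCoeff a b c n := by
      have := hyperCoeff_succ (a := a) (b := b) hc n
      field_simp
      linear_combination this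
    have h6 := norm_ne_zero_iff.mpr h1
    rw [h5, norm_mul ((a + n) / (c + n) * ((b + n) / (1 + n))), Real.norm_of_nonneg (by positivity),
      Real.norm_of_nonneg (by positivity), pow_succ]
    field_simp

section

variable {a b c : ℂ} (ha : ∀ j : ℕ, a ≠ -(j : ℂ)) (hb : ∀ j : ℕ, b ≠ -(j : ℂ))
  (hc : ∀ j : ℕ, c ≠ -(j : ℂ))
include ha hb hc

theorem analyticOnNhd_hyperF : AnalyticOnNhd ℝ (hyperF a b c) (Set.Ioo (-1) 1) :=
  analyticOnNhd_powerSeriesSum fun _ h1 h2 => summable_hyperCoeff ha hb hc h1 h2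

theorem iteratedDeriv_hyperF (n : ℕ) :
    iteratedDeriv n (hyperF a b c) 0 = risingProd a n * risingProd b n / risingProd c n := by
  obtain ⟨C, hC⟩ := (summable_hyperCoeff ha hb hc (ρ := 1 / 2) (by norm_num)
    (by norm_num)).tendsto_atTop_zero.bddAbove_range
  have h3 : (n.factorial : ℂ) ≠ 0 := by exact_mod_cast n.factorial_ne_zero
  have h1 := risingProd_ne_zero hc n
  rw [hyperF, iteratedDeriv_powerSeriesSum_zero (ρ := 1 / 2) (by norm_num) fun n => hC ⟨n, rfl⟩,
    hyperCoeff, Complex.real_smul]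
  push_cast
  field_simp

theorem deriv_hyperF : Set.EqOn (deriv (hyperF a b c))
    (fun x => a * b / c * hyperF (a + 1) (b + 1) (c + 1) x) (Set.Ioo (-1) 1) := by
  have ha' := add_one_ne_neg_natCast ha
  have hb' := add_one_ne_neg_natCast hb
  have hc' := add_one_ne_neg_natCast hc
  have h1 := (analyticOnNhd_hyperF ha hb hc).deriv
  have h2 : AnalyticOnNhd ℝ (fun x => a * b / c * hyperF (a + 1) (b + 1) (c + 1) x)
      (Set.Ioo (-1) 1) := analyticOnNhd_const.mul (analyticOnNhd_hyperF ha' hb' hc')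
  have h0 : (0 : ℝ) ∈ Set.Ioo (-1 : ℝ) 1 := by norm_num
  refine h1.eqOn_of_preconnected_of_eventuallyEq h2 isPreconnected_Ioo h0 ?_
  refine (h1 0 h0).eventuallyEq_of_iteratedDeriv_eq (h2 0 h0) fun n => ?_
  have hc0 : c ≠ 0 := by simpa using hc 0
  have := risingProd_ne_zero hc' n
  rw [← iteratedDeriv_succ', iteratedDeriv_hyperF ha hb hc, iteratedDeriv_const_mul_field,
    iteratedDeriv_hyperF ha' hb' hc', risingProd_succ', risingProd_succ' b, risingProd_succ' c]
  field_simp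

end

theorem natCast_add_one_ne_neg (m : ℕ) (j : ℕ) : ((m : ℂ) + 1) ≠ -(j : ℂ) := fun h => by
  have : (m : ℂ) + 1 + j = 0 := by linear_combination h
  exact absurd this (by exact_mod_cast (by omega : m + 1 + j ≠ 0))

theorem one_ne_neg_natCast (j : ℕ) : (1 : ℂ) ≠ -(j : ℂ) := by
  simpa using natCast_add_one_ne_neg 0 j

theorem ne_neg_natCast_of_re_pos {s : ℂ} (hs : 0 < s.re) (j : ℕ) : s ≠ -(j : ℂ) := fun h => by
  rw [h] at hs
  simp at hs
  linarith [(Nat.cast_nonneg j : (0 : ℝ) ≤ j)]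

/-! ### Complex powers of a positive real variable -/

/-- The power `x ^ s` of a real number `x > 0`; for `x ≤ 0` the value has no meaning. -/
noncomputable def powC (x : ℝ) (s : ℂ) : ℂ := Complex.exp (s * (Real.log x : ℂ))

theorem powC_ne_zero (x : ℝ) (s : ℂ) : powC x s ≠ 0 := Complex.exp_ne_zero _

theorem powC_add (x : ℝ) (s t : ℂ) : powC x (s + t) = powC x s * powC x t := by
  simp [powC, add_mul, Complex.exp_add]

theorem powC_neg_mul_self (x : ℝ) (s : ℂ) : powC x (-s) * powC x s = 1 := by
  rw [← powC_add, neg_add_cancel]; simp [powC]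

theorem norm_powC (x : ℝ) (s : ℂ) : ‖powC x s‖ = Real.exp (s.re * Real.log x) := by
  simp [powC, Complex.norm_exp]

theorem hasDerivAt_powC {x : ℝ} (hx : 0 < x) (s : ℂ) :
    HasDerivAt (fun y => powC y s) (s / x * powC x s) x := by
  have h1 := ((Real.hasDerivAt_log hx.ne').ofReal_comp.const_mul s).cexp
  convert! h1 using 1
  simp only [powC]
  push_cast
  ring

theorem hasDerivAt_powC_one_sub {x : ℝ} (hx : x < 1) (s : ℂ) :
    HasDerivAt (fun y : ℝ => powC (1 - y) s) (-(s / (1 - x)) * powC (1 - x) s) x := by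
  have h1 := (hasDerivAt_powC (sub_pos.mpr hx) s).scomp x ((hasDerivAt_id x).const_sub 1)
  convert! h1 using 1
  push_cast
  simp

theorem AnalyticAt.powC {f : ℝ → ℝ} {x : ℝ} (hf : AnalyticAt ℝ f x) (hx : 0 < f x) (s : ℂ) :
    AnalyticAt ℝ (fun y => powC (f y) s) x := by
  have h1 : AnalyticAt ℝ (fun y => (Real.log (f y) : ℂ)) x :=
    (Complex.ofRealCLM.analyticAt _).comp (hf.log hx)
  have h2 : AnalyticAt ℝ Complex.exp (s * (Real.log (f x) : ℂ)) :=
    (Complex.differentiable_exp.analyticAt _).restrictScalars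
  exact h2.fun_comp (f := fun y => s * (Real.log (f y) : ℂ)) (analyticAt_const.mul h1)

/-! ### Growth of the hypergeometric series at `1` -/

/-- The hypergeometric series with `b = c = 1` is the binomial series. -/
theorem hyperF_one_one {σ : ℂ} (hσ : ∀ j : ℕ, σ ≠ -(j : ℂ)) :
    Set.EqOn (hyperF σ 1 1) (fun x => powC (1 - x) (-σ)) (Set.Ioo (-1) 1) := by
  have h1 := analyticOnNhd_hyperF hσ one_ne_neg_natCast one_ne_neg_natCast
  have h2 : AnalyticOnNhd ℝ (fun x => powC (1 - x) (-σ)) (Set.Ioo (-1) 1) := fun x hx =>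
    AnalyticAt.powC (f := fun x => 1 - x) (by fun_prop) (by linarith [hx.2]) _
  have h0 : (0 : ℝ) ∈ Set.Ioo (-1 : ℝ) 1 := by norm_num
  have hd : ∀ (n : ℕ) (s : ℂ), iteratedDeriv n (fun x => powC (1 - x) (-s)) 0 = risingProd s n := by
    intro n
    induction n with
    | zero => intro s; simp [risingProd, powC]
    | succ n ih =>
      intro s
      have he : deriv (fun x : ℝ => powC (1 - x) (-s))
          =ᶠ[𝓝 0] fun x => s * powC (1 - x) (-(s + 1)) := by
        filter_upwards [Iio_mem_nhds (zero_lt_one : (0 : ℝ) < 1)] with x hx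
        have hx1 : (0 : ℝ) < 1 - x := sub_pos.mpr hx
        have hx2 : (1 : ℂ) - x ≠ 0 := by exact_mod_cast hx1.ne'
        have h3 : powC (1 - x) (-s) = powC (1 - x) (-(s + 1)) * (1 - x) := by
          rw [show -s = -(s + 1) + 1 by ring, powC_add]
          congr 1
          simp only [powC, one_mul]
          rw [← Complex.ofReal_exp, Real.exp_log hx1]
          push_cast; ring
        rw [(hasDerivAt_powC_one_sub hx (-s)).deriv, h3]
        field_simp
      rw [iteratedDeriv_succ', he.iteratedDeriv_eq, iteratedDeriv_const_mul_field, ih,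
        risingProd_succ']
  refine h1.eqOn_of_preconnected_of_eventuallyEq h2 isPreconnected_Ioo h0 ?_
  refine (h1 0 h0).eventuallyEq_of_iteratedDeriv_eq (h2 0 h0) fun n => ?_
  rw [iteratedDeriv_hyperF hσ one_ne_neg_natCast one_ne_neg_natCast, hd,
    mul_div_cancel_right₀ _ (risingProd_ne_zero one_ne_neg_natCast n)]

/-- Euler's limit formula for the Gamma function, solved for the rising product. -/
theorem risingProd_succ_eq_gammaSeq {s : ℂ} (hs : ∀ j : ℕ, s ≠ -(j : ℂ)) {n : ℕ} (hn : n ≠ 0) :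
    risingProd s (n + 1) = (n : ℂ) ^ s * n.factorial / Complex.GammaSeq s n ∧
      Complex.GammaSeq s n ≠ 0 := by
  have h1 := risingProd_ne_zero hs (n + 1)
  have h2 : (n : ℂ) ^ s ≠ 0 := by simp [Complex.cpow_eq_zero_iff, hn]
  have h3 : (n.factorial : ℂ) ≠ 0 := by exact_mod_cast n.factorial_ne_zero
  have h4 : Complex.GammaSeq s n = (n : ℂ) ^ s * n.factorial / risingProd s (n + 1) := rfl
  rw [h4]
  exact ⟨by field_simp, div_ne_zero (mul_ne_zero h2 h3) h1⟩

theorem tendsto_hyperCoeff_div {a b c : ℂ} (ha : ∀ j : ℕ, a ≠ -(j : ℂ))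
    (hb : ∀ j : ℕ, b ≠ -(j : ℂ)) (hc : ∀ j : ℕ, c ≠ -(j : ℂ)) (hσ : 0 < (a + b - c).re) :
    ∃ L : ℂ, L ≠ 0 ∧ Tendsto (fun n => hyperCoeff a b c (n + 1) / hyperCoeff (a + b - c) 1 1 (n + 1))
      atTop (𝓝 L) := by
  have hs := ne_neg_natCast_of_re_pos hσ
  have G := Complex.GammaSeq_tendsto_Gamma
  have gne : ∀ {s : ℂ}, (∀ j : ℕ, s ≠ -(j : ℂ)) → Complex.Gamma s ≠ 0 :=
    fun h => Complex.Gamma_ne_zero h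
  refine ⟨Complex.Gamma c * Complex.Gamma (a + b - c) / (Complex.Gamma a * Complex.Gamma b),
    div_ne_zero (mul_ne_zero (gne hc) (gne hs)) (mul_ne_zero (gne ha) (gne hb)), ?_⟩
  refine (((G c).mul (G _)).div ((G a).mul (G b)) (mul_ne_zero (gne ha) (gne hb))).congr' ?_
  filter_upwards [eventually_ne_atTop 0] with n hn
  obtain ⟨ea, ga⟩ := risingProd_succ_eq_gammaSeq ha hn
  obtain ⟨eb, gb⟩ := risingProd_succ_eq_gammaSeq hb hn
  obtain ⟨ec, gc⟩ := risingProd_succ_eq_gammaSeq hc hn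
  obtain ⟨es, gs⟩ := risingProd_succ_eq_gammaSeq hs hn
  have hn' : (n : ℂ) ≠ 0 := by exact_mod_cast hn
  have h2 : ∀ s : ℂ, (n : ℂ) ^ s ≠ 0 := fun s => by simp [Complex.cpow_eq_zero_iff, hn]
  have h3 : (n.factorial : ℂ) ≠ 0 := by exact_mod_cast n.factorial_ne_zero
  have h4 : ((n + 1).factorial : ℂ) ≠ 0 := by exact_mod_cast (n + 1).factorial_ne_zero
  have h5 := risingProd_ne_zero one_ne_neg_natCast (n + 1)
  have h6 : (n : ℂ) ^ (a + b - c) = (n : ℂ) ^ a * (n : ℂ) ^ b / (n : ℂ) ^ c := by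
    rw [Complex.cpow_sub _ _ hn', Complex.cpow_add _ _ hn']
  have := h2 a; have := h2 b; have := h2 c
  rw [hyperCoeff, hyperCoeff, ea, eb, ec, es, h6, Pi.div_apply]
  field_simp

theorem exists_tendsto_norm_hyperCoeff_div_re {σ : ℂ} (hσ : 0 < σ.re) :
    ∃ L : ℝ, Tendsto (fun n => ‖hyperCoeff σ 1 1 (n + 1)‖ / ‖hyperCoeff σ.re 1 1 (n + 1)‖)
      atTop (𝓝 L) := by
  have hr : 0 < ((σ.re : ℝ) : ℂ).re := by simpa using hσ
  have hs := ne_neg_natCast_of_re_pos hσ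
  have hs' := ne_neg_natCast_of_re_pos hr
  have G := Complex.GammaSeq_tendsto_Gamma
  refine ⟨_, (((G σ.re).norm.div (G σ).norm ?_)).congr' ?_⟩
  · exact norm_ne_zero_iff.mpr (Complex.Gamma_ne_zero hs)
  filter_upwards [eventually_gt_atTop 0] with n hn
  obtain ⟨ea, ga⟩ := risingProd_succ_eq_gammaSeq hs hn.ne'
  obtain ⟨eb, gb⟩ := risingProd_succ_eq_gammaSeq hs' hn.ne'
  have h3 : (n.factorial : ℂ) ≠ 0 := by exact_mod_cast n.factorial_ne_zero
  have h4 : ((n + 1).factorial : ℂ) ≠ 0 := by exact_mod_cast (n + 1).factorial_ne_zero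
  have h5 := risingProd_ne_zero one_ne_neg_natCast (n + 1)
  have h6 : ‖(n : ℂ) ^ σ‖ = ‖(n : ℂ) ^ ((σ.re : ℝ) : ℂ)‖ := by
    rw [Complex.norm_natCast_cpow_of_pos hn, Complex.norm_natCast_cpow_of_pos hn, Complex.ofReal_re]
  have h7 : ‖(n : ℂ) ^ ((σ.re : ℝ) : ℂ)‖ ≠ 0 := by
    rw [Complex.norm_natCast_cpow_of_pos hn]; positivity
  rw [hyperCoeff, hyperCoeff, ea, eb, Pi.div_apply]
  simp only [norm_mul, norm_div, h6]
  have := norm_ne_zero_iff.mpr h3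
  have := norm_ne_zero_iff.mpr h4
  have := norm_ne_zero_iff.mpr h5
  have := norm_ne_zero_iff.mpr ga
  have := norm_ne_zero_iff.mpr gb
  field_simp

/-- For a positive parameter the binomial series has positive coefficients. -/
theorem hasSum_norm_hyperCoeff_one_one {ρ : ℝ} (hρ : 0 < ρ) {x : ℝ} (hx : x ∈ Set.Ioo (0 : ℝ) 1) :
    HasSum (fun n => ‖hyperCoeff ρ 1 1 n‖ * x ^ n) (Real.exp (-ρ * Real.log (1 - x))) := by
  have hs := ne_neg_natCast_of_re_pos (s := (ρ : ℂ)) (by simpa using hρ)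
  have hsum := summable_hyperCoeff hs one_ne_neg_natCast one_ne_neg_natCast hx.1 hx.2
  have hF : hyperF ρ 1 1 x = powC (1 - x) (-ρ) :=
    hyperF_one_one hs (x := x) ⟨by linarith [hx.1], hx.2⟩
  have hnn : ∀ n, hyperCoeff ρ 1 1 n = ((‖hyperCoeff ρ 1 1 n‖ : ℝ) : ℂ) := by
    intro n
    have : hyperCoeff ρ 1 1 n
        = (((∏ j ∈ Finset.range n, (ρ + j)) / n.factorial : ℝ) : ℂ) := by
      have h5 := risingProd_ne_zero one_ne_neg_natCast n
      rw [hyperCoeff, mul_comm (risingProd 1 n), mul_div_mul_right _ _ h5]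
      simp [risingProd]
    rw [this, Complex.norm_real, Real.norm_of_nonneg]
    positivity
  have h1 : ((∑' n, ‖hyperCoeff ρ 1 1 n‖ * x ^ n : ℝ) : ℂ) = powC (1 - x) (-ρ) := by
    rw [← hF, hyperF, powerSeriesSum, Complex.ofReal_tsum]
    refine tsum_congr fun n => ?_
    conv_rhs => rw [hnn n]
    rw [Complex.real_smul]
    push_cast
    ring
  convert! hsum.hasSum using 1
  have h2 : ((Real.exp (-ρ * Real.log (1 - x)) : ℝ) : ℂ) = powC (1 - x) (-ρ) := by
    simp [powC]
  exact_mod_cast h2.trans h1.symm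

/-- The coefficients are asymptotic to a nonzero multiple of those of `(1 - x) ^ (c - a - b)`, so
the series is unbounded at `1` when `Re (c - a - b) < 0`. -/
theorem tendsto_norm_hyperF_atTop {a b c : ℂ} (ha : ∀ j : ℕ, a ≠ -(j : ℂ))
    (hb : ∀ j : ℕ, b ≠ -(j : ℂ)) (hc : ∀ j : ℕ, c ≠ -(j : ℂ)) (hσ : 0 < (a + b - c).re) :
    Tendsto (fun x => ‖hyperF a b c x‖) (𝓝[<] 1) atTop := by
  set σ := a + b - c with hσdef
  set ρ := σ.re with hρdef
  have hs := ne_neg_natCast_of_re_pos hσ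
  have hs' := ne_neg_natCast_of_re_pos (s := (ρ : ℂ)) (by simpa using hσ)
  obtain ⟨L, hL0, hL⟩ := tendsto_hyperCoeff_div ha hb hc hσ
  obtain ⟨M, hM⟩ := exists_tendsto_norm_hyperCoeff_div_re hσ
  set t := hyperCoeff a b c with ht
  set s := hyperCoeff σ 1 1 with hsdef
  set p := hyperCoeff ρ 1 1 with hp
  have hs0 : ∀ n, s n ≠ 0 := hyperCoeff_ne_zero hs one_ne_neg_natCast one_ne_neg_natCast
  have hp0 : ∀ n, 0 < ‖p n‖ := fun n =>
    norm_pos_iff.mpr (hyperCoeff_ne_zero hs' one_ne_neg_natCast one_ne_neg_natCast n)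
  have hLpos : 0 < ‖L‖ := norm_pos_iff.mpr hL0
  have hsmall : ∀ᶠ n in atTop, ‖t n - L * s n‖ ≤ ‖L‖ / 2 * ‖p n‖ := by
    have h1 : Tendsto (fun n => ‖t (n + 1) / s (n + 1) - L‖ * (‖s (n + 1)‖ / ‖p (n + 1)‖)) atTop
        (𝓝 (‖L - L‖ * M)) := (hL.sub_const L).norm.mul hM
    rw [sub_self, norm_zero, zero_mul] at h1
    have h2 := h1.eventually (gt_mem_nhds (half_pos hLpos))
    rw [← eventually_map (m := fun n => n + 1)
      (P := fun n => ‖t n / s n - L‖ * (‖s n‖ / ‖p n‖) < ‖L‖ / 2), map_add_atTop_eq_nat] at h2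
    filter_upwards [h2] with n hn
    have h3 : ‖t n - L * s n‖ = ‖t n / s n - L‖ * (‖s n‖ / ‖p n‖) * ‖p n‖ := by
      have := (hp0 n).ne'
      have := hs0 n
      rw [mul_assoc, div_mul_cancel₀ _ (hp0 n).ne', ← norm_mul, sub_mul, div_mul_cancel₀ _ (hs0 n)]
    rw [h3]
    exact mul_le_mul_of_nonneg_right hn.le (hp0 n).le
  obtain ⟨N, hN⟩ := eventually_atTop.mp hsmall
  set K := ∑ n ∈ Finset.range N, ‖t n - L * s n‖ with hK
  have hlower : ∀ x ∈ Set.Ioo (0 : ℝ) 1,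
      ‖L‖ / 2 * Real.exp (-ρ * Real.log (1 - x)) - K ≤ ‖hyperF a b c x‖ := by
    intro x hx
    have hx' : x ∈ Set.Ioo (-1 : ℝ) 1 := ⟨by linarith [hx.1], hx.2⟩
    have sum_of : ∀ {u : ℕ → ℂ}, (Summable fun n => ‖u n‖ * x ^ n) →
        Summable fun n => x ^ n • u n := fun {u} h => by
      refine Summable.of_norm (h.congr fun n => ?_)
      rw [norm_smul, norm_pow, Real.norm_of_nonneg hx.1.le, mul_comm]
    have st := sum_of (summable_hyperCoeff ha hb hc hx.1 hx.2)
    have ss := sum_of (summable_hyperCoeff hs one_ne_neg_natCast one_ne_neg_natCast hx.1 hx.2)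
    have hdiff : HasSum (fun n => x ^ n • (t n - L * s n))
        (hyperF a b c x - L * powC (1 - x) (-σ)) := by
      have hF : hyperF σ 1 1 x = powC (1 - x) (-σ) := hyperF_one_one hs hx'
      rw [← hF]
      convert! st.hasSum.sub (ss.hasSum.mul_left L) using 2 with n
      rw [smul_sub, mul_smul_comm]
    have hbound : HasSum (fun n => (if n ∈ Finset.range N then ‖t n - L * s n‖ else 0)
        + ‖L‖ / 2 * (‖p n‖ * x ^ n)) (K + ‖L‖ / 2 * Real.exp (-ρ * Real.log (1 - x))) := by
      refine HasSum.add ?_ ((hasSum_norm_hyperCoeff_one_one hσ hx).mul_left _)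
      rw [hK, ← Finset.sum_congr rfl fun n hn => if_pos hn]
      exact hasSum_sum_of_ne_finset_zero fun n hn => if_neg hn
    have hle : ‖hyperF a b c x - L * powC (1 - x) (-σ)‖
        ≤ K + ‖L‖ / 2 * Real.exp (-ρ * Real.log (1 - x)) := by
      rw [← hdiff.tsum_eq]
      refine tsum_of_norm_bounded hbound fun n => ?_
      have hxn : 0 ≤ x ^ n := pow_nonneg hx.1.le n
      have hxn1 : x ^ n ≤ 1 := pow_le_one₀ hx.1.le hx.2.le
      rw [norm_smul, Real.norm_of_nonneg hxn]
      by_cases hn : n ∈ Finset.range N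
      · rw [if_pos hn]
        have h1 : x ^ n * ‖t n - L * s n‖ ≤ ‖t n - L * s n‖ :=
          mul_le_of_le_one_left (norm_nonneg _) hxn1
        have h2 : 0 ≤ ‖L‖ / 2 * (‖p n‖ * x ^ n) := by positivity
        linarith
      · rw [if_neg hn, zero_add]
        have h1 := hN n (by simpa using hn)
        calc x ^ n * ‖t n - L * s n‖ ≤ x ^ n * (‖L‖ / 2 * ‖p n‖) := by gcongr
          _ = ‖L‖ / 2 * (‖p n‖ * x ^ n) := by ring
    have hv : ‖L * powC (1 - x) (-σ)‖ = ‖L‖ * Real.exp (-ρ * Real.log (1 - x)) := by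
      rw [norm_mul, norm_powC, Complex.neg_re]
    have h3 := norm_sub_norm_le (L * powC (1 - x) (-σ)) (hyperF a b c x)
    rw [norm_sub_rev, hv] at h3
    linarith
  have hexp : Tendsto (fun x : ℝ => ‖L‖ / 2 * Real.exp (-ρ * Real.log (1 - x)) - K)
      (𝓝[<] 1) atTop := by
    have h1 : Tendsto (fun x : ℝ => 1 - x) (𝓝[<] 1) (𝓝[>] 0) := by
      refine tendsto_nhdsWithin_iff.mpr ⟨?_, ?_⟩
      · have : Tendsto (fun x : ℝ => 1 - x) (𝓝 1) (𝓝 (1 - 1)) :=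
          (continuous_const.sub continuous_id).tendsto 1
        rw [sub_self] at this
        exact this.mono_left nhdsWithin_le_nhds
      · filter_upwards [self_mem_nhdsWithin] with x hx
        exact sub_pos.mpr (Set.mem_Iio.mp hx)
    have h2 := Real.tendsto_log_nhdsGT_zero.comp h1
    have h3 := Real.tendsto_exp_atTop.comp (h2.const_mul_atBot_of_neg (neg_neg_of_pos hσ))
    exact tendsto_atTop_add_const_right _ (-K) (h3.const_mul_atTop (half_pos hLpos))
  refine tendsto_atTop_mono' _ ?_ hexp
  filter_upwards [Ioo_mem_nhdsLT (zero_lt_one : (0 : ℝ) < 1)] with x hx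
  exact hlower x hx

/-- A hypergeometric series that does not terminate is singular at `1`: differentiating lowers
`Re (c - a - b)`, so that some derivative is unbounded there. -/
theorem not_analyticAt_one_hyperF {a b c : ℂ} (ha : ∀ j : ℕ, a ≠ -(j : ℂ))
    (hb : ∀ j : ℕ, b ≠ -(j : ℂ)) (hc : ∀ j : ℕ, c ≠ -(j : ℂ)) {g : ℝ → ℂ}
    (hg : AnalyticAt ℝ g 1) : ¬ hyperF a b c =ᶠ[𝓝[<] 1] g := by
  obtain ⟨k, hk⟩ := exists_nat_gt (-(a + b - c).re)
  replace hk : 0 < (a + b - c).re + k := by linarith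
  induction k generalizing a b c g with
  | zero =>
    intro h
    have h1 := tendsto_norm_hyperF_atTop ha hb hc (by simpa using hk)
    have h2 : Tendsto (fun x => ‖g x‖) (𝓝[<] 1) (𝓝 ‖g 1‖) :=
      (hg.continuousAt.tendsto.mono_left nhdsWithin_le_nhds).norm
    refine not_tendsto_nhds_of_tendsto_atTop h1 _ (h2.congr' ?_)
    filter_upwards [h] with x hx
    rw [hx]
  | succ k ih =>
    intro h
    have ha0 : a ≠ 0 := by simpa using ha 0
    have hb0 : b ≠ 0 := by simpa using hb 0
    have hc0 : c ≠ 0 := by simpa using hc 0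
    refine ih (add_one_ne_neg_natCast ha) (add_one_ne_neg_natCast hb) (add_one_ne_neg_natCast hc)
      (g := fun x => c / (a * b) * deriv g x) (analyticAt_const.mul hg.deriv) ?_ ?_
    · push_cast at hk
      simp at hk ⊢
      linarith
    · obtain ⟨l, hl, hsub⟩ := (mem_nhdsLT_iff_exists_Ioo_subset' (zero_lt_one : (0 : ℝ) < 1)).mp
        h
      filter_upwards [Ioo_mem_nhdsLT hl, Ioo_mem_nhdsLT (zero_lt_one : (0 : ℝ) < 1)] with x hx hx0
      have he : hyperF a b c =ᶠ[𝓝 x] g := by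
        filter_upwards [isOpen_Ioo.mem_nhds hx] with y hy
        exact hsub hy
      have h1 := deriv_hyperF ha hb hc (x := x) ⟨by linarith [hx0.1], hx0.2⟩
      rw [he.deriv_eq] at h1
      simp only [h1]
      field_simp

/-! ### Solutions of the hypergeometric equation that are regular at both ends of `(0, 1)` -/

/-- `u` solves the hypergeometric equation on `(0, 1)`, with first derivative `u'` and second
derivative `u''`. -/
def SolvesHypergeometric (a b c : ℂ) (u u' u'' : ℝ → ℂ) : Prop :=
  ∀ x ∈ Set.Ioo (0 : ℝ) 1, HasDerivAt u (u' x) x ∧ HasDerivAt u' (u'' x) x ∧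
    x * (1 - x) * u'' x + (c - (a + b + 1) * x) * u' x - a * b * u x = 0

/-- If a solution on `(0, 1)` continues analytically to `0`, the continuation solves the equation
in a full neighbourhood of `0`. -/
theorem SolvesHypergeometric.hypergeometricOp_germ_eq_zero {a b c : ℂ} {u u' u'' g : ℝ → ℂ}
    (hu : SolvesHypergeometric a b c u u' u'') (hg : AnalyticAt ℝ g 0) (h : u =ᶠ[𝓝[>] 0] g) :
    hypergeometricOp a b c g =ᶠ[𝓝 0] 0 := by
  obtain ⟨ε, hε, hsub⟩ := (mem_nhdsGT_iff_exists_Ioo_subset' (zero_lt_one : (0 : ℝ) < 1)).mp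
    (inter_mem h (Ioo_mem_nhdsGT (zero_lt_one : (0 : ℝ) < 1)))
  have hz : ∀ x ∈ Set.Ioo 0 ε, hypergeometricOp a b c g x = 0 := by
    intro x hx
    have hn : Set.Ioo 0 ε ∈ 𝓝 x := isOpen_Ioo.mem_nhds hx
    have e0 : ∀ y ∈ Set.Ioo 0 ε, u =ᶠ[𝓝 y] g := fun y hy => by
      filter_upwards [isOpen_Ioo.mem_nhds hy] with z hz using (hsub hz).1
    have e1 : ∀ y ∈ Set.Ioo 0 ε, deriv g y = u' y := fun y hy => by
      rw [← (e0 y hy).deriv_eq, (hu y (hsub hy).2).1.deriv]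
    have e2 : deriv (deriv g) x = u'' x := by
      have : deriv g =ᶠ[𝓝 x] u' := by
        filter_upwards [hn] with y hy using e1 y hy
      rw [this.deriv_eq, (hu x (hsub hx).2).2.1.deriv]
    have e3 := (hu x (hsub hx).2).2.2
    rw [hypergeometricOp, e2, e1 x hx, ← (e0 x hx).self_of_nhds, e3]
  refine (analyticAt_hypergeometricOp hg).frequently_zero_iff_eventually_zero.mp ?_
  have hev : ∀ᶠ x in 𝓝[>] (0 : ℝ), hypergeometricOp a b c g x = 0 := by
    filter_upwards [Ioo_mem_nhdsGT hε] with x hx using hz x hx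
  exact hev.frequently.filter_mono (nhdsWithin_mono _ fun x hx => ne_of_gt hx)

/-- The solution regular at `0` is proportional to the hypergeometric series, all the way
to `1`. -/
theorem SolvesHypergeometric.eqOn_hyperF {a b c : ℂ} {u u' u'' g : ℝ → ℂ}
    (hu : SolvesHypergeometric a b c u u' u'')
    (ha : ∀ j : ℕ, a ≠ -(j : ℂ)) (hb : ∀ j : ℕ, b ≠ -(j : ℂ)) (hc : ∀ j : ℕ, c ≠ -(j : ℂ))
    (hg : AnalyticAt ℝ g 0) (hg0 : g 0 ≠ 0) (h : u =ᶠ[𝓝[>] 0] g) :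
    Set.EqOn u (fun x => g 0 * hyperF a b c x) (Set.Ioo 0 1) := by
  have hop := hu.hypergeometricOp_germ_eq_zero hg h
  have hF := analyticOnNhd_hyperF ha hb hc
  have h0 : (0 : ℝ) ∈ Set.Ioo (-1 : ℝ) 1 := by norm_num
  -- The series has no need to be differentiated termwise: it solves the equation near `0` because
  -- `g` does, and hence on `(-1, 1)` by analytic continuation.
  have hgF : g =ᶠ[𝓝 0] fun x => g 0 * hyperF a b c x := by
    refine hg.eventuallyEq_of_iteratedDeriv_eq (analyticAt_const.mul (hF 0 h0)) fun n => ?_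
    have h1 := risingProd_mul_iteratedDeriv hg hop n
    have h2 := risingProd_ne_zero hc n
    rw [iteratedDeriv_const_mul_field, iteratedDeriv_hyperF ha hb hc]
    field_simp
    linear_combination h1
  have hopF : Set.EqOn (hypergeometricOp a b c (hyperF a b c)) 0 (Set.Ioo (-1) 1) := by
    refine AnalyticOnNhd.eqOn_zero_of_preconnected_of_eventuallyEq_zero
      (fun x hx => analyticAt_hypergeometricOp (hF x hx)) isPreconnected_Ioo h0 ?_
    filter_upwards [hgF.hypergeometricOp, hop] with x h1 h2
    rw [h2, hypergeometricOp_const_mul, Pi.zero_apply, eq_comm] at h1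
    exact (mul_eq_zero.mp h1).resolve_left hg0
  obtain ⟨ε, hε, hsub⟩ := (mem_nhdsGT_iff_exists_Ioo_subset' (zero_lt_one : (0 : ℝ) < 1)).mp
    (inter_mem (h.trans (hgF.filter_mono nhdsWithin_le_nhds))
      (Ioo_mem_nhdsGT (zero_lt_one : (0 : ℝ) < 1)))
  obtain ⟨x₀, hx₀⟩ : ∃ x₀, x₀ ∈ Set.Ioo 0 ε := ⟨ε / 2, half_pos (Set.mem_Ioi.mp hε), by
    have : (0 : ℝ) < ε := hε
    linarith⟩
  have hlin : ∀ x ∈ Set.Ioo (0 : ℝ) 1, ∀ v v' v'' : ℂ,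
      x * (1 - x) * v'' + (c - (a + b + 1) * x) * v' - a * b * v = 0 →
      v'' = -(c - (a + b + 1) * x) / (x * (1 - x)) * v' + a * b / (x * (1 - x)) * v := by
    intro x hx v v' v'' hv
    have h1 : (x : ℂ) ≠ 0 := by exact_mod_cast hx.1.ne'
    have h2 : (1 : ℂ) - x ≠ 0 := by exact_mod_cast (sub_pos.mpr hx.2).ne'
    field_simp
    linear_combination hv
  have hcont : ∀ k : ℝ → ℂ, Continuous k →
      ContinuousOn (fun x : ℝ => k x / ((x : ℂ) * (1 - x))) (Set.Ioo 0 1) := by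
    intro k hk
    refine hk.continuousOn.div (by fun_prop) fun x hx => ?_
    have h1 : (x : ℂ) ≠ 0 := by exact_mod_cast hx.1.ne'
    have h2 : (1 : ℂ) - x ≠ 0 := by exact_mod_cast (sub_pos.mpr hx.2).ne'
    exact mul_ne_zero h1 h2
  have hsub' : Set.Ioo (0 : ℝ) 1 ⊆ Set.Ioo (-1) 1 := Set.Ioo_subset_Ioo_left (by norm_num)
  refine eqOn_of_hasDerivAt_linear_second_order (x₀ := x₀) (f' := u')
    (g' := fun x => g 0 * deriv (hyperF a b c) x)
    (hcont (fun x => -(c - (a + b + 1) * x)) (by fun_prop)) (hcont (fun _ => a * b) (by fun_prop))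
    (fun x hx => (hu x hx).1) (fun x hx => ?_) (fun x hx => ?_) (fun x hx => ?_)
    (hsub hx₀).2 (hsub hx₀).1 ?_
  · rw [← hlin x hx _ _ _ (hu x hx).2.2]
    exact (hu x hx).2.1
  · exact (hF x (hsub' hx)).differentiableAt.hasDerivAt.const_mul _
  · have h1 := hopF (hsub' hx)
    rw [Pi.zero_apply, hypergeometricOp] at h1
    have h2 := ((hF x (hsub' hx)).deriv.differentiableAt.hasDerivAt).const_mul (g 0)
    rw [hlin x hx _ _ _ h1] at h2
    convert! h2 using 1
    ring
  · have he : u =ᶠ[𝓝 x₀] fun x => g 0 * hyperF a b c x := by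
      filter_upwards [isOpen_Ioo.mem_nhds hx₀] with y hy using (hsub hy).1
    rw [← (hu x₀ (hsub hx₀).2).1.deriv, he.deriv_eq, deriv_const_mul_field]

/-- A solution analytic at both ends of `(0, 1)`, and nonzero at `0`, exists only if the
hypergeometric series terminates. -/
theorem exists_nat_of_solvesHypergeometric {a b c : ℂ} {u u' u'' g₀ g₁ : ℝ → ℂ}
    (hu : SolvesHypergeometric a b c u u' u'') (hc : ∀ j : ℕ, c ≠ -(j : ℂ))
    (hg₀ : AnalyticAt ℝ g₀ 0) (hg₀0 : g₀ 0 ≠ 0) (h₀ : ∀ᶠ x in 𝓝[>] 0, u x = g₀ x)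
    (hg₁ : AnalyticAt ℝ g₁ 0) (h₁ : ∀ᶠ x in 𝓝[>] 0, u (1 - x) = g₁ x) :
    ∃ n : ℕ, a = -(n : ℂ) ∨ b = -(n : ℂ) := by
  by_contra! hcon
  have ha : ∀ j : ℕ, a ≠ -(j : ℂ) := fun j => (hcon j).1
  have hb : ∀ j : ℕ, b ≠ -(j : ℂ) := fun j => (hcon j).2
  have he := hu.eqOn_hyperF ha hb hc hg₀ hg₀0 h₀
  have hg : AnalyticAt ℝ (fun x => (g₀ 0)⁻¹ * g₁ (1 - x)) 1 :=
    analyticAt_const.mul (AnalyticAt.fun_comp (f := fun x : ℝ => 1 - x) (by simpa using hg₁)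
      (by fun_prop))
  refine not_analyticAt_one_hyperF ha hb hc hg ?_
  have ht : Tendsto (fun x : ℝ => 1 - x) (𝓝[<] 1) (𝓝[>] 0) := by
    refine tendsto_nhdsWithin_iff.mpr ⟨?_, ?_⟩
    · have : Tendsto (fun x : ℝ => 1 - x) (𝓝 1) (𝓝 (1 - 1)) :=
        (continuous_const.sub continuous_id).tendsto 1
      rw [sub_self] at this
      exact this.mono_left nhdsWithin_le_nhds
    · filter_upwards [self_mem_nhdsWithin] with x hx
      exact sub_pos.mpr (Set.mem_Iio.mp hx)
  filter_upwards [ht.eventually h₁, Ioo_mem_nhdsLT (zero_lt_one : (0 : ℝ) < 1)] with x h1 h2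
  rw [sub_sub_cancel, he h2] at h1
  rw [← h1]
  field_simp

/-! ### Hypergeometric polynomials -/

/-- The hypergeometric series with `a = -n`, which terminates. -/
noncomputable def hyperPoly (n : ℕ) (b c : ℂ) : Polynomial ℂ :=
  ∑ j ∈ Finset.range (n + 1), Polynomial.monomial j (hyperCoeff (-(n : ℂ)) b c j)

open Polynomial in
theorem coeff_hyperPoly (n : ℕ) (b c : ℂ) (m : ℕ) :
    (hyperPoly n b c).coeff m = hyperCoeff (-(n : ℂ)) b c m := by
  simp only [hyperPoly, finsetSum_coeff, coeff_monomial, Finset.sum_ite_eq', Finset.mem_range]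
  split_ifs with h
  · rfl
  · rw [hyperCoeff, risingProd_neg_natCast (by omega)]
    simp

open Polynomial in
theorem hyperPoly_equation (n : ℕ) (b : ℂ) {c : ℂ} (hc : ∀ j : ℕ, c ≠ -(j : ℂ)) :
    X * (1 - X) * derivative (derivative (hyperPoly n b c)) +
      (C c - C (-(n : ℂ) + b + 1) * X) * derivative (hyperPoly n b c) -
      C (-(n : ℂ) * b) * hyperPoly n b c = 0 := by
  set P := hyperPoly n b c with hP
  have h1 : X * (1 - X) * derivative (derivative P) + (C c - C (-(n : ℂ) + b + 1) * X) * derivative P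
      - C (-(n : ℂ) * b) * P = X * derivative (derivative P) - X * (X * derivative (derivative P))
      + C c * derivative P - C (-(n : ℂ) + b + 1) * (X * derivative P) - C (-(n : ℂ) * b) * P := by
    ring
  rw [h1]
  ext m
  have hrec := hyperCoeff_succ (a := -(n : ℂ)) (b := b) hc
  rcases m with _ | _ | m
  · have := hrec 0
    simp [coeff_derivative, hP, coeff_hyperPoly] at this ⊢
    linear_combination this
  · have := hrec 1
    simp only [coeff_sub, coeff_add, coeff_X_mul, coeff_C_mul, coeff_derivative, hP,
      coeff_hyperPoly, coeff_zero, mul_coeff_zero, coeff_X_zero, zero_mul]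
    push_cast at this ⊢
    linear_combination this
  · have := hrec (m + 2)
    simp only [coeff_sub, coeff_add, coeff_X_mul, coeff_C_mul, coeff_derivative, hP,
      coeff_hyperPoly, coeff_zero]
    push_cast at this ⊢
    linear_combination this

theorem hyperPoly_eval_zero (n : ℕ) (b c : ℂ) : (hyperPoly n b c).eval 0 = 1 := by
  rw [← Polynomial.coeff_zero_eq_eval_zero, coeff_hyperPoly]
  simp [hyperCoeff, risingProd]

theorem Polynomial.analyticAt_eval_ofReal (P : Polynomial ℂ) {f : ℝ → ℝ} {x : ℝ}
    (hf : AnalyticAt ℝ f x) : AnalyticAt ℝ (fun y => P.eval (f y : ℂ)) x := by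
  have h1 : AnalyticAt ℝ (fun z : ℂ => P.eval z) (f x) :=
    (P.differentiable.analyticAt _).restrictScalars
  exact h1.fun_comp (f := fun y => (f y : ℂ)) ((Complex.ofRealCLM.analyticAt _).fun_comp hf)

theorem solvesHypergeometric_hyperPoly (n : ℕ) (b : ℂ) {c : ℂ} (hc : ∀ j : ℕ, c ≠ -(j : ℂ)) :
    SolvesHypergeometric (-(n : ℂ)) b c (fun x => (hyperPoly n b c).eval (x : ℂ))
      (fun x => (hyperPoly n b c).derivative.eval (x : ℂ))
      (fun x => (hyperPoly n b c).derivative.derivative.eval (x : ℂ)) := by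
  intro x _
  refine ⟨(Polynomial.hasDerivAt _ _).comp_ofReal, (Polynomial.hasDerivAt _ _).comp_ofReal, ?_⟩
  have := congrArg (Polynomial.eval (x : ℂ)) (hyperPoly_equation n b hc)
  simpa only [Polynomial.eval_add, Polynomial.eval_sub, Polynomial.eval_mul, Polynomial.eval_C,
    Polynomial.eval_X, Polynomial.eval_one, Polynomial.eval_zero] using this

/-- Reflected at `x ↦ 1 - x`, the polynomial solves the hypergeometric equation with `c` replaced
by `a + b - c + 1`; it would vanish identically if it vanished at `1`. -/
theorem hyperPoly_eval_one_ne_zero (n : ℕ) {b c : ℂ} (hc : ∀ j : ℕ, c ≠ -(j : ℂ))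
    (hc' : ∀ j : ℕ, -(n : ℂ) + b - c + 1 ≠ -(j : ℂ)) : (hyperPoly n b c).eval 1 ≠ 0 := by
  intro h1
  set P := hyperPoly n b c with hP
  have hd : ∀ (Q : Polynomial ℂ) (x : ℝ), HasDerivAt (fun y : ℝ => Q.eval ((1 - y : ℝ) : ℂ))
      (-(Q.derivative.eval ((1 - x : ℝ) : ℂ))) x := by
    intro Q x
    exact HasDerivAt.comp_const_sub 1 x (Q.hasDerivAt ((1 - x : ℝ) : ℂ)).comp_ofReal
  set g : ℝ → ℂ := fun y => P.eval ((1 - y : ℝ) : ℂ) with hg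
  have hga : AnalyticOnNhd ℝ g Set.univ := fun x _ =>
    P.analyticAt_eval_ofReal (f := fun y => 1 - y) (by fun_prop)
  have e1 : deriv g = fun x => -(P.derivative.eval ((1 - x : ℝ) : ℂ)) :=
    funext fun x => (hd P x).deriv
  have e2 : deriv (deriv g) = fun x => P.derivative.derivative.eval ((1 - x : ℝ) : ℂ) := by
    rw [e1]
    exact funext fun x => by simpa using (hd P.derivative x).neg.deriv
  have hop : hypergeometricOp (-(n : ℂ)) b (-(n : ℂ) + b - c + 1) g =ᶠ[𝓝 0] 0 := by
    refine Eventually.of_forall fun x => ?_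
    have := congrArg (Polynomial.eval ((1 - x : ℝ) : ℂ)) (hyperPoly_equation n b hc)
    simp only [Polynomial.eval_add, Polynomial.eval_sub, Polynomial.eval_mul, Polynomial.eval_C,
      Polynomial.eval_X, Polynomial.eval_one, Polynomial.eval_zero, ← hP] at this
    rw [Pi.zero_apply, hypergeometricOp, e2, e1, hg]
    push_cast at this ⊢
    linear_combination this
  have hz := eventuallyEq_zero_of_hypergeometricOp hc' (hga 0 (Set.mem_univ _)) hop (by simpa [hg])
  have := hga.eqOn_zero_of_preconnected_of_eventuallyEq_zero isPreconnected_univ (Set.mem_univ 0) hz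
    (Set.mem_univ 1)
  simp [hg, hP, hyperPoly_eval_zero] at this

/-! ### The frequencies at which a hypergeometric parameter is a non-positive integer -/

/-- If `V = ± W` means that `ω` is one of two points, then the sign of `Re V` at these points
tells which of them belongs to `W = V`, where `Re W ≥ 0`. -/
theorem eq_iff_of_sq_eq_sq_iff {V W : ℂ → ℂ} {ω₁ ω₂ : ℂ} (hW : ∀ ω, 0 ≤ (W ω).re)
    (h : ∀ ω, V ω ^ 2 = W ω ^ 2 ↔ ω = ω₁ ∨ ω = ω₂) (h₁ : 0 < (V ω₁).re) (h₂ : (V ω₂).re < 0)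
    (ω : ℂ) : (W ω = V ω ↔ ω = ω₁) ∧ (W ω = -V ω ↔ ω = ω₂) := by
  refine ⟨⟨fun e => ?_, ?_⟩, ⟨fun e => ?_, ?_⟩⟩
  · rcases (h ω).mp (by rw [e]) with rfl | rfl
    · rfl
    · have := hW ω
      rw [e] at this
      linarith
  · rintro rfl
    rcases sq_eq_sq_iff_eq_or_eq_neg.mp ((h ω).mpr (Or.inl rfl)) with e | e
    · exact e.symm
    · have := hW ω
      rw [e, Complex.neg_re] at h₁
      linarith
  · rcases (h ω).mp (by rw [e, neg_sq]) with rfl | rfl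
    · have := hW ω
      rw [e, Complex.neg_re] at this
      linarith
    · rfl
  · rintro rfl
    rcases sq_eq_sq_iff_eq_or_eq_neg.mp ((h ω).mpr (Or.inr rfl)) with e | e
    · have := hW ω
      rw [e] at h₂
      linarith
    · rw [e, neg_neg]

namespace StretchedBlackHole

variable (B : StretchedBlackHole)

theorem ν_sq_add_three_pos : 0 < B.ν ^ 2 + 3 := by positivity

theorem three_mul_ν_sq_sub_one_pos : 0 < 3 * (B.ν ^ 2 - 1) := by nlinarith [B.one_lt_ν]

theorem rp_pos : 0 < B.rp := B.rm_nonneg.trans_lt B.rm_lt_rp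

theorem rp_sub_rm_pos : 0 < B.rp - B.rm := sub_pos.mpr B.rm_lt_rp

theorem q_sq : B.q ^ 2 = B.rp * B.rm * (B.ν ^ 2 + 3) :=
  Real.sq_sqrt (mul_nonneg (mul_nonneg B.rp_pos.le B.rm_nonneg) B.ν_sq_add_three_pos.le)

theorem Rsq_rp : B.Rsq B.rp = ((2 * B.ν * B.rp - B.q) / 2) ^ 2 := by
  unfold Rsq
  linear_combination (-1 / 4) * B.q_sq

theorem two_ν_rp_sub_q_pos : 0 < 2 * B.ν * B.rp - B.q := by
  have h1 := B.one_lt_ν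
  have h2 := B.rp_pos
  have h3 := B.rm_lt_rp
  rw [sub_pos]
  refine lt_of_pow_lt_pow_left₀ 2 (by positivity) ?_
  rw [B.q_sq]
  have h4 : B.rp * B.rm ≤ B.rp ^ 2 := by nlinarith
  calc B.rp * B.rm * (B.ν ^ 2 + 3) ≤ B.rp ^ 2 * (B.ν ^ 2 + 3) := by gcongr
    _ < B.rp ^ 2 * (4 * B.ν ^ 2) := by
      have : 0 < B.rp ^ 2 := by positivity
      gcongr
      nlinarith
    _ = (2 * B.ν * B.rp) ^ 2 := by ring

theorem Nθ_rp_mul : B.Nθ B.rp * (2 * B.ν * B.rp - B.q) = 2 := by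
  have := B.two_ν_rp_sub_q_pos.ne'
  unfold Nθ
  rw [B.Rsq_rp]
  field_simp

/-- `α`, with the pole of `N^θ` cancelled, in the form in which `γ` is given. -/
theorem α_eq (k : ℤ) (ω : ℂ) : B.α k ω =
    -Complex.I * (ω * ((2 * B.ν * B.rp - B.q : ℝ) : ℂ) + 2 * (k : ℂ)) /
      (((B.ν ^ 2 + 3) * (B.rp - B.rm) : ℝ) : ℂ) := by
  have h : (B.Nθ B.rp : ℂ) * ((2 * B.ν * B.rp - B.q : ℝ) : ℂ) = 2 := by
    rw [← Complex.ofReal_mul, B.Nθ_rp_mul]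
    norm_num
  unfold α omegaTilde
  rw [Complex.ofReal_div]
  linear_combination (-Complex.I * (k : ℂ) / (((B.ν ^ 2 + 3) * (B.rp - B.rm) : ℝ) : ℂ)) * h

theorem δ_eq : B.δ = 2 * B.ν * (B.rp + B.rm) - 2 * B.q := by
  unfold δ q
  rw [show (B.ν ^ 2 + 3) * B.rp * B.rm = B.rp * B.rm * (B.ν ^ 2 + 3) by ring]

theorem α_add_γ (k : ℤ) (ω : ℂ) : B.α k ω + B.γ k ω =
    -Complex.I * (B.d * (B.δ * ω + 4 * k)) / (B.ν ^ 2 + 3) := by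
  have h1 : ((B.rp : ℂ) - B.rm) ≠ 0 := by exact_mod_cast B.rp_sub_rm_pos.ne'
  have h2 : ((B.ν : ℂ) ^ 2 + 3) ≠ 0 := by exact_mod_cast B.ν_sq_add_three_pos.ne'
  rw [α_eq, γ, δ_eq, d]
  push_cast
  field_simp
  ring

theorem α_sub_γ (k : ℤ) (ω : ℂ) : B.α k ω - B.γ k ω =
    -Complex.I * (2 * B.ν * ω) / (B.ν ^ 2 + 3) := by
  have h1 : ((B.rp : ℂ) - B.rm) ≠ 0 := by exact_mod_cast B.rp_sub_rm_pos.ne'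
  have h2 : ((B.ν : ℂ) ^ 2 + 3) ≠ 0 := by exact_mod_cast B.ν_sq_add_three_pos.ne'
  rw [α_eq, γ]
  push_cast
  field_simp
  ring

theorem d_mul_δ_pos : 0 < B.d * B.δ := by
  have h1 := B.one_lt_ν
  have h2 := B.rp_pos
  have h3 := B.rm_nonneg
  refine mul_pos (one_div_pos.mpr B.rp_sub_rm_pos) ?_
  have h4 : B.q < B.ν * (B.rp + B.rm) := by
    refine lt_of_pow_lt_pow_left₀ 2 (by positivity) ?_
    rw [B.q_sq]
    have h5 : 0 < (B.rp - B.rm) ^ 2 := pow_pos B.rp_sub_rm_pos 2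
    have h6 : 4 * (B.rp * B.rm) < (B.rp + B.rm) ^ 2 := by nlinarith
    have h7 : 0 ≤ B.rp * B.rm := mul_nonneg h2.le h3
    calc B.rp * B.rm * (B.ν ^ 2 + 3) ≤ B.rp * B.rm * (4 * B.ν ^ 2) := by
          gcongr
          nlinarith
      _ = 4 * (B.rp * B.rm) * B.ν ^ 2 := by ring
      _ < (B.rp + B.rm) ^ 2 * B.ν ^ 2 := by gcongr
      _ = (B.ν * (B.rp + B.rm)) ^ 2 := by ring
  rw [δ_eq]
  linarith

/-- `d² δ² - 3 (ν² - 1)` is a square up to a positive factor, so it can only fail to be positive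
by vanishing. -/
theorem three_mul_lt_d_mul_δ_sq (hD : B.d ^ 2 * B.δ ^ 2 ≠ 3 * (B.ν ^ 2 - 1)) :
    3 * (B.ν ^ 2 - 1) < B.d ^ 2 * B.δ ^ 2 := by
  refine lt_of_le_of_ne ?_ hD.symm
  have h1 := B.rp_sub_rm_pos
  have h2 := B.ν_sq_add_three_pos
  have h3 : B.d ^ 2 * B.δ ^ 2 - 3 * (B.ν ^ 2 - 1) =
      ((B.ν ^ 2 + 3) * (B.rp + B.rm) - 4 * B.ν * B.q) ^ 2 /
        ((B.ν ^ 2 + 3) * (B.rp - B.rm) ^ 2) := by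
    rw [δ_eq, d]
    field_simp
    linear_combination (-12 * B.ν ^ 2 + 12) * B.q_sq
  have h4 : 0 ≤ ((B.ν ^ 2 + 3) * (B.rp + B.rm) - 4 * B.ν * B.q) ^ 2 /
        ((B.ν ^ 2 + 3) * (B.rp - B.rm) ^ 2) := by positivity
  linarith

section Mass

variable {msq : ℝ}

theorem varpiHat_sq (ω : ℂ) : B.varpiHat msq ω ^ 2 = (B.omegaM msq : ℂ) ^ 2 - ω ^ 2 := by
  have h : ((B.omegaM msq : ℂ) ^ 2 - ω ^ 2) =
      (((B.omegaM msq : ℂ) ^ 2 - ω ^ 2) ^ (1 / 2 : ℂ)) ^ 2 := by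
    simp
  unfold varpiHat
  split_ifs
  · rw [neg_sq, ← h]
  · rw [← h]

theorem omegaM_nonneg : 0 ≤ B.omegaM msq := by
  have := B.ν_sq_add_three_pos
  unfold omegaM
  positivity

/-- The principal square root has non-negative real part; where the sign is flipped, the real
part vanishes. -/
theorem varpiHat_re_nonneg (ω : ℂ) : 0 ≤ (B.varpiHat msq ω).re := by
  have hre : ∀ z : ℂ, 0 ≤ (z ^ (1 / 2 : ℂ)).re := by
    intro z
    rcases eq_or_ne z 0 with rfl | hz
    · simp
    · have harg : (Complex.log z * (1 / 2)).im = z.arg / 2 := by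
        have : Complex.log z * (1 / 2) = Complex.log z / ((2 : ℝ) : ℂ) := by push_cast; ring
        rw [this, Complex.div_ofReal_im, Complex.log_im]
      rw [Complex.cpow_def_of_ne_zero hz, Complex.exp_re, harg]
      refine mul_nonneg (Real.exp_pos _).le (Real.cos_nonneg_of_mem_Icc ⟨?_, ?_⟩)
      · linarith [Complex.neg_pi_lt_arg z]
      · linarith [Complex.arg_le_pi z]
  unfold varpiHat
  split_ifs with h
  · have hω : ω = (ω.re : ℂ) := Complex.ext rfl (by simp [h.1])
    have hneg : B.omegaM msq ^ 2 - ω.re ^ 2 < 0 := by nlinarith [B.omegaM_nonneg (msq := msq)]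
    set z : ℂ := (B.omegaM msq : ℂ) ^ 2 - ω ^ 2 with hz
    have hzr : z = ((B.omegaM msq ^ 2 - ω.re ^ 2 : ℝ) : ℂ) := by
      rw [hz, hω]
      push_cast
      simp
    have hsq : (z ^ (1 / 2 : ℂ)) ^ 2 = z := by
      simp
    set y := z ^ (1 / 2 : ℂ) with hy
    have e1 : y.re * y.re - y.im * y.im = B.omegaM msq ^ 2 - ω.re ^ 2 := by
      have := congrArg Complex.re hsq
      rw [hzr, Complex.ofReal_re, sq, Complex.mul_re] at this
      exact this
    have e2 : y.re * y.im = 0 := by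
      have := congrArg Complex.im hsq
      rw [hzr, Complex.ofReal_im, sq, Complex.mul_im] at this
      linarith
    rcases mul_eq_zero.mp e2 with e | e
    · rw [Complex.neg_re, e, neg_zero]
    · rw [e] at e1
      nlinarith [mul_self_nonneg y.re]
  · exact hre _

theorem im_eq_zero_of_varpiHat_re_eq_zero {ω : ℂ} (h : (B.varpiHat msq ω).re = 0) :
    ω.im = 0 := by
  have h1 := B.varpiHat_sq (msq := msq) ω
  set y := B.varpiHat msq ω
  have e1 := congrArg Complex.re h1
  have e2 := congrArg Complex.im h1
  simp only [sq, Complex.mul_re, Complex.mul_im, Complex.sub_re, Complex.sub_im,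
    Complex.ofReal_re, Complex.ofReal_im, h] at e1 e2
  by_contra him
  have hre : ω.re = 0 := by
    have : ω.re * ω.im = 0 := by linarith
    exact (mul_eq_zero.mp this).resolve_right him
  rw [hre] at e1
  have : 0 < ω.im * ω.im := mul_self_pos.mpr him
  nlinarith [mul_self_nonneg y.im, mul_self_nonneg (B.omegaM msq)]

theorem one_add_nonneg (hm : -((B.ν ^ 2 + 3) / 4) ≤ msq) : 0 ≤ 1 + 4 * msq / (B.ν ^ 2 + 3) := by
  have := B.ν_sq_add_three_pos
  rw [show 1 + 4 * msq / (B.ν ^ 2 + 3) = (B.ν ^ 2 + 3 + 4 * msq) / (B.ν ^ 2 + 3) by field_simp]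
  exact div_nonneg (by linarith) this.le

theorem omegaM_sq (hm : -((B.ν ^ 2 + 3) / 4) ≤ msq) : 3 * (B.ν ^ 2 - 1) * B.omegaM msq ^ 2 =
    (B.ν ^ 2 + 3) ^ 2 / 4 * (1 + 4 * msq / (B.ν ^ 2 + 3)) := by
  have h1 := B.three_mul_ν_sq_sub_one_pos
  have h2 := Real.sq_sqrt h1.le
  have h3 : √(3 * (B.ν ^ 2 - 1)) ≠ 0 := (Real.sqrt_pos.mpr h1).ne'
  have h4 := Real.sq_sqrt (B.one_add_nonneg hm)
  unfold omegaM
  simp only [mul_pow, div_pow, h2, h4]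
  have := h1.ne'
  generalize 3 * (B.ν ^ 2 - 1) = x at *
  field_simp
  norm_num

/-- `W = √(3 (ν² - 1)) ϖ̂`, the quantity the conditions `a = -n`, … express through `ω`. -/
noncomputable def scaledVarpi (msq : ℝ) (ω : ℂ) : ℂ := (√(3 * (B.ν ^ 2 - 1)) : ℂ) * B.varpiHat msq ω

theorem scaledVarpi_re_nonneg (ω : ℂ) : 0 ≤ (B.scaledVarpi msq ω).re := by
  rw [scaledVarpi, Complex.re_ofReal_mul]
  exact mul_nonneg (Real.sqrt_nonneg _) (B.varpiHat_re_nonneg ω)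

theorem scaledVarpi_sq (hm : -((B.ν ^ 2 + 3) / 4) ≤ msq) (ω : ℂ) :
    B.scaledVarpi msq ω ^ 2 = ((B.ν : ℂ) ^ 2 + 3) ^ 2 / 4 * ((1 + 4 * msq / (B.ν ^ 2 + 3) : ℝ) : ℂ)
      - 3 * ((B.ν : ℂ) ^ 2 - 1) * ω ^ 2 := by
  have h2 : (√(3 * (B.ν ^ 2 - 1)) : ℂ) ^ 2 = 3 * ((B.ν : ℂ) ^ 2 - 1) := by
    exact_mod_cast Real.sq_sqrt B.three_mul_ν_sq_sub_one_pos.le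
  have h3 : 3 * ((B.ν : ℂ) ^ 2 - 1) * (B.omegaM msq : ℂ) ^ 2 =
      ((B.ν : ℂ) ^ 2 + 3) ^ 2 / 4 * ((1 + 4 * msq / (B.ν ^ 2 + 3) : ℝ) : ℂ) := by
    exact_mod_cast B.omegaM_sq hm
  rw [scaledVarpi, mul_pow, h2, B.varpiHat_sq, mul_sub, h3]

theorem β_eq (ω : ℂ) : B.β msq ω = 1 / 2 - B.scaledVarpi msq ω / ((B.ν : ℂ) ^ 2 + 3) := by
  rw [β, scaledVarpi]
  push_cast
  ring

/-- `β` and `1 - β` are the exponents at infinity: the roots of the indicial equation there. -/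
theorem β_mul_one_sub_β (hm : -((B.ν ^ 2 + 3) / 4) ≤ msq) (ω : ℂ) :
    B.β msq ω * (1 - B.β msq ω) =
      3 * ((B.ν : ℂ) ^ 2 - 1) * ω ^ 2 / ((B.ν : ℂ) ^ 2 + 3) ^ 2 - msq / ((B.ν : ℂ) ^ 2 + 3) := by
  have h2 : ((B.ν : ℂ) ^ 2 + 3) ≠ 0 := by exact_mod_cast B.ν_sq_add_three_pos.ne'
  have h3 := B.scaledVarpi_sq hm ω
  push_cast at h3
  rw [β_eq]
  generalize B.scaledVarpi msq ω = W at *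
  field_simp at h3 ⊢
  linear_combination (-1 : ℂ) * h3

/-- The value of `W` required by `a = -n`; `c - b = -n` requires its negative. -/
noncomputable def rightCondition (k : ℤ) (n : ℕ) (ω : ℂ) : ℂ :=
  ((B.ν : ℂ) ^ 2 + 3) * (n + 1 / 2) - Complex.I * (B.d * (B.δ * ω + 4 * k))

/-- The value of `W` required by `b = -n`; `c - a = -n` requires its negative. -/
noncomputable def leftCondition (n : ℕ) (ω : ℂ) : ℂ :=
  ((B.ν : ℂ) ^ 2 + 3) * (n + 1 / 2) - Complex.I * (2 * B.ν * ω)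

theorem a_eq_neg_iff (k : ℤ) (n : ℕ) (ω : ℂ) :
    B.a msq k ω = -(n : ℂ) ↔ B.scaledVarpi msq ω = B.rightCondition k n ω := by
  have h2 : ((B.ν : ℂ) ^ 2 + 3) ≠ 0 := by exact_mod_cast B.ν_sq_add_three_pos.ne'
  have h : B.a msq k ω + n =
      (B.rightCondition k n ω - B.scaledVarpi msq ω) / ((B.ν : ℂ) ^ 2 + 3) := by
    rw [show B.a msq k ω = (B.α k ω + B.γ k ω) + B.β msq ω by unfold a; ring, α_add_γ, β_eq,
      rightCondition]
    field_simp
    ring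
  rw [← add_eq_zero_iff_eq_neg, h, div_eq_zero_iff, or_iff_left h2, sub_eq_zero, eq_comm]

theorem b_eq_neg_iff (k : ℤ) (n : ℕ) (ω : ℂ) :
    B.b msq k ω = -(n : ℂ) ↔ B.scaledVarpi msq ω = B.leftCondition n ω := by
  have h2 : ((B.ν : ℂ) ^ 2 + 3) ≠ 0 := by exact_mod_cast B.ν_sq_add_three_pos.ne'
  have h : B.b msq k ω + n =
      (B.leftCondition n ω - B.scaledVarpi msq ω) / ((B.ν : ℂ) ^ 2 + 3) := by
    rw [show B.b msq k ω = (B.α k ω - B.γ k ω) + B.β msq ω by unfold b; ring, α_sub_γ, β_eq,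
      leftCondition]
    field_simp
    ring
  rw [← add_eq_zero_iff_eq_neg, h, div_eq_zero_iff, or_iff_left h2, sub_eq_zero, eq_comm]

theorem c_sub_b_eq_neg_iff (k : ℤ) (n : ℕ) (ω : ℂ) :
    B.c k ω - B.b msq k ω = -(n : ℂ) ↔ B.scaledVarpi msq ω = -B.rightCondition k n ω := by
  have h2 : ((B.ν : ℂ) ^ 2 + 3) ≠ 0 := by exact_mod_cast B.ν_sq_add_three_pos.ne'
  have h : B.c k ω - B.b msq k ω + n =
      (B.scaledVarpi msq ω + B.rightCondition k n ω) / ((B.ν : ℂ) ^ 2 + 3) := by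
    rw [show B.c k ω - B.b msq k ω = (B.α k ω + B.γ k ω) + (1 - B.β msq ω) by unfold b c; ring,
      α_add_γ, β_eq, rightCondition]
    field_simp
    ring
  rw [← add_eq_zero_iff_eq_neg, h, div_eq_zero_iff, or_iff_left h2, add_eq_zero_iff_eq_neg]

theorem c_sub_a_eq_neg_iff (k : ℤ) (n : ℕ) (ω : ℂ) :
    B.c k ω - B.a msq k ω = -(n : ℂ) ↔ B.scaledVarpi msq ω = -B.leftCondition n ω := by
  have h2 : ((B.ν : ℂ) ^ 2 + 3) ≠ 0 := by exact_mod_cast B.ν_sq_add_three_pos.ne'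
  have h : B.c k ω - B.a msq k ω + n =
      (B.scaledVarpi msq ω + B.leftCondition n ω) / ((B.ν : ℂ) ^ 2 + 3) := by
    rw [show B.c k ω - B.a msq k ω = (B.α k ω - B.γ k ω) + (1 - B.β msq ω) by unfold a c; ring,
      α_sub_γ, β_eq, leftCondition]
    field_simp
    ring
  rw [← add_eq_zero_iff_eq_neg, h, div_eq_zero_iff, or_iff_left h2, add_eq_zero_iff_eq_neg]

theorem scaledVarpi_eq_leftCondition_iff (hm : -((B.ν ^ 2 + 3) / 4) ≤ msq) (n : ℕ) (ω : ℂ) :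
    (B.scaledVarpi msq ω = B.leftCondition n ω ↔ ω = B.leftFreq 1 msq n) ∧
      (B.scaledVarpi msq ω = -B.leftCondition n ω ↔ ω = B.leftFreq (-1) msq n) := by
  have hA := B.ν_sq_add_three_pos
  have hB := B.three_mul_ν_sq_sub_one_pos
  have hM := B.one_add_nonneg hm
  have hν := B.one_lt_ν
  have hA' : ((B.ν : ℂ) ^ 2 + 3) ≠ 0 := by exact_mod_cast hA.ne'
  set M : ℝ := 1 + 4 * msq / (B.ν ^ 2 + 3) with hMdef
  set S : ℝ := √(3 * (B.ν ^ 2 - 1) * ((n : ℝ) + 1 / 2) ^ 2 + (B.ν ^ 2 + 3) / 4 * M) with hS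
  have hS0 : 0 ≤ S := Real.sqrt_nonneg _
  have hS2 : S ^ 2 = 3 * (B.ν ^ 2 - 1) * ((n : ℝ) + 1 / 2) ^ 2 + (B.ν ^ 2 + 3) / 4 * M :=
    Real.sq_sqrt (by positivity)
  have hS2' : (S : ℂ) ^ 2 = 3 * ((B.ν : ℂ) ^ 2 - 1) * ((n : ℂ) + 1 / 2) ^ 2
      + ((B.ν : ℂ) ^ 2 + 3) / 4 * M := by
    have := congrArg (fun x : ℝ => (x : ℂ)) hS2
    push_cast at this
    exact this
  have hp : B.leftFreq 1 msq n = -Complex.I * ((2 * n + 1) * B.ν - S) := by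
    rw [leftFreq, ← hMdef, ← hS]; push_cast; ring
  have hmn : B.leftFreq (-1) msq n = -Complex.I * ((2 * n + 1) * B.ν + S) := by
    rw [leftFreq, ← hMdef, ← hS]; push_cast; ring
  have hn : (0 : ℝ) < n + 1 / 2 := by positivity
  refine eq_iff_of_sq_eq_sq_iff (V := B.leftCondition n) (W := B.scaledVarpi msq)
    (fun ω => B.scaledVarpi_re_nonneg ω) (fun ω => ?_) ?_ ?_ ω
  · have h : B.leftCondition n ω ^ 2 - B.scaledVarpi msq ω ^ 2 = -((B.ν : ℂ) ^ 2 + 3) *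
        ((ω - B.leftFreq 1 msq n) * (ω - B.leftFreq (-1) msq n)) := by
      rw [B.scaledVarpi_sq hm, hp, hmn, leftCondition, ← hMdef]
      linear_combination ((B.ν : ℂ) ^ 2 + 3) * hS2' + (4 * (B.ν : ℂ) ^ 2 * ω ^ 2 +
        ((B.ν : ℂ) ^ 2 + 3) * ((2 * n + 1) ^ 2 * (B.ν : ℂ) ^ 2 - S ^ 2)) * Complex.I_sq
    rw [← sub_eq_zero, h, mul_eq_zero, or_iff_right (neg_ne_zero.mpr hA'), mul_eq_zero, sub_eq_zero,
      sub_eq_zero]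
  · have h : B.leftCondition n (B.leftFreq 1 msq n) =
        ((2 * B.ν * S - 3 * (B.ν ^ 2 - 1) * (n + 1 / 2) : ℝ) : ℂ) := by
      rw [hp, leftCondition]
      push_cast
      linear_combination (2 * (B.ν : ℂ) * ((2 * n + 1) * B.ν - S)) * Complex.I_sq
    rw [h, Complex.ofReal_re, sub_pos]
    refine lt_of_pow_lt_pow_left₀ 2 (by positivity) ?_
    have h1 : 3 * (B.ν ^ 2 - 1) < 4 * B.ν ^ 2 := by linarith
    calc (3 * (B.ν ^ 2 - 1) * ((n : ℝ) + 1 / 2)) ^ 2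
        = 3 * (B.ν ^ 2 - 1) * (3 * (B.ν ^ 2 - 1) * ((n : ℝ) + 1 / 2) ^ 2) := by ring
      _ < 4 * B.ν ^ 2 * (3 * (B.ν ^ 2 - 1) * ((n : ℝ) + 1 / 2) ^ 2) := by gcongr
      _ ≤ 4 * B.ν ^ 2 * S ^ 2 := by
          rw [hS2]
          gcongr
          have : 0 ≤ (B.ν ^ 2 + 3) / 4 * M := by positivity
          linarith
      _ = (2 * B.ν * S) ^ 2 := by ring
  · have h : B.leftCondition n (B.leftFreq (-1) msq n) =
        ((-(2 * B.ν * S) - 3 * (B.ν ^ 2 - 1) * (n + 1 / 2) : ℝ) : ℂ) := by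
      rw [hmn, leftCondition]
      push_cast
      linear_combination (2 * (B.ν : ℂ) * ((2 * n + 1) * B.ν + S)) * Complex.I_sq
    rw [h, Complex.ofReal_re]
    have h1 : 0 < 3 * (B.ν ^ 2 - 1) * ((n : ℝ) + 1 / 2) := by positivity
    have h2 : 0 ≤ 2 * B.ν * S := by positivity
    linarith

/-- `e - i sgn(k) f` is a square root of `E + i F` of real part at least
`√(3 (ν² - 1)) (n + 1/2)`. -/
theorem smallE_smallF (hm : -((B.ν ^ 2 + 3) / 4) ≤ msq)
    (hD : B.d ^ 2 * B.δ ^ 2 ≠ 3 * (B.ν ^ 2 - 1)) (k : ℤ) (n : ℕ) :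
    ((B.smallE msq k n : ℂ) - Complex.I * (Int.sign k : ℂ) * (B.smallF msq k n : ℂ)) ^ 2 =
      B.capE msq k n + Complex.I * B.capF k n ∧
    3 * (B.ν ^ 2 - 1) * ((n : ℝ) + 1 / 2) ^ 2 ≤ B.smallE msq k n ^ 2 := by
  have hA := B.ν_sq_add_three_pos
  have hB := B.three_mul_ν_sq_sub_one_pos
  have hM := B.one_add_nonneg hm
  have hD' := B.three_mul_lt_d_mul_δ_sq hD
  have hd : 0 < B.d := one_div_pos.mpr B.rp_sub_rm_pos
  have hn : (0 : ℝ) < n + 1 / 2 := by positivity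
  set M : ℝ := 1 + 4 * msq / (B.ν ^ 2 + 3) with hMdef
  set b3 : ℝ := 3 * (B.ν ^ 2 - 1) with hb3
  set κ : ℝ := 4 * (k : ℝ) * B.d / (B.ν ^ 2 + 3) with hκ
  set N : ℝ := (n : ℝ) + 1 / 2 with hN
  have hE : B.capE msq k n = (B.d ^ 2 * B.δ ^ 2 - b3) * M / 4 + b3 * (N ^ 2 - κ ^ 2) := by
    rw [capE, ← hMdef, ← hκ, ← hN, ← hb3]; ring
  have hF : B.capF k n = -(2 * b3 * N * κ) := by
    rw [capF, ← hN, hκ, hb3]; ring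
  have hθ : 0 ≤ (B.d ^ 2 * B.δ ^ 2 - b3) * M / 4 := by
    have : 0 ≤ B.d ^ 2 * B.δ ^ 2 - b3 := by linarith
    positivity
  set E := B.capE msq k n with hEdef
  set F := B.capF k n with hFdef
  have hEabs : |E| ≤ √(E ^ 2 + F ^ 2) := Real.abs_le_sqrt (by nlinarith [sq_nonneg F])
  have hr2 : √(E ^ 2 + F ^ 2) ^ 2 = E ^ 2 + F ^ 2 := Real.sq_sqrt (by positivity)
  have hE1 := (abs_le.mp hEabs).1
  have hE2 := (abs_le.mp hEabs).2
  set r := √(E ^ 2 + F ^ 2) with hr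
  have he2 : B.smallE msq k n ^ 2 = (r + E) / 2 := by
    rw [smallE, ← hEdef, ← hFdef, ← hr]
    exact Real.sq_sqrt (by linarith)
  have hf2 : B.smallF msq k n ^ 2 = (r - E) / 2 := by
    rw [smallF, ← hEdef, ← hFdef, ← hr]
    exact Real.sq_sqrt (by linarith)
  have he0 : 0 ≤ B.smallE msq k n := Real.sqrt_nonneg _
  have hf0 : 0 ≤ B.smallF msq k n := Real.sqrt_nonneg _
  constructor
  · rcases eq_or_ne k 0 with hk | hk
    · -- For `k = 0` the sign vanishes, and so does `F`; here `E ≥ 0` is needed.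
      have hκ0 : κ = 0 := by rw [hκ, hk]; simp
      rw [hκ0] at hE hF
      have hF0 : F = 0 := by rw [hF]; ring
      have hEnn : 0 ≤ E := by
        rw [hE]
        have : 0 ≤ b3 * (N ^ 2 - 0 ^ 2) := by rw [zero_pow two_ne_zero, sub_zero]; positivity
        linarith
      have hrE : r = E := by rw [hr, hF0, zero_pow two_ne_zero, add_zero, Real.sqrt_sq hEnn]
      rw [hk, Int.sign_zero, hF0]
      rw [hk, hrE, add_self_div_two] at he2
      have : (B.smallE msq 0 n : ℂ) ^ 2 = E := by exact_mod_cast he2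
      simpa using this
    · have hef : 2 * (B.smallE msq k n * B.smallF msq k n) = |F| := by
        rw [← abs_of_nonneg (show 0 ≤ 2 * (B.smallE msq k n * B.smallF msq k n) by positivity),
          ← sq_eq_sq_iff_abs_eq_abs, mul_pow, mul_pow, he2, hf2]
        linear_combination hr2
      have hsF : (Int.sign k : ℝ) * |F| = -F := by
        have hpos : 0 < 2 * b3 * N * (4 * B.d / (B.ν ^ 2 + 3)) := by positivity
        have hF' : F = -((2 * b3 * N * (4 * B.d / (B.ν ^ 2 + 3))) * k) := by rw [hF, hκ]; ring
        have habs : (Int.sign k : ℝ) * |(k : ℝ)| = k := by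
          have := Int.sign_mul_abs k
          exact_mod_cast this
        rw [hF', abs_neg, abs_mul, abs_of_pos hpos]
        linear_combination (2 * b3 * N * (4 * B.d / (B.ν ^ 2 + 3))) * habs
      have hs2 : (Int.sign k : ℂ) ^ 2 = 1 := by
        have : Int.sign k ^ 2 = 1 := by
          rcases lt_or_gt_of_ne hk with h | h
          · rw [Int.sign_eq_neg_one_of_neg h]; norm_num
          · rw [Int.sign_eq_one_of_pos h]; norm_num
        exact_mod_cast this
      have hre : (B.smallE msq k n : ℂ) ^ 2 - (B.smallF msq k n : ℂ) ^ 2 = E := by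
        have : B.smallE msq k n ^ 2 - B.smallF msq k n ^ 2 = E := by rw [he2, hf2]; ring
        exact_mod_cast this
      have him : 2 * (Int.sign k : ℂ) * ((B.smallE msq k n : ℂ) * B.smallF msq k n) = -F := by
        have : 2 * (Int.sign k : ℝ) * (B.smallE msq k n * B.smallF msq k n) = -F := by
          rw [← hsF, ← hef]; ring
        exact_mod_cast this
      linear_combination hre - Complex.I * him
        + ((B.smallF msq k n : ℂ) ^ 2 * (Int.sign k : ℂ) ^ 2) * Complex.I_sq
        - (B.smallF msq k n : ℂ) ^ 2 * hs2
  · -- `√(E² + F²) ≥ 2 b₃ N² - E`, because `E ≥ b₃ (N² - κ²)`.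
    have h1 : |2 * b3 * N ^ 2 - E| ≤ r := by
      refine Real.abs_le_sqrt ?_
      have h2 : 0 ≤ 4 * b3 * N ^ 2 * ((B.d ^ 2 * B.δ ^ 2 - b3) * M / 4) := by positivity
      have h3 : E ^ 2 + F ^ 2 - (2 * b3 * N ^ 2 - E) ^ 2 =
          4 * b3 * N ^ 2 * ((B.d ^ 2 * B.δ ^ 2 - b3) * M / 4) := by
        rw [hF, hE]
        ring
      linarith
    have h3 := (abs_le.mp h1).2
    rw [he2]
    linarith

theorem scaledVarpi_eq_rightCondition_iff (hm : -((B.ν ^ 2 + 3) / 4) ≤ msq)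
    (hD : B.d ^ 2 * B.δ ^ 2 ≠ 3 * (B.ν ^ 2 - 1)) (k : ℤ) (n : ℕ) (ω : ℂ) :
    (B.scaledVarpi msq ω = B.rightCondition k n ω ↔ ω = B.rightFreq 1 msq k n) ∧
      (B.scaledVarpi msq ω = -B.rightCondition k n ω ↔ ω = B.rightFreq (-1) msq k n) := by
  have hA := B.ν_sq_add_three_pos
  have hB := B.three_mul_ν_sq_sub_one_pos
  have hD' := B.three_mul_lt_d_mul_δ_sq hD
  have hDpos := B.d_mul_δ_pos
  obtain ⟨hs2, he2⟩ := B.smallE_smallF hm hD k n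
  have he0 : 0 ≤ B.smallE msq k n := Real.sqrt_nonneg _
  have hA' : ((B.ν : ℂ) ^ 2 + 3) ≠ 0 := by exact_mod_cast hA.ne'
  have hn : (0 : ℝ) < n + 1 / 2 := by positivity
  set s : ℂ := (B.smallE msq k n : ℂ) - Complex.I * (Int.sign k : ℂ) * (B.smallF msq k n : ℂ) with hs
  have hsre : s.re = B.smallE msq k n := by
    have : ((Int.sign k : ℂ)) = ((Int.sign k : ℝ) : ℂ) := by push_cast; rfl
    rw [hs, this, mul_assoc, ← Complex.ofReal_mul]
    simp
  have hQpos : 0 < (B.d * B.δ) ^ 2 - 3 * (B.ν ^ 2 - 1) := by rw [mul_pow]; linarith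
  set Q : ℝ := (B.d * B.δ) ^ 2 - 3 * (B.ν ^ 2 - 1) with hQ
  have hQ' : (Q : ℂ) ≠ 0 := by exact_mod_cast hQpos.ne'
  have hQc : (Q : ℂ) = ((B.d : ℂ) * B.δ) ^ 2 - 3 * ((B.ν : ℂ) ^ 2 - 1) := by
    rw [hQ]; push_cast; ring
  set P : ℂ := ((B.ν : ℂ) ^ 2 + 3) * (n + 1 / 2) - 4 * Complex.I * k * B.d with hP
  have hPre : P.re = (B.ν ^ 2 + 3) * (n + 1 / 2) := by
    have : P = (((B.ν ^ 2 + 3) * (n + 1 / 2) : ℝ) : ℂ) - Complex.I * ((4 * k * B.d : ℝ) : ℂ) := by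
      rw [hP]; push_cast; ring
    rw [this, Complex.sub_re, Complex.ofReal_re, Complex.I_mul_re, Complex.ofReal_im, neg_zero,
      sub_zero]
  have hfreq : ∀ σ : ℤ, B.rightFreq σ msq k n =
      Complex.I * (σ * (((B.ν : ℂ) ^ 2 + 3) * s) - P * (B.d * B.δ)) / Q := by
    intro σ
    rw [rightFreq, ← hs, hP]
    have : B.d ^ 2 * B.δ ^ 2 - 3 * (B.ν ^ 2 - 1) = Q := by rw [hQ]; ring
    rw [this]
    push_cast
    field_simp
    linear_combination (-8 * (B.d : ℂ) ^ 2 * k * B.δ) * Complex.I_sq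
  have hV : ∀ ω, B.rightCondition k n ω = P - Complex.I * (B.d * B.δ) * ω := by
    intro ω
    rw [rightCondition, hP]
    ring
  have hVfreq : ∀ σ : ℤ, B.rightCondition k n (B.rightFreq σ msq k n) =
      (σ * ((B.d * B.δ : ℝ) : ℂ) * (((B.ν ^ 2 + 3 : ℝ) : ℂ) * s) -
        ((3 * (B.ν ^ 2 - 1) : ℝ) : ℂ) * P) / Q := by
    intro σ
    rw [hV, hfreq]
    field_simp
    push_cast
    linear_combination P * hQc - (σ * ((B.ν : ℂ) ^ 2 + 3) * s - B.d * B.δ * P) * B.d * B.δ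
      * Complex.I_sq
  have hVre : ∀ σ : ℤ, (B.rightCondition k n (B.rightFreq σ msq k n)).re =
      (B.ν ^ 2 + 3) * (σ * (B.d * B.δ) * B.smallE msq k n
        - 3 * (B.ν ^ 2 - 1) * (n + 1 / 2)) / Q := by
    intro σ
    have : ((σ : ℂ)) = ((σ : ℝ) : ℂ) := by push_cast; rfl
    rw [hVfreq, Complex.div_ofReal_re, Complex.sub_re, this, ← Complex.ofReal_mul, ← mul_assoc,
      ← Complex.ofReal_mul, Complex.re_ofReal_mul, Complex.re_ofReal_mul, hsre, hPre]
    ring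
  refine eq_iff_of_sq_eq_sq_iff (V := B.rightCondition k n) (W := B.scaledVarpi msq)
    (fun ω => B.scaledVarpi_re_nonneg ω) (fun ω => ?_) ?_ ?_ ω
  · have h : B.rightCondition k n ω ^ 2 - B.scaledVarpi msq ω ^ 2 = -(Q : ℂ) *
        ((ω - B.rightFreq 1 msq k n) * (ω - B.rightFreq (-1) msq k n)) := by
      have hcap : (B.capE msq k n : ℂ) + Complex.I * B.capF k n =
          Q * ((1 + 4 * msq / (B.ν ^ 2 + 3) : ℝ) : ℂ) / 4
            + 3 * ((B.ν : ℂ) ^ 2 - 1) * P ^ 2 / ((B.ν : ℂ) ^ 2 + 3) ^ 2 := by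
        rw [capE, capF, hP, hQ]
        push_cast
        field_simp
        ring_nf
        simp only [Complex.I_sq]
        ring
      rw [hcap] at hs2
      rw [B.scaledVarpi_sq hm, hfreq, hfreq, hV]
      generalize ((1 + 4 * msq / (B.ν ^ 2 + 3) : ℝ) : ℂ) = M at *
      have hs3 : (((B.ν : ℂ) ^ 2 + 3) * s) ^ 2 = ((B.ν : ℂ) ^ 2 + 3) ^ 2 * Q * M / 4
          + 3 * ((B.ν : ℂ) ^ 2 - 1) * P ^ 2 := by
        rw [mul_pow, hs2]
        field_simp
      generalize ((B.ν : ℂ) ^ 2 + 3) * s = T at *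
      push_cast
      field_simp
      rw [hQc] at hs3 ⊢
      linear_combination (norm := skip) 4 * hs3
      ring_nf
      simp only [Complex.I_sq]
      ring
    rw [← sub_eq_zero, h, mul_eq_zero, or_iff_right (neg_ne_zero.mpr hQ'), mul_eq_zero, sub_eq_zero,
      sub_eq_zero]
  · rw [hVre]
    refine div_pos (mul_pos hA (sub_pos.mpr ?_)) hQpos
    refine lt_of_pow_lt_pow_left₀ 2 (by push_cast; positivity) ?_
    calc (3 * (B.ν ^ 2 - 1) * ((n : ℝ) + 1 / 2)) ^ 2
        = 3 * (B.ν ^ 2 - 1) * (3 * (B.ν ^ 2 - 1) * ((n : ℝ) + 1 / 2) ^ 2) := by ring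
      _ < (B.d * B.δ) ^ 2 * (3 * (B.ν ^ 2 - 1) * ((n : ℝ) + 1 / 2) ^ 2) := by
          gcongr
          linarith
      _ ≤ (B.d * B.δ) ^ 2 * B.smallE msq k n ^ 2 := by gcongr
      _ = (((1 : ℤ) : ℝ) * (B.d * B.δ) * B.smallE msq k n) ^ 2 := by push_cast; ring
  · rw [hVre]
    refine div_neg_of_neg_of_pos (mul_neg_of_pos_of_neg hA ?_) hQpos
    have h1 : 0 < 3 * (B.ν ^ 2 - 1) * ((n : ℝ) + 1 / 2) := by positivity
    have h2 : 0 ≤ B.d * B.δ * B.smallE msq k n := by positivity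
    push_cast
    linarith

/-- A frequency with `c - a = -n` or `c - b = -n` decays at infinity: on the real axis, where
`Re ϖ̂` may vanish, the condition would give `Re W = -(ν² + 3) (n + 1/2)`. -/
theorem varpiHat_re_pos_of_condition {k : ℤ} {n : ℕ} {ω : ℂ}
    (h : B.scaledVarpi msq ω = -B.rightCondition k n ω ∨
      B.scaledVarpi msq ω = -B.leftCondition n ω) : 0 < (B.varpiHat msq ω).re := by
  refine lt_of_le_of_ne (B.varpiHat_re_nonneg ω) fun h0 => ?_
  have him := B.im_eq_zero_of_varpiHat_re_eq_zero h0.symm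
  have hω : ω = (ω.re : ℂ) := Complex.ext rfl (by simp [him])
  have hA := B.ν_sq_add_three_pos
  have hpos : 0 < (B.ν ^ 2 + 3) * ((n : ℝ) + 1 / 2) := by positivity
  have hW : (B.scaledVarpi msq ω).re = 0 := by
    rw [scaledVarpi, Complex.re_ofReal_mul, ← h0, mul_zero]
  have hr : (B.rightCondition k n ω).re = (B.ν ^ 2 + 3) * ((n : ℝ) + 1 / 2) := by
    have : B.rightCondition k n ω = (((B.ν ^ 2 + 3) * ((n : ℝ) + 1 / 2) : ℝ) : ℂ)
        - Complex.I * ((B.d * (B.δ * ω.re + 4 * k) : ℝ) : ℂ) := by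
      rw [rightCondition, hω]; push_cast; simp
    rw [this, Complex.sub_re, Complex.ofReal_re, Complex.I_mul_re, Complex.ofReal_im, neg_zero,
      sub_zero]
  have hl : (B.leftCondition n ω).re = (B.ν ^ 2 + 3) * ((n : ℝ) + 1 / 2) := by
    have : B.leftCondition n ω = (((B.ν ^ 2 + 3) * ((n : ℝ) + 1 / 2) : ℝ) : ℂ)
        - Complex.I * ((2 * B.ν * ω.re : ℝ) : ℂ) := by
      rw [leftCondition, hω]; push_cast; simp
    rw [this, Complex.sub_re, Complex.ofReal_re, Complex.I_mul_re, Complex.ofReal_im, neg_zero,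
      sub_zero]
  rcases h with h | h
  · rw [h, Complex.neg_re, hr] at hW
    linarith
  · rw [h, Complex.neg_re, hl] at hW
    linarith

end Mass

end StretchedBlackHole

namespace StretchedBlackHole

variable (B : StretchedBlackHole)

/-! ### Separation of the Klein-Gordon equation -/

theorem Rsq_pos {r : ℝ} (hr : B.rp ≤ r) : 0 < B.Rsq r := by
  have h1 := B.rp_pos
  have h2 := B.three_mul_ν_sq_sub_one_pos
  have h3 : 0 < B.Rsq B.rp := by
    rw [B.Rsq_rp]
    exact pow_pos (half_pos B.two_ν_rp_sub_q_pos) 2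
  unfold Rsq at h3 ⊢
  have h4 := (pos_iff_pos_of_mul_pos h3).mp (by positivity)
  have h5 : 0 < r := h1.trans_le hr
  refine mul_pos (by positivity) (h4.trans_le ?_)
  have := mul_le_mul_of_nonneg_left hr h2.le
  linarith

/-- `(r - r₊) (r - r₋)`. -/
def quad (r : ℝ) : ℝ := (r - B.rp) * (r - B.rm)

theorem quad_pos {r : ℝ} (hr : B.rp < r) : 0 < B.quad r :=
  mul_pos (sub_pos.mpr hr) (sub_pos.mpr (B.rm_lt_rp.trans hr))

theorem four_mul_Rsq_mul_Nsq {r : ℝ} (hr : B.rp < r) :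
    4 * B.Rsq r * B.Nsq r = (B.ν ^ 2 + 3) * B.quad r := by
  have := (B.Rsq_pos hr.le).ne'
  unfold Nsq quad
  field_simp

theorem Rsq_mul_Nθ {r : ℝ} (hr : B.rp < r) : B.Rsq r * B.Nθ r = (2 * B.ν * r - B.q) / 2 := by
  have := (B.Rsq_pos hr.le).ne'
  unfold Nθ
  field_simp

theorem Rsq_sub_sq (r : ℝ) : B.Rsq r - ((2 * B.ν * r - B.q) / 2) ^ 2 =
    -((B.ν ^ 2 + 3) * B.quad r / 4) := by
  unfold Rsq quad
  linear_combination (-1 / 4) * B.q_sq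

/-- The components of the inverse metric in the exterior region. -/
noncomputable def inverseMetric (r : ℝ) : Matrix (Fin 3) (Fin 3) ℝ :=
  !![-(4 * B.Rsq r) / ((B.ν ^ 2 + 3) * B.quad r), 0,
      2 * (2 * B.ν * r - B.q) / ((B.ν ^ 2 + 3) * B.quad r);
    0, (B.ν ^ 2 + 3) * B.quad r, 0;
    2 * (2 * B.ν * r - B.q) / ((B.ν ^ 2 + 3) * B.quad r), 0,
      -4 / ((B.ν ^ 2 + 3) * B.quad r)]

theorem det_metric {x : Fin 3 → ℝ} (hx : B.rp < x 1) : (B.metric x).det = -1 / 4 := by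
  have h1 := B.ν_sq_add_three_pos.ne'
  have h2 := (B.quad_pos hx).ne'
  have h3 := B.Rsq_sub_sq (x 1)
  rw [metric, B.Rsq_mul_Nθ hx, B.four_mul_Rsq_mul_Nsq hx, Matrix.det_fin_three]
  simp
  field_simp
  linear_combination 16 * h3

theorem inv_metric {x : Fin 3 → ℝ} (hx : B.rp < x 1) :
    (B.metric x)⁻¹ = B.inverseMetric (x 1) := by
  have h1 := B.ν_sq_add_three_pos.ne'
  have h2 := (B.quad_pos hx).ne'
  have h3 := B.Rsq_sub_sq (x 1)
  refine Matrix.inv_eq_right_inv ?_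
  rw [metric, B.Rsq_mul_Nθ hx, B.four_mul_Rsq_mul_Nsq hx, inverseMetric]
  generalize B.Rsq (x 1) = R2 at *
  generalize (2 * B.ν * x 1 - B.q) = w at *
  generalize (B.ν ^ 2 + 3) = A at *
  generalize B.quad (x 1) = D at *
  ext i j
  fin_cases i <;> fin_cases j <;> simp [Matrix.mul_apply, Fin.sum_univ_three]
  · field_simp
    linear_combination (-4) * h3
  · field_simp
    ring
  · field_simp
  · field_simp
    ring
  · field_simp
    linear_combination (-4) * h3

/-- In the exterior region `partialD` only depends on the values there. -/
theorem partialD_congr {μ : Fin 3} {F G : (Fin 3 → ℝ) → ℂ} {x : Fin 3 → ℝ} (hx : B.rp < x 1)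
    (h : ∀ y : Fin 3 → ℝ, B.rp < y 1 → F y = G y) : partialD μ F x = partialD μ G x := by
  refine Filter.EventuallyEq.deriv_eq ?_
  have hc : Continuous fun s : ℝ => Function.update x μ s 1 :=
    (continuous_apply 1).comp
      (continuous_const.update μ continuous_id : Continuous fun s => Function.update x μ s)
  have hx' : B.rp < Function.update x μ (x μ) 1 := by rwa [Function.update_eq_self]
  filter_upwards [hc.continuousAt.eventually (lt_mem_nhds hx')] with s hs using h _ hs

theorem partialD_modeField_zero (k : ℤ) (ω : ℂ) (φ : ℝ → ℂ) (x : Fin 3 → ℝ) :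
    partialD 0 (modeField k ω φ) x = -Complex.I * ω * modeField k ω φ x := by
  have h1 : HasDerivAt (fun s : ℝ => -Complex.I * ω * (s : ℂ) + Complex.I * (k : ℂ) * (x 2 : ℂ))
      (-Complex.I * ω * 1) (x 0) :=
    (Complex.ofRealCLM.hasDerivAt.const_mul _).add_const _
  have h2 := h1.cexp.mul_const (φ (x 1))
  unfold partialD modeField
  simp only [Function.update_self, ne_eq, Fin.reduceEq, not_false_eq_true, Function.update_of_ne,
    one_ne_zero]
  rw [h2.deriv]
  ring

theorem partialD_modeField_two (k : ℤ) (ω : ℂ) (φ : ℝ → ℂ) (x : Fin 3 → ℝ) :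
    partialD 2 (modeField k ω φ) x = Complex.I * k * modeField k ω φ x := by
  have h1 : HasDerivAt (fun s : ℝ => -Complex.I * ω * (x 0 : ℂ) + Complex.I * (k : ℂ) * (s : ℂ))
      (Complex.I * (k : ℂ) * 1) (x 2) :=
    (Complex.ofRealCLM.hasDerivAt.const_mul _).const_add _
  have h2 := h1.cexp.mul_const (φ (x 1))
  unfold partialD modeField
  simp only [Function.update_self, ne_eq, Fin.reduceEq, not_false_eq_true, Function.update_of_ne]
  rw [h2.deriv]
  ring

theorem partialD_modeField_one (k : ℤ) (ω : ℂ) (φ : ℝ → ℂ) (x : Fin 3 → ℝ) :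
    partialD 1 (modeField k ω φ) x = modeField k ω (deriv φ) x := by
  unfold partialD modeField
  simp only [Function.update_self, ne_eq, Fin.reduceEq, not_false_eq_true, Function.update_of_ne,
    zero_ne_one]
  exact deriv_const_mul_field _

/-- The numerator `4 R² ω² + 4 ω k (2 ν r - q) + 4 k²` of the term that the `t` and `θ` derivatives
contribute to the radial equation. -/
noncomputable def modePot (k : ℤ) (ω : ℂ) (r : ℝ) : ℂ :=
  4 * B.Rsq r * ω ^ 2 + 4 * ω * k * (2 * B.ν * r - B.q) + 4 * k ^ 2

theorem box_modeField (k : ℤ) (ω : ℂ) (φ : ℝ → ℂ) {x : Fin 3 → ℝ} (hx : B.rp < x 1) :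
    B.box (modeField k ω φ) x =
      Complex.exp (-Complex.I * ω * (x 0 : ℂ) + Complex.I * (k : ℂ) * (x 2 : ℂ)) *
        (deriv (fun s : ℝ => (((B.ν ^ 2 + 3) * B.quad s : ℝ) : ℂ) * deriv φ s) (x 1) +
          B.modePot k ω (x 1) / (((B.ν ^ 2 + 3) * B.quad (x 1) : ℝ) : ℂ) * φ (x 1)) := by
  have hA : ((B.ν : ℂ) ^ 2 + 3) ≠ 0 := by exact_mod_cast B.ν_sq_add_three_pos.ne'
  have hq : (B.quad (x 1) : ℂ) ≠ 0 := by exact_mod_cast (B.quad_pos hx).ne'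
  have hs : √|(-1 / 4 : ℝ)| = 1 / 2 := by
    rw [show |(-1 / 4 : ℝ)| = (1 / 2) ^ 2 by norm_num [abs_of_neg]]
    exact Real.sqrt_sq (by norm_num)
  have hcoef : ∀ μ ρ : Fin 3, partialD μ (fun y =>
      ((√|(B.metric y).det| * (B.metric y)⁻¹ μ ρ : ℝ) : ℂ) * partialD ρ (modeField k ω φ) y) x =
      partialD μ (fun y => ((1 / 2 * B.inverseMetric (y 1) μ ρ : ℝ) : ℂ) *
        partialD ρ (modeField k ω φ) y) x := fun μ ρ =>
    B.partialD_congr hx fun y hy => by rw [B.det_metric hy, B.inv_metric hy, hs]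
  have hzero : ∀ μ, partialD μ (fun _ => (0 : ℂ)) x = 0 := fun μ => by simp [partialD]
  have hKilling : ∀ (μ ρ : Fin 3) (κ κ' : ℂ), μ ≠ 1 →
      partialD μ (modeField k ω φ) x = κ * modeField k ω φ x →
      (∀ y, partialD ρ (modeField k ω φ) y = κ' * modeField k ω φ y) →
      partialD μ (fun y => ((1 / 2 * B.inverseMetric (y 1) μ ρ : ℝ) : ℂ) *
        partialD ρ (modeField k ω φ) y) x =
      ((1 / 2 * B.inverseMetric (x 1) μ ρ : ℝ) : ℂ) * (κ' * (κ * modeField k ω φ x)) := by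
    intro μ ρ κ κ' hμ h1 h2
    rw [← h1]
    simp only [h2]
    unfold partialD
    simp only [Function.update_of_ne hμ.symm]
    rw [deriv_const_mul_field, deriv_const_mul_field]
  have h11 : partialD 1 (fun y => ((1 / 2 * B.inverseMetric (y 1) 1 1 : ℝ) : ℂ) *
      partialD 1 (modeField k ω φ) y) x =
      1 / 2 * (Complex.exp (-Complex.I * ω * (x 0 : ℂ) + Complex.I * (k : ℂ) * (x 2 : ℂ)) *
        deriv (fun s : ℝ => (((B.ν ^ 2 + 3) * B.quad s : ℝ) : ℂ) * deriv φ s) (x 1)) := by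
    simp only [partialD_modeField_one]
    unfold partialD modeField
    simp only [Function.update_self, ne_eq, Fin.reduceEq, not_false_eq_true, Function.update_of_ne,
      zero_ne_one]
    rw [← deriv_const_mul_field, ← deriv_const_mul_field]
    congr 1
    ext s
    simp [inverseMetric]
    ring
  have e01 : ∀ r, B.inverseMetric r 0 1 = 0 := fun r => by simp [inverseMetric]
  have e10 : ∀ r, B.inverseMetric r 1 0 = 0 := fun r => by simp [inverseMetric]
  have e12 : ∀ r, B.inverseMetric r 1 2 = 0 := fun r => by simp [inverseMetric]
  have e21 : ∀ r, B.inverseMetric r 2 1 = 0 := fun r => by simp [inverseMetric]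
  have p0 := partialD_modeField_zero k ω φ
  have p2 := partialD_modeField_two k ω φ
  unfold box
  rw [B.det_metric hx, hs]
  simp only [hcoef, Fin.sum_univ_three]
  rw [h11, hKilling 0 0 _ _ (by decide) (p0 x) p0, hKilling 0 2 _ _ (by decide) (p0 x) p2,
    hKilling 2 0 _ _ (by decide) (p2 x) p0, hKilling 2 2 _ _ (by decide) (p2 x) p2]
  simp only [e01, e10, e12, e21, mul_zero, Complex.ofReal_zero, zero_mul, hzero, add_zero, zero_add]
  simp [inverseMetric, modePot, modeField]
  field_simp
  linear_combination (-(4 * (B.Rsq (x 1) : ℂ) * ω ^ 2 + 4 * ω * k * (2 * B.ν * x 1 - B.q) +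
    4 * k ^ 2) * φ (x 1)) * Complex.I_sq

/-- `φ` solves the radial equation on `(r₊, ∞)`, with first derivative `φ'` and second
derivative `φ''`. -/
def SolvesRadial (msq : ℝ) (k : ℤ) (ω : ℂ) (φ φ' φ'' : ℝ → ℂ) : Prop :=
  ∀ r, B.rp < r → HasDerivAt φ (φ' r) r ∧ HasDerivAt φ' (φ'' r) r ∧
    ((B.ν : ℂ) ^ 2 + 3) * B.quad r * φ'' r + ((B.ν : ℂ) ^ 2 + 3) * (2 * r - B.rp - B.rm) * φ' r +
      (B.modePot k ω r / (((B.ν : ℂ) ^ 2 + 3) * B.quad r) - msq) * φ r = 0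

theorem hasDerivAt_quad (r : ℝ) :
    HasDerivAt (fun s : ℝ => (((B.ν ^ 2 + 3) * B.quad s : ℝ) : ℂ))
      (((B.ν : ℂ) ^ 2 + 3) * (2 * r - B.rp - B.rm)) r := by
  have h1 : HasDerivAt B.quad (1 * (r - B.rm) + (r - B.rp) * 1) r :=
    ((hasDerivAt_id r).sub_const B.rp).mul ((hasDerivAt_id r).sub_const B.rm)
  have h2 := (h1.const_mul (B.ν ^ 2 + 3)).ofReal_comp
  convert! h2 using 1
  push_cast
  ring

variable {B}

theorem SolvesRadial.isModeSolution {msq : ℝ} {k : ℤ} {ω : ℂ} {φ φ' φ'' : ℝ → ℂ}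
    (h : B.SolvesRadial msq k ω φ φ' φ'') (hφ : ContDiffOn ℝ 2 φ (Set.Ioi B.rp)) :
    B.IsModeSolution msq k ω φ := by
  refine ⟨hφ, fun x hx => ?_⟩
  obtain ⟨h0, h1, h2⟩ := h (x 1) hx
  have he : deriv φ =ᶠ[𝓝 (x 1)] φ' := by
    filter_upwards [Ioi_mem_nhds hx] with r hr using (h r hr).1.deriv
  have hd : HasDerivAt (fun s : ℝ => (((B.ν ^ 2 + 3) * B.quad s : ℝ) : ℂ) * deriv φ s) _ (x 1) :=
    (B.hasDerivAt_quad (x 1)).mul (h1.congr_of_eventuallyEq he)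
  rw [B.box_modeField k ω φ hx, hd.deriv, h0.deriv, modeField]
  push_cast
  linear_combination Complex.exp (-Complex.I * ω * (x 0 : ℂ) + Complex.I * (k : ℂ) * (x 2 : ℂ)) * h2

theorem IsModeSolution.solvesRadial {msq : ℝ} {k : ℤ} {ω : ℂ} {φ : ℝ → ℂ}
    (h : B.IsModeSolution msq k ω φ) : B.SolvesRadial msq k ω φ (deriv φ) (deriv (deriv φ)) := by
  intro r hr
  have hmem : Set.Ioi B.rp ∈ 𝓝 r := Ioi_mem_nhds hr
  have hd : ContDiffOn ℝ 1 (deriv φ) (Set.Ioi B.rp) :=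
    ((contDiffOn_succ_iff_deriv_of_isOpen (n := 1) isOpen_Ioi).mp
      (by simpa [one_add_one_eq_two] using h.1)).2.2
  have h0 : HasDerivAt φ (deriv φ r) r :=
    ((h.1.contDiffAt hmem).differentiableAt (by norm_num)).hasDerivAt
  have h1 : HasDerivAt (deriv φ) (deriv (deriv φ) r) r :=
    ((hd.contDiffAt hmem).differentiableAt (by norm_num)).hasDerivAt
  refine ⟨h0, h1, ?_⟩
  have h2 := h.2 ![0, r, 0] (by simpa using hr)
  have hd : HasDerivAt (fun s : ℝ => (((B.ν ^ 2 + 3) * B.quad s : ℝ) : ℂ) * deriv φ s) _ r :=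
    (B.hasDerivAt_quad r).mul h1
  rw [B.box_modeField k ω φ (by simpa using hr),
    show (![0, r, 0] : Fin 3 → ℝ) 1 = r from rfl, hd.deriv] at h2
  simp [modeField] at h2
  linear_combination h2

end StretchedBlackHole

namespace StretchedBlackHole

variable (B : StretchedBlackHole)

/-! ### Reduction to the hypergeometric equation -/

/-- The coordinate `z = (r - r₊) / (r - r₋)`, which maps the exterior region onto `(0, 1)`. -/
noncomputable def zOf (r : ℝ) : ℝ := (r - B.rp) / (r - B.rm)

/-- The inverse of `zOf`. -/
noncomputable def rOf (z : ℝ) : ℝ := (B.rp - B.rm * z) / (1 - z)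

theorem zOf_mem {r : ℝ} (hr : B.rp < r) : B.zOf r ∈ Set.Ioo (0 : ℝ) 1 := by
  have h1 := B.rm_lt_rp
  have h2 : 0 < r - B.rm := by linarith
  exact ⟨div_pos (by linarith) h2, (div_lt_one h2).mpr (by linarith)⟩

theorem rOf_sub_rp {z : ℝ} (hz : z < 1) : B.rOf z - B.rp = (B.rp - B.rm) * z / (1 - z) := by
  have : 1 - z ≠ 0 := (sub_pos.mpr hz).ne'
  unfold rOf
  field_simp
  ring

theorem rOf_sub_rm {z : ℝ} (hz : z < 1) : B.rOf z - B.rm = (B.rp - B.rm) / (1 - z) := by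
  have : 1 - z ≠ 0 := (sub_pos.mpr hz).ne'
  unfold rOf
  field_simp
  ring

theorem rp_lt_rOf {z : ℝ} (hz : z ∈ Set.Ioo (0 : ℝ) 1) : B.rp < B.rOf z := by
  rw [← sub_pos, B.rOf_sub_rp hz.2]
  exact div_pos (mul_pos B.rp_sub_rm_pos hz.1) (sub_pos.mpr hz.2)

theorem zOf_rOf {z : ℝ} (hz : z < 1) : B.zOf (B.rOf z) = z := by
  have h1 : 1 - z ≠ 0 := (sub_pos.mpr hz).ne'
  have h2 := B.rp_sub_rm_pos.ne'
  rw [zOf, B.rOf_sub_rp hz, B.rOf_sub_rm hz]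
  field_simp

theorem one_sub_zOf {r : ℝ} (hr : B.rp < r) : 1 - B.zOf r = (B.rp - B.rm) / (r - B.rm) := by
  have : r - B.rm ≠ 0 := by linarith [B.rm_lt_rp]
  unfold zOf
  field_simp
  ring

theorem rOf_zOf {r : ℝ} (hr : B.rp < r) : B.rOf (B.zOf r) = r := by
  have h1 : r - B.rm ≠ 0 := by linarith [B.rm_lt_rp]
  have h2 := B.rp_sub_rm_pos.ne'
  rw [rOf, B.one_sub_zOf hr, zOf]
  field_simp
  ring

theorem quad_rOf {z : ℝ} (hz : z < 1) :
    B.quad (B.rOf z) = (B.rp - B.rm) ^ 2 * z / (1 - z) ^ 2 := by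
  have : 1 - z ≠ 0 := (sub_pos.mpr hz).ne'
  rw [quad, B.rOf_sub_rp hz, B.rOf_sub_rm hz]
  field_simp

theorem hasDerivAt_rOf {z : ℝ} (hz : z < 1) :
    HasDerivAt B.rOf ((B.rp - B.rm) / (1 - z) ^ 2) z := by
  have h1 : 1 - z ≠ 0 := (sub_pos.mpr hz).ne'
  have h2 := (((hasDerivAt_id z).const_mul B.rm).const_sub B.rp).div
    ((hasDerivAt_id z).const_sub 1) h1
  convert! h2 using 1
  simp
  ring

theorem hasDerivAt_zOf {r : ℝ} (hr : B.rp < r) :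
    HasDerivAt B.zOf ((B.rp - B.rm) / (r - B.rm) ^ 2) r := by
  have h1 : r - B.rm ≠ 0 := by linarith [B.rm_lt_rp]
  have h2 := ((hasDerivAt_id r).sub_const B.rp).div ((hasDerivAt_id r).sub_const B.rm) h1
  convert! h2 using 1
  simp

/-- The potential of the radial equation in the coordinate `z`, when `± α`, `β` and `1 - β` are
the exponents at `z = 0` and `z = 1`. -/
noncomputable def zPotential (α β γ : ℂ) (z : ℝ) : ℂ :=
  -α ^ 2 / z + (γ ^ 2 - α ^ 2) / (1 - z) + β * (1 - β) / (1 - z) ^ 2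

/-- `ψ` solves the radial equation in the coordinate `z` on `(0, 1)`. -/
def SolvesZ (α β γ : ℂ) (ψ ψ' ψ'' : ℝ → ℂ) : Prop :=
  ∀ z ∈ Set.Ioo (0 : ℝ) 1, HasDerivAt ψ (ψ' z) z ∧ HasDerivAt ψ' (ψ'' z) z ∧
    z * ψ'' z + ψ' z + zPotential α β γ z * ψ z = 0

/-- The partial fraction decomposition of the potential: the residues at the horizons are perfect
squares, because `R²` is one there. -/
theorem modePot_eq (k : ℤ) (ω : ℂ) (r : ℝ) : B.modePot k ω r =
    ((B.ν : ℂ) ^ 2 + 3) ^ 2 * (-B.γ k ω ^ 2 * (B.rp - B.rm) ^ 2 +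
      (B.γ k ω ^ 2 - B.α k ω ^ 2) * (B.rp - B.rm) * (r - B.rm)) +
      3 * ((B.ν : ℂ) ^ 2 - 1) * ω ^ 2 * (r - B.rm) * (r - B.rp) := by
  have h1 : ((B.rp : ℂ) - B.rm) ≠ 0 := by exact_mod_cast B.rp_sub_rm_pos.ne'
  have h2 : ((B.ν : ℂ) ^ 2 + 3) ≠ 0 := by exact_mod_cast B.ν_sq_add_three_pos.ne'
  have hq : (B.q : ℂ) ^ 2 = B.rp * B.rm * ((B.ν : ℂ) ^ 2 + 3) := by exact_mod_cast B.q_sq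
  have hγ : B.γ k ω ^ 2 * (((B.ν : ℂ) ^ 2 + 3) ^ 2 * (B.rp - B.rm) ^ 2) =
      -(ω * (2 * B.ν * B.rm - B.q) + 2 * k) ^ 2 := by
    rw [γ]
    push_cast
    field_simp
    linear_combination (ω * (2 * B.ν * B.rm - B.q) + 2 * k) ^ 2 * Complex.I_sq
  have hα : B.α k ω ^ 2 * (((B.ν : ℂ) ^ 2 + 3) ^ 2 * (B.rp - B.rm) ^ 2) =
      -(ω * (2 * B.ν * B.rp - B.q) + 2 * k) ^ 2 := by
    rw [α_eq]
    push_cast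
    field_simp
    linear_combination (ω * (2 * B.ν * B.rp - B.q) + 2 * k) ^ 2 * Complex.I_sq
  have key : B.modePot k ω r * (B.rp - B.rm) =
    (((B.ν : ℂ) ^ 2 + 3) ^ 2 * (-B.γ k ω ^ 2 * (B.rp - B.rm) ^ 2 +
      (B.γ k ω ^ 2 - B.α k ω ^ 2) * (B.rp - B.rm) * (r - B.rm)) +
      3 * ((B.ν : ℂ) ^ 2 - 1) * ω ^ 2 * (r - B.rm) * (r - B.rp)) * (B.rp - B.rm) := by
    rw [modePot, Rsq]
    push_cast
    linear_combination (B.rp - r : ℂ) * hγ + (r - B.rm : ℂ) * hα - ω ^ 2 * (B.rp - B.rm) * hq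
  exact mul_right_cancel₀ h1 key

theorem zPotential_eq {msq : ℝ} {k : ℤ} {ω β : ℂ}
    (hβ : β * (1 - β) = 3 * ((B.ν : ℂ) ^ 2 - 1) * ω ^ 2 / ((B.ν : ℂ) ^ 2 + 3) ^ 2
      - msq / ((B.ν : ℂ) ^ 2 + 3)) {z : ℝ} (hz : z ∈ Set.Ioo (0 : ℝ) 1) :
    B.modePot k ω (B.rOf z) / (((B.ν : ℂ) ^ 2 + 3) * B.quad (B.rOf z)) - msq =
      ((B.ν : ℂ) ^ 2 + 3) * (1 - z) ^ 2 * zPotential (B.α k ω) β (B.γ k ω) z := by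
  have h1 : ((B.rp : ℂ) - B.rm) ≠ 0 := by exact_mod_cast B.rp_sub_rm_pos.ne'
  have h2 : ((B.ν : ℂ) ^ 2 + 3) ≠ 0 := by exact_mod_cast B.ν_sq_add_three_pos.ne'
  have h3 : (z : ℂ) ≠ 0 := by exact_mod_cast hz.1.ne'
  have h4 : (1 : ℂ) - z ≠ 0 := by exact_mod_cast (sub_pos.mpr hz.2).ne'
  have e1 : (B.rOf z : ℂ) - B.rp = (B.rp - B.rm) * z / (1 - z) := by
    exact_mod_cast congrArg (fun x : ℝ => (x : ℂ)) (B.rOf_sub_rp hz.2)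
  have e2 : (B.rOf z : ℂ) - B.rm = (B.rp - B.rm) / (1 - z) := by
    exact_mod_cast congrArg (fun x : ℝ => (x : ℂ)) (B.rOf_sub_rm hz.2)
  rw [modePot_eq, B.quad_rOf hz.2, e1, e2, zPotential, hβ]
  push_cast
  generalize B.α k ω = α
  generalize B.γ k ω = γ
  field_simp
  ring

variable {B}

theorem SolvesRadial.solvesZ {msq : ℝ} {k : ℤ} {ω β : ℂ} {φ φ' φ'' : ℝ → ℂ}
    (hβ : β * (1 - β) = 3 * ((B.ν : ℂ) ^ 2 - 1) * ω ^ 2 / ((B.ν : ℂ) ^ 2 + 3) ^ 2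
      - msq / ((B.ν : ℂ) ^ 2 + 3)) (h : B.SolvesRadial msq k ω φ φ' φ'') :
    SolvesZ (B.α k ω) β (B.γ k ω) (fun z => φ (B.rOf z))
      (fun z => ((B.rp - B.rm) / (1 - z) ^ 2 : ℝ) * φ' (B.rOf z))
      (fun z => (2 * (B.rp - B.rm) / (1 - z) ^ 3 : ℝ) * φ' (B.rOf z) +
        (((B.rp - B.rm) / (1 - z) ^ 2 : ℝ) : ℂ) ^ 2 * φ'' (B.rOf z)) := by
  intro z hz
  obtain ⟨h0, h1, h2⟩ := h _ (B.rp_lt_rOf hz)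
  have hr := B.hasDerivAt_rOf hz.2
  have hz1 : 1 - z ≠ 0 := (sub_pos.mpr hz.2).ne'
  have hc : HasDerivAt (fun z : ℝ => ((B.rp - B.rm) / (1 - z) ^ 2 : ℝ))
      (2 * (B.rp - B.rm) / (1 - z) ^ 3) z := by
    have := (hasDerivAt_const z (B.rp - B.rm)).div (((hasDerivAt_id z).const_sub 1).pow 2)
      (pow_ne_zero 2 hz1)
    convert! this using 1
    simp
    field_simp
  have d0 := h0.scomp z hr
  have d1 := hc.ofReal_comp.mul (h1.scomp z hr)
  refine ⟨?_, ?_, ?_⟩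
  · convert! d0 using 1
  · convert! d1 using 1
    simp only [Complex.real_smul, Function.comp]
    ring
  · rw [B.zPotential_eq hβ hz] at h2
    have h1' : ((B.rp : ℂ) - B.rm) ≠ 0 := by exact_mod_cast B.rp_sub_rm_pos.ne'
    have h2' : ((B.ν : ℂ) ^ 2 + 3) ≠ 0 := by exact_mod_cast B.ν_sq_add_three_pos.ne'
    have h4 : (1 : ℂ) - z ≠ 0 := by exact_mod_cast hz1
    have e1 : (B.rOf z : ℂ) - B.rp = (B.rp - B.rm) * z / (1 - z) := by
      exact_mod_cast congrArg (fun x : ℝ => (x : ℂ)) (B.rOf_sub_rp hz.2)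
    have e2 : (B.rOf z : ℂ) - B.rm = (B.rp - B.rm) / (1 - z) := by
      exact_mod_cast congrArg (fun x : ℝ => (x : ℂ)) (B.rOf_sub_rm hz.2)
    rw [show (2 * (B.rOf z : ℂ) - B.rp - B.rm) = (B.rOf z - B.rp) + (B.rOf z - B.rm) by ring,
      e1, e2, B.quad_rOf hz.2] at h2
    push_cast at h2 ⊢
    generalize zPotential (B.α k ω) β (B.γ k ω) z = V at *
    generalize φ (B.rOf z) = f0 at *
    generalize φ' (B.rOf z) = f1 at *
    generalize φ'' (B.rOf z) = f2 at *
    refine mul_left_cancel₀ (mul_ne_zero h2' (pow_ne_zero 2 h4)) ?_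
    rw [mul_zero, ← h2]
    field_simp
    ring

theorem SolvesZ.solvesRadial {msq : ℝ} {k : ℤ} {ω β : ℂ} {ψ ψ' ψ'' : ℝ → ℂ}
    (hβ : β * (1 - β) = 3 * ((B.ν : ℂ) ^ 2 - 1) * ω ^ 2 / ((B.ν : ℂ) ^ 2 + 3) ^ 2
      - msq / ((B.ν : ℂ) ^ 2 + 3)) (h : SolvesZ (B.α k ω) β (B.γ k ω) ψ ψ' ψ'') :
    B.SolvesRadial msq k ω (fun r => ψ (B.zOf r))
      (fun r => ((B.rp - B.rm) / (r - B.rm) ^ 2 : ℝ) * ψ' (B.zOf r))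
      (fun r => (-(2 * (B.rp - B.rm)) / (r - B.rm) ^ 3 : ℝ) * ψ' (B.zOf r) +
        (((B.rp - B.rm) / (r - B.rm) ^ 2 : ℝ) : ℂ) ^ 2 * ψ'' (B.zOf r)) := by
  intro r hr
  obtain ⟨h0, h1, h2⟩ := h _ (B.zOf_mem hr)
  have hz := B.hasDerivAt_zOf hr
  have hr1 : r - B.rm ≠ 0 := by linarith [B.rm_lt_rp]
  have hc : HasDerivAt (fun r : ℝ => ((B.rp - B.rm) / (r - B.rm) ^ 2 : ℝ))
      (-(2 * (B.rp - B.rm)) / (r - B.rm) ^ 3) r := by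
    have := (hasDerivAt_const r (B.rp - B.rm)).div (((hasDerivAt_id r).sub_const B.rm).pow 2)
      (pow_ne_zero 2 hr1)
    convert! this using 1
    simp
    field_simp
  have d0 := h0.scomp r hz
  have d1 := hc.ofReal_comp.mul (h1.scomp r hz)
  refine ⟨?_, ?_, ?_⟩
  · convert! d0 using 1
  · convert! d1 using 1
    simp only [Complex.real_smul, Function.comp]
    ring
  · have hV := B.zPotential_eq (k := k) hβ (B.zOf_mem hr)
    rw [B.rOf_zOf hr] at hV
    rw [hV]
    have h1' : ((B.rp : ℂ) - B.rm) ≠ 0 := by exact_mod_cast B.rp_sub_rm_pos.ne'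
    have h2' : ((B.ν : ℂ) ^ 2 + 3) ≠ 0 := by exact_mod_cast B.ν_sq_add_three_pos.ne'
    have h4 : (r : ℂ) - B.rm ≠ 0 := by exact_mod_cast hr1
    have e1 : (1 : ℂ) - B.zOf r = (B.rp - B.rm) / (r - B.rm) := by
      exact_mod_cast congrArg (fun x : ℝ => (x : ℂ)) (B.one_sub_zOf hr)
    have e2 : (B.zOf r : ℂ) = (r - B.rp) / (r - B.rm) := by
      rw [zOf]; push_cast; rfl
    rw [e1, quad]
    beta_reduce
    generalize zPotential (B.α k ω) β (B.γ k ω) (B.zOf r) = V at *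
    generalize ψ (B.zOf r) = f0 at *
    generalize ψ' (B.zOf r) = f1 at *
    generalize ψ'' (B.zOf r) = f2 at *
    rw [e2] at h2
    have h3 : V * f0 = -((r - B.rp) / (r - B.rm) * f2 + f1) := by linear_combination h2
    rw [mul_assoc _ V, h3]
    push_cast
    field_simp
    ring

/-- The prefactor `z ^ s (1 - z) ^ t`. -/
noncomputable def endFactor (s t : ℂ) (z : ℝ) : ℂ := powC z s * powC (1 - z) t

/-- The logarithmic derivative of `endFactor`. -/
noncomputable def endLogDeriv (s t : ℂ) (z : ℝ) : ℂ := s / z - t / (1 - z)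

theorem hasDerivAt_endFactor (s t : ℂ) {z : ℝ} (hz : z ∈ Set.Ioo (0 : ℝ) 1) :
    HasDerivAt (endFactor s t) (endLogDeriv s t z * endFactor s t z) z := by
  have h := (hasDerivAt_powC hz.1 s).mul (hasDerivAt_powC_one_sub hz.2 t)
  convert! h using 1
  simp only [endLogDeriv, endFactor]
  ring

theorem hasDerivAt_endLogDeriv (s t : ℂ) {z : ℝ} (hz : z ∈ Set.Ioo (0 : ℝ) 1) :
    HasDerivAt (endLogDeriv s t) (-s / (z : ℂ) ^ 2 - t / (1 - (z : ℂ)) ^ 2) z := by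
  have h3 : (z : ℂ) ≠ 0 := by exact_mod_cast hz.1.ne'
  have h4 : (1 : ℂ) - z ≠ 0 := by exact_mod_cast (sub_pos.mpr hz.2).ne'
  have hid : HasDerivAt (fun x : ℝ => (x : ℂ)) 1 z := Complex.ofRealCLM.hasDerivAt
  have h := ((hasDerivAt_const z s).div hid h3).sub
    ((hasDerivAt_const z t).div (hid.const_sub 1) h4)
  convert! h using 1
  simp

theorem hasDerivAt_mul_endFactor (s t : ℂ) {f f' f'' : ℝ → ℂ} {z : ℝ}
    (hz : z ∈ Set.Ioo (0 : ℝ) 1) (h0 : HasDerivAt f (f' z) z) (h1 : HasDerivAt f' (f'' z) z) :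
    HasDerivAt (fun x => f x * endFactor s t x)
      ((f' z + endLogDeriv s t z * f z) * endFactor s t z) z ∧
    HasDerivAt (fun x => (f' x + endLogDeriv s t x * f x) * endFactor s t x)
      ((f'' z + 2 * endLogDeriv s t z * f' z + (-s / (z : ℂ) ^ 2 - t / (1 - (z : ℂ)) ^ 2 +
        endLogDeriv s t z ^ 2) * f z) * endFactor s t z) z := by
  have e := hasDerivAt_endFactor s t hz
  have l := hasDerivAt_endLogDeriv s t hz
  constructor
  · convert! h0.mul e using 1
    ring
  · convert! (h1.add (l.mul h0)).mul e using 1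
    simp only [Pi.add_apply, Pi.mul_apply]
    ring

theorem SolvesZ.solvesHypergeometric {α β γ : ℂ} {ψ ψ' ψ'' : ℝ → ℂ}
    (h : SolvesZ α β γ ψ ψ' ψ'') :
    ∃ u' u'', SolvesHypergeometric (α + β + γ) (α + β - γ) (2 * α + 1)
      (fun z => ψ z * endFactor (-α) (-β) z) u' u'' := by
  refine ⟨fun z => (ψ' z + endLogDeriv (-α) (-β) z * ψ z) * endFactor (-α) (-β) z,
    fun z => (ψ'' z + 2 * endLogDeriv (-α) (-β) z * ψ' z + (-(-α) / (z : ℂ) ^ 2 -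
      -β / (1 - (z : ℂ)) ^ 2 + endLogDeriv (-α) (-β) z ^ 2) * ψ z) * endFactor (-α) (-β) z,
    fun z hz => ?_⟩
  obtain ⟨h0, h1, h2⟩ := h z hz
  obtain ⟨d0, d1⟩ := hasDerivAt_mul_endFactor (-α) (-β) hz h0 h1
  refine ⟨d0, d1, ?_⟩
  have h3 : (z : ℂ) ≠ 0 := by exact_mod_cast hz.1.ne'
  have h4 : (1 : ℂ) - z ≠ 0 := by exact_mod_cast (sub_pos.mpr hz.2).ne'
  have h5 : ψ'' z = -(ψ' z + zPotential α β γ z * ψ z) / z := by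
    field_simp
    linear_combination h2
  beta_reduce
  rw [h5, zPotential, endLogDeriv]
  generalize endFactor (-α) (-β) z = e
  field_simp
  ring

theorem _root_.SolvesHypergeometric.solvesZ {α β γ : ℂ} {u u' u'' : ℝ → ℂ}
    (h : SolvesHypergeometric (α + β + γ) (α + β - γ) (2 * α + 1) u u' u'') :
    ∃ ψ' ψ'', SolvesZ α β γ (fun z => u z * endFactor α β z) ψ' ψ'' := by
  refine ⟨fun z => (u' z + endLogDeriv α β z * u z) * endFactor α β z,
    fun z => (u'' z + 2 * endLogDeriv α β z * u' z + (-α / (z : ℂ) ^ 2 -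
      β / (1 - (z : ℂ)) ^ 2 + endLogDeriv α β z ^ 2) * u z) * endFactor α β z,
    fun z hz => ?_⟩
  obtain ⟨h0, h1, h2⟩ := h z hz
  obtain ⟨d0, d1⟩ := hasDerivAt_mul_endFactor α β hz h0 h1
  refine ⟨d0, d1, ?_⟩
  have h3 : (z : ℂ) ≠ 0 := by exact_mod_cast hz.1.ne'
  have h4 : (1 : ℂ) - z ≠ 0 := by exact_mod_cast (sub_pos.mpr hz.2).ne'
  have h5 : u'' z = -((2 * α + 1 - ((α + β + γ) + (α + β - γ) + 1) * z) * u' z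
      - (α + β + γ) * (α + β - γ) * u z) / (z * (1 - z)) := by
    field_simp
    linear_combination h2
  beta_reduce
  rw [h5, zPotential, endLogDeriv]
  generalize endFactor α β z = e
  field_simp
  ring

end StretchedBlackHole

/-! ### Functions with a power-law singularity at an end of the radial interval -/

theorem Real.sqrt_eq_exp_log {x : ℝ} (hx : 0 < x) : √x = Real.exp (Real.log x * (1 / 2)) := by
  rw [Real.sqrt_eq_rpow, Real.rpow_def_of_pos hx]

theorem AnalyticAt.real_sqrt {f : ℝ → ℝ} {x : ℝ} (hf : AnalyticAt ℝ f x) (hx : 0 < f x) :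
    AnalyticAt ℝ (fun y => √(f y)) x := by
  have h1 : AnalyticAt ℝ (fun y => Real.exp (Real.log (f y) * (1 / 2))) x :=
    ((hf.log hx).mul analyticAt_const).rexp
  refine h1.congr ?_
  filter_upwards [hf.continuousAt.eventually (lt_mem_nhds hx)] with y hy
  exact (Real.sqrt_eq_exp_log hy).symm

theorem AnalyticAt.complex_ofReal {f : ℝ → ℝ} {x : ℝ} (hf : AnalyticAt ℝ f x) :
    AnalyticAt ℝ (fun y => (f y : ℂ)) x :=
  (Complex.ofRealCLM.analyticAt _).fun_comp hf

theorem ofReal_sqrt_eq_powC {x : ℝ} (hx : 0 < x) : ((√x : ℝ) : ℂ) = powC x (1 / 2) := by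
  rw [Real.sqrt_eq_exp_log hx, powC]
  push_cast
  ring_nf

/-- `f x = x ^ s g(x)` for small `x > 0`, with `g` analytic and nonzero at `0`. -/
def PowerAtZero (s : ℂ) (f : ℝ → ℂ) : Prop :=
  ∃ g : ℝ → ℂ, AnalyticAt ℝ g 0 ∧ g 0 ≠ 0 ∧ ∀ᶠ x in 𝓝[>] 0, f x = powC x s * g x

/-- If `x T'(x)` is analytic at `0`, then `T` is a logarithm plus an analytic function, and its
exponentials are power laws. -/
theorem powerAtZero_exp {T G : ℝ → ℝ} (hG : AnalyticAt ℝ G 0)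
    (hT : ∀ᶠ x in 𝓝[>] 0, HasDerivAt T (G x / x) x) (lam : ℂ) :
    PowerAtZero (lam * G 0) (fun x => Complex.exp (lam * (T x : ℂ))) := by
  obtain ⟨D, hD, hGD⟩ := hG.exists_eq_sum_add_pow_mul 1
  have hGD' : ∀ x, G x = G 0 + x * D x := fun x => by simpa using hGD x
  obtain ⟨H, hH, hHd⟩ := hD.exists_primitive
  obtain ⟨ε, hε, hsub⟩ := (mem_nhdsGT_iff_exists_Ioo_subset' (zero_lt_one : (0 : ℝ) < 1)).mp
    (inter_mem hT (hHd.filter_mono nhdsWithin_le_nhds))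
  have hd : ∀ x ∈ Set.Ioo 0 ε, HasDerivAt (fun y => T y - G 0 * Real.log y - H y) 0 x := by
    intro x hx
    have h1 := ((hsub hx).1.sub ((Real.hasDerivAt_log hx.1.ne').const_mul (G 0))).sub (hsub hx).2
    convert! h1 using 1
    have := hx.1.ne'
    rw [hGD' x]
    field_simp
    ring
  obtain ⟨C, hC⟩ := isOpen_Ioo.exists_is_const_of_deriv_eq_zero (isPreconnected_Ioo (a := 0)
    (b := ε)) (fun x hx => (hd x hx).differentiableAt.differentiableWithinAt)
    (fun x hx => (hd x hx).deriv)
  refine ⟨fun x => Complex.exp (lam * ((H x + C : ℝ) : ℂ)), ?_, Complex.exp_ne_zero _, ?_⟩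
  · have h1 : AnalyticAt ℝ Complex.exp (lam * ((H 0 + C : ℝ) : ℂ)) :=
      (Complex.differentiable_exp.analyticAt _).restrictScalars
    exact h1.fun_comp (f := fun x => lam * ((H x + C : ℝ) : ℂ))
      (analyticAt_const.mul (hH.add analyticAt_const).complex_ofReal)
  · filter_upwards [Ioo_mem_nhdsGT hε] with x hx
    have h1 : T x = G 0 * Real.log x + (H x + C) := by
      rw [← hC x hx]; ring
    rw [h1, powC, ← Complex.exp_add]
    push_cast
    ring_nf

namespace StretchedBlackHole

variable (B : StretchedBlackHole)

theorem hasDerivAt_tortoise {r : ℝ} (hr : B.rp < r) :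
    HasDerivAt B.tortoise (2 * B.R r / ((B.ν ^ 2 + 3) * B.quad r)) r := by
  have hRc : Continuous B.R := by
    unfold R Rsq
    fun_prop
  have hc : ContinuousOn (fun s => 1 / (2 * B.R s * B.Nsq s)) (Set.Ioi B.rp) := by
    have hN : ContinuousOn B.Nsq (Set.Ioi B.rp) := by
      unfold Nsq
      refine ContinuousOn.div (by fun_prop) ?_ fun s hs => ?_
      · unfold Rsq
        fun_prop
      · exact mul_ne_zero four_ne_zero (B.Rsq_pos (le_of_lt hs)).ne'
    refine continuousOn_const.div ((continuousOn_const.mul hRc.continuousOn).mul hN) fun s hs => ?_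
    have h1 : 0 < B.R s := Real.sqrt_pos.mpr (B.Rsq_pos (le_of_lt hs))
    have h2 := B.four_mul_Rsq_mul_Nsq hs
    have h3 := mul_pos B.ν_sq_add_three_pos (B.quad_pos hs)
    have h4 : B.Nsq s ≠ 0 := fun h0 => by
      rw [h0, mul_zero] at h2
      linarith
    exact mul_ne_zero (by positivity) h4
  have hsub : Set.uIcc (B.rp + 1) r ⊆ Set.Ioi B.rp := fun s hs =>
    lt_of_lt_of_le (lt_min (by linarith) hr) hs.1
  have hat : ContinuousAt (fun s => 1 / (2 * B.R s * B.Nsq s)) r := hc.continuousAt (Ioi_mem_nhds hr)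
  have h := intervalIntegral.integral_hasDerivAt_right ((hc.mono hsub).intervalIntegrable)
    (hc.stronglyMeasurableAtFilter isOpen_Ioi r hr) hat
  unfold tortoise
  convert! h using 1
  have h1 : 0 < B.R r := Real.sqrt_pos.mpr (B.Rsq_pos hr.le)
  have h2 : B.R r ^ 2 = B.Rsq r := Real.sq_sqrt (B.Rsq_pos hr.le).le
  have h4 := mul_pos B.ν_sq_add_three_pos (B.quad_pos hr)
  have h3 : (B.ν ^ 2 + 3) * B.quad r = 4 * B.R r ^ 2 * B.Nsq r := by
    rw [h2, B.four_mul_Rsq_mul_Nsq hr]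
  have h5 : B.Nsq r ≠ 0 := fun h0 => by
    rw [h0, mul_zero] at h3
    linarith
  rw [h3]
  field_simp
  norm_num

/-! ### Boundary conditions at the horizon -/

theorem analyticAt_rOf : AnalyticAt ℝ B.rOf 0 := by
  unfold rOf
  exact AnalyticAt.div (by fun_prop) (by fun_prop) (by norm_num)

theorem rOf_zero : B.rOf 0 = B.rp := by simp [rOf]

theorem analyticAt_zOf : AnalyticAt ℝ B.zOf B.rp := by
  unfold zOf
  exact AnalyticAt.div (by fun_prop) (by fun_prop) B.rp_sub_rm_pos.ne'

theorem zOf_rp : B.zOf B.rp = 0 := by simp [zOf]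

theorem Rsq_analyticAt (r : ℝ) : AnalyticAt ℝ B.Rsq r := by
  unfold Rsq
  fun_prop

theorem R_rp : B.R B.rp = (2 * B.ν * B.rp - B.q) / 2 := by
  rw [R, B.Rsq_rp, Real.sqrt_sq (half_pos B.two_ν_rp_sub_q_pos).le]

theorem tendsto_rOf : Tendsto B.rOf (𝓝[>] 0) (𝓝[>] B.rp) := by
  refine tendsto_nhdsWithin_iff.mpr ⟨?_, ?_⟩
  · have := B.analyticAt_rOf.continuousAt.tendsto
    rw [B.rOf_zero] at this
    exact this.mono_left nhdsWithin_le_nhds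
  · filter_upwards [Ioo_mem_nhdsGT (zero_lt_one : (0 : ℝ) < 1)] with z hz using B.rp_lt_rOf hz

theorem tendsto_zOf : Tendsto B.zOf (𝓝[>] B.rp) (𝓝[>] 0) := by
  refine tendsto_nhdsWithin_iff.mpr ⟨?_, ?_⟩
  · have := B.analyticAt_zOf.continuousAt.tendsto
    rw [B.zOf_rp] at this
    exact this.mono_left nhdsWithin_le_nhds
  · filter_upwards [self_mem_nhdsWithin] with r hr using (B.zOf_mem hr).1

theorem powerAtZero_exp_tortoise_horizon (lam : ℂ) :
    PowerAtZero (lam * (((2 * B.ν * B.rp - B.q) / ((B.ν ^ 2 + 3) * (B.rp - B.rm)) : ℝ) : ℂ))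
      (fun z => Complex.exp (lam * (B.tortoise (B.rOf z) : ℂ))) := by
  have hL := B.rp_sub_rm_pos.ne'
  have hA := B.ν_sq_add_three_pos.ne'
  set G : ℝ → ℝ := fun z => 2 * B.R (B.rOf z) / ((B.ν ^ 2 + 3) * (B.rp - B.rm)) with hG
  have hRa : AnalyticAt ℝ (fun z => B.R (B.rOf z)) 0 := by
    refine AnalyticAt.real_sqrt (f := fun z => B.Rsq (B.rOf z))
      ((B.Rsq_analyticAt _).fun_comp B.analyticAt_rOf) ?_
    rw [B.rOf_zero]
    exact B.Rsq_pos le_rfl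
  have hGa : AnalyticAt ℝ G 0 := (analyticAt_const.mul hRa).div analyticAt_const
    (mul_ne_zero hA hL)
  have hG0 : G 0 = (2 * B.ν * B.rp - B.q) / ((B.ν ^ 2 + 3) * (B.rp - B.rm)) := by
    simp only [hG, B.rOf_zero, B.R_rp]
    ring
  rw [← hG0]
  refine powerAtZero_exp (T := fun z => B.tortoise (B.rOf z)) hGa ?_ lam
  filter_upwards [Ioo_mem_nhdsGT (zero_lt_one : (0 : ℝ) < 1)] with z hz
  have h1 := (B.hasDerivAt_tortoise (B.rp_lt_rOf hz)).comp z (B.hasDerivAt_rOf hz.2)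
  convert! h1 using 1
  have h2 : 1 - z ≠ 0 := (sub_pos.mpr hz.2).ne'
  have h3 := hz.1.ne'
  rw [hG, B.quad_rOf hz.2]
  field_simp

theorem analyticAt_sqrt_R_rp : AnalyticAt ℝ (fun r => ((√(B.R r) : ℝ) : ℂ)) B.rp := by
  have h1 : AnalyticAt ℝ B.R B.rp := AnalyticAt.real_sqrt (B.Rsq_analyticAt _) (B.Rsq_pos le_rfl)
  exact (AnalyticAt.real_sqrt h1 (Real.sqrt_pos.mpr (B.Rsq_pos le_rfl))).complex_ofReal

theorem sqrt_R_ne_zero {r : ℝ} (hr : B.rp ≤ r) : ((√(B.R r) : ℝ) : ℂ) ≠ 0 :=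
  Complex.ofReal_ne_zero.mpr (Real.sqrt_pos.mpr (Real.sqrt_pos.mpr (B.Rsq_pos hr))).ne'

theorem pureAtHorizon_rescaled_iff (lam : ℂ) (φ : ℝ → ℂ) :
    B.PureAtHorizon lam (B.rescaled φ) ↔
      PowerAtZero (lam * (((2 * B.ν * B.rp - B.q) / ((B.ν ^ 2 + 3) * (B.rp - B.rm)) : ℝ) : ℂ))
        (fun z => φ (B.rOf z)) := by
  obtain ⟨E, hE, hE0, hTE⟩ := B.powerAtZero_exp_tortoise_horizon lam
  have hS := B.analyticAt_sqrt_R_rp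
  have hS0 := B.sqrt_R_ne_zero le_rfl
  set s := lam * (((2 * B.ν * B.rp - B.q) / ((B.ν ^ 2 + 3) * (B.rp - B.rm)) : ℝ) : ℂ)
  constructor
  · rintro ⟨g, hg, hg0, h⟩
    refine ⟨fun z => E z * g (B.rOf z) / ((√(B.R (B.rOf z)) : ℝ) : ℂ), ?_, ?_, ?_⟩
    · refine (hE.mul (AnalyticAt.fun_comp (by rwa [B.rOf_zero]) B.analyticAt_rOf)).div
        (AnalyticAt.fun_comp (g := fun r => ((√(B.R r) : ℝ) : ℂ)) (by rwa [B.rOf_zero])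
          B.analyticAt_rOf) ?_
      rwa [B.rOf_zero]
    · simp only [B.rOf_zero]
      exact div_ne_zero (mul_ne_zero hE0 hg0) hS0
    · filter_upwards [hTE, B.tendsto_rOf.eventually h,
        Ioo_mem_nhdsGT (zero_lt_one : (0 : ℝ) < 1)] with z h1 h2 hz
      have h3 := B.sqrt_R_ne_zero (B.rp_lt_rOf hz).le
      rw [h1, rescaled] at h2
      field_simp
      linear_combination h2
  · rintro ⟨g, hg, hg0, h⟩
    refine ⟨fun r => ((√(B.R r) : ℝ) : ℂ) * g (B.zOf r) / E (B.zOf r), ?_, ?_, ?_⟩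
    · refine (hS.mul (AnalyticAt.fun_comp (by rwa [B.zOf_rp]) B.analyticAt_zOf)).div
        (AnalyticAt.fun_comp (by rwa [B.zOf_rp]) B.analyticAt_zOf) ?_
      rwa [B.zOf_rp]
    · simp only [B.zOf_rp]
      exact div_ne_zero (mul_ne_zero hS0 hg0) hE0
    · filter_upwards [B.tendsto_zOf.eventually h, B.tendsto_zOf.eventually hTE,
        B.tendsto_zOf.eventually
          ((hE.continuousAt.eventually_ne hE0).filter_mono nhdsWithin_le_nhds),
        self_mem_nhdsWithin] with r h1 h2 h3 hr
      rw [B.rOf_zOf hr] at h1 h2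
      rw [rescaled, h1, h2]
      field_simp

/-! ### Boundary conditions at infinity -/

theorem rOf_one_sub (w : ℝ) : B.rOf (1 - w) = (B.rp - B.rm + B.rm * w) / w := by
  unfold rOf
  ring_nf

/-- `w² R(r)²` as a function of `w = 1 - z`, which is analytic up to infinity, `w = 0`. -/
noncomputable def scaledRsq (w : ℝ) : ℝ :=
  (B.rp - B.rm + B.rm * w) / 4 * (3 * (B.ν ^ 2 - 1) * (B.rp - B.rm + B.rm * w) +
    ((B.ν ^ 2 + 3) * (B.rp + B.rm) - 4 * B.ν * B.q) * w)

theorem scaledRsq_eq {w : ℝ} (hw : w ≠ 0) :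
    B.scaledRsq w = w ^ 2 * B.Rsq (B.rOf (1 - w)) := by
  rw [B.rOf_one_sub, scaledRsq, Rsq]
  field_simp
  ring

theorem scaledRsq_zero : B.scaledRsq 0 = (√(3 * (B.ν ^ 2 - 1)) * (B.rp - B.rm) / 2) ^ 2 := by
  rw [scaledRsq, div_pow, mul_pow, Real.sq_sqrt B.three_mul_ν_sq_sub_one_pos.le]
  ring

theorem sqrt_scaledRsq_zero : √(B.scaledRsq 0) = √(3 * (B.ν ^ 2 - 1)) * (B.rp - B.rm) / 2 := by
  have := B.rp_sub_rm_pos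
  rw [B.scaledRsq_zero, Real.sqrt_sq (by positivity)]

theorem scaledRsq_zero_pos : 0 < B.scaledRsq 0 := by
  have h1 := B.rp_sub_rm_pos
  have h2 := Real.sqrt_pos.mpr B.three_mul_ν_sq_sub_one_pos
  rw [B.scaledRsq_zero]
  positivity

theorem analyticAt_sqrt_scaledRsq : AnalyticAt ℝ (fun w => √(B.scaledRsq w)) 0 := by
  refine AnalyticAt.real_sqrt ?_ B.scaledRsq_zero_pos
  unfold scaledRsq
  fun_prop

theorem one_sub_mem {w : ℝ} (hw : w ∈ Set.Ioo (0 : ℝ) 1) : 1 - w ∈ Set.Ioo (0 : ℝ) 1 :=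
  ⟨sub_pos.mpr hw.2, sub_lt_self 1 hw.1⟩

theorem R_rOf_one_sub {w : ℝ} (hw : 0 < w) : B.R (B.rOf (1 - w)) = √(B.scaledRsq w) / w := by
  rw [B.scaledRsq_eq hw.ne', Real.sqrt_mul (by positivity), Real.sqrt_sq hw.le, R]
  field_simp

theorem tendsto_rOf_one_sub : Tendsto (fun w => B.rOf (1 - w)) (𝓝[>] 0) atTop := by
  have h1 : Tendsto (fun w : ℝ => (B.rp - B.rm) * w⁻¹ + B.rm) (𝓝[>] 0) atTop :=
    tendsto_atTop_add_const_right _ _ (tendsto_inv_nhdsGT_zero.const_mul_atTop B.rp_sub_rm_pos)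
  refine h1.congr' ?_
  filter_upwards [self_mem_nhdsWithin] with w hw
  have : w ≠ 0 := ne_of_gt hw
  rw [B.rOf_one_sub]
  field_simp

/-- `1 - z` as a function of `y = 1 / r`. -/
noncomputable def wOf (y : ℝ) : ℝ := (B.rp - B.rm) * y / (1 - B.rm * y)

theorem wOf_one_div {r : ℝ} (hr : B.rp < r) : B.wOf (1 / r) = 1 - B.zOf r := by
  have h1 : r - B.rm ≠ 0 := by linarith [B.rm_lt_rp]
  have h2 : r ≠ 0 := by linarith [B.rp_pos]
  have h3 : 1 - B.rm * (1 / r) = (r - B.rm) / r := by field_simp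
  rw [B.one_sub_zOf hr, wOf, h3]
  field_simp

theorem wOf_zero : B.wOf 0 = 0 := by simp [wOf]

theorem analyticAt_wOf : AnalyticAt ℝ B.wOf 0 := by
  unfold wOf
  exact AnalyticAt.div (by fun_prop) (by fun_prop) (by simp)

theorem tendsto_wOf : Tendsto (fun r => B.wOf (1 / r)) atTop (𝓝[>] 0) := by
  refine tendsto_nhdsWithin_iff.mpr ⟨?_, ?_⟩
  · have h1 := B.analyticAt_wOf.continuousAt.tendsto
    rw [B.wOf_zero] at h1
    refine h1.comp ?_
    exact (tendsto_inv_atTop_zero (𝕜 := ℝ)).congr fun r => (one_div r).symm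
  · filter_upwards [eventually_gt_atTop B.rp] with r hr
    rw [B.wOf_one_div hr]
    exact (one_sub_mem (B.zOf_mem hr)).1

theorem powerAtZero_exp_tortoise_infinity (lam : ℂ) :
    PowerAtZero (-lam * ((√(3 * (B.ν ^ 2 - 1)) / (B.ν ^ 2 + 3) : ℝ) : ℂ))
      (fun w => Complex.exp (lam * (B.tortoise (B.rOf (1 - w)) : ℂ))) := by
  have hL := B.rp_sub_rm_pos.ne'
  have hA := B.ν_sq_add_three_pos.ne'
  set G : ℝ → ℝ := fun w => -(2 * √(B.scaledRsq w)) /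
    ((B.ν ^ 2 + 3) * (B.rp - B.rm) * (1 - w)) with hG
  have hGa : AnalyticAt ℝ G 0 := by
    refine AnalyticAt.div (analyticAt_const.mul B.analyticAt_sqrt_scaledRsq).neg (by fun_prop) ?_
    simpa using ⟨hA, hL⟩
  have hG0 : G 0 = -(√(3 * (B.ν ^ 2 - 1)) / (B.ν ^ 2 + 3)) := by
    simp only [hG, B.sqrt_scaledRsq_zero]
    field_simp
    ring
  have hs : -lam * ((√(3 * (B.ν ^ 2 - 1)) / (B.ν ^ 2 + 3) : ℝ) : ℂ) = lam * (G 0 : ℂ) := by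
    rw [hG0]
    push_cast
    ring
  rw [hs]
  refine powerAtZero_exp (T := fun w => B.tortoise (B.rOf (1 - w))) hGa ?_ lam
  filter_upwards [Ioo_mem_nhdsGT (zero_lt_one : (0 : ℝ) < 1)] with w hw
  have hz := one_sub_mem hw
  have h1 := ((B.hasDerivAt_tortoise (B.rp_lt_rOf hz)).comp (1 - w)
    (B.hasDerivAt_rOf hz.2)).comp_const_sub 1 w
  convert! h1 using 1
  have h2 : 1 - w ≠ 0 := hz.1.ne'
  have h3 := hw.1.ne'
  rw [hG, B.quad_rOf hz.2, B.R_rOf_one_sub hw.1, sub_sub_cancel]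
  field_simp

theorem sqrt_R_rOf_one_sub {w : ℝ} (hw : 0 < w) : ((√(B.R (B.rOf (1 - w))) : ℝ) : ℂ) =
    powC w (-(1 / 2)) * ((√(√(B.scaledRsq w)) : ℝ) : ℂ) := by
  have h1 := powC_neg_mul_self w (1 / 2)
  rw [← ofReal_sqrt_eq_powC hw] at h1
  have h2 : ((√w : ℝ) : ℂ) ≠ 0 := Complex.ofReal_ne_zero.mpr (Real.sqrt_pos.mpr hw).ne'
  rw [B.R_rOf_one_sub hw, Real.sqrt_div (Real.sqrt_nonneg _)]
  push_cast
  field_simp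
  linear_combination (-((√(√(B.scaledRsq w)) : ℝ) : ℂ)) * h1

theorem pureAtInfinity_rescaled_iff (lam : ℂ) (φ : ℝ → ℂ) :
    B.PureAtInfinity lam (B.rescaled φ) ↔
      PowerAtZero (1 / 2 - lam * ((√(3 * (B.ν ^ 2 - 1)) / (B.ν ^ 2 + 3) : ℝ) : ℂ))
        (fun w => φ (B.rOf (1 - w))) := by
  obtain ⟨E, hE, hE0, hTE⟩ := B.powerAtZero_exp_tortoise_infinity lam
  set s := -lam * ((√(3 * (B.ν ^ 2 - 1)) / (B.ν ^ 2 + 3) : ℝ) : ℂ) with hs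
  rw [show 1 / 2 - lam * ((√(3 * (B.ν ^ 2 - 1)) / (B.ν ^ 2 + 3) : ℝ) : ℂ) = 1 / 2 + s by
    rw [hs]; ring]
  set S : ℝ → ℂ := fun w => ((√(√(B.scaledRsq w)) : ℝ) : ℂ) with hSdef
  have hpos : 0 < √(B.scaledRsq 0) := Real.sqrt_pos.mpr B.scaledRsq_zero_pos
  have hS : AnalyticAt ℝ S 0 := (B.analyticAt_sqrt_scaledRsq.real_sqrt hpos).complex_ofReal
  have hS0 : S 0 ≠ 0 := Complex.ofReal_ne_zero.mpr (Real.sqrt_pos.mpr hpos).ne'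
  have hSw : ∀ᶠ w in 𝓝[>] 0, S w ≠ 0 :=
    (hS.continuousAt.eventually_ne hS0).filter_mono nhdsWithin_le_nhds
  constructor
  · rintro ⟨g, hg, hg0, h⟩
    -- The function `w ↦ 1 / r`.
    have hy : AnalyticAt ℝ (fun w : ℝ => w / (B.rp - B.rm + B.rm * w)) 0 :=
      AnalyticAt.div (by fun_prop) (by fun_prop) (by simpa using B.rp_sub_rm_pos.ne')
    refine ⟨fun w => E w * g (w / (B.rp - B.rm + B.rm * w)) / S w, ?_, ?_, ?_⟩
    · exact (hE.mul (AnalyticAt.fun_comp (f := fun w : ℝ => w / (B.rp - B.rm + B.rm * w))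
        (by simpa using hg) hy)).div hS hS0
    · simp only [zero_div]
      exact div_ne_zero (mul_ne_zero hE0 hg0) hS0
    · filter_upwards [hTE, B.tendsto_rOf_one_sub.eventually h, hSw, self_mem_nhdsWithin] with
        w h1 h2 h3 hw
      have e1 : 1 / B.rOf (1 - w) = w / (B.rp - B.rm + B.rm * w) := by
        rw [B.rOf_one_sub, one_div_div]
      rw [h1, rescaled, B.sqrt_R_rOf_one_sub hw, e1] at h2
      have h4 := powC_neg_mul_self w (1 / 2)
      rw [powC_add]
      have h5 : φ (B.rOf (1 - w)) * S w = powC w (1 / 2) * powC w s *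
          (E w * g (w / (B.rp - B.rm + B.rm * w))) := by
        linear_combination powC w (1 / 2) * h2 - φ (B.rOf (1 - w)) * S w * h4
      rw [← mul_div_assoc, eq_div_iff h3, h5]
  · rintro ⟨g, hg, hg0, h⟩
    refine ⟨fun y => S (B.wOf y) * g (B.wOf y) / E (B.wOf y), ?_, ?_, ?_⟩
    · have hc : ∀ {f : ℝ → ℂ}, AnalyticAt ℝ f 0 → AnalyticAt ℝ (fun y => f (B.wOf y)) 0 :=
        fun hf => AnalyticAt.fun_comp (by rwa [B.wOf_zero]) B.analyticAt_wOf
      refine ((hc hS).mul (hc hg)).div (hc hE) ?_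
      rwa [B.wOf_zero]
    · simp only [B.wOf_zero]
      exact div_ne_zero (mul_ne_zero hS0 hg0) hE0
    · filter_upwards [B.tendsto_wOf.eventually h, B.tendsto_wOf.eventually hTE,
        B.tendsto_wOf.eventually
          ((hE.continuousAt.eventually_ne hE0).filter_mono nhdsWithin_le_nhds),
        B.tendsto_wOf.eventually self_mem_nhdsWithin, eventually_gt_atTop B.rp] with
        r h1 h2 h3 hw hr
      have e1 : B.rOf (1 - B.wOf (1 / r)) = r := by
        rw [B.wOf_one_div hr, sub_sub_cancel, B.rOf_zOf hr]
      have e2 := B.sqrt_R_rOf_one_sub (w := B.wOf (1 / r)) hw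
      have h4 := powC_neg_mul_self (B.wOf (1 / r)) (1 / 2)
      rw [e1] at h1 h2 e2
      rw [rescaled, e2, h1, h2, powC_add]
      field_simp
      linear_combination (S (B.wOf (1 / r)) * powC (B.wOf (1 / r)) s * g (B.wOf (1 / r))) * h4

end StretchedBlackHole

namespace StretchedBlackHole

variable {B : StretchedBlackHole}

/-! ### Modes with prescribed exponents at both ends -/

/-- A mode with pure exponents `α` at the horizon and `β` at infinity exists only if one of the
hypergeometric parameters is a non-positive integer. Here `β` may be either exponent at infinity. -/
theorem exists_nat_of_powerAtZero {msq : ℝ} {k : ℤ} {ω β : ℂ} {φ : ℝ → ℂ}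
    (hβ : β * (1 - β) = 3 * ((B.ν : ℂ) ^ 2 - 1) * ω ^ 2 / ((B.ν : ℂ) ^ 2 + 3) ^ 2
      - msq / ((B.ν : ℂ) ^ 2 + 3)) (hc : ∀ j : ℕ, 2 * B.α k ω + 1 ≠ -(j : ℂ))
    (hφ : B.IsModeSolution msq k ω φ) (h0 : PowerAtZero (B.α k ω) (fun z => φ (B.rOf z)))
    (h1 : PowerAtZero β (fun w => φ (B.rOf (1 - w)))) :
    ∃ n : ℕ, B.α k ω + β + B.γ k ω = -(n : ℂ) ∨ B.α k ω + β - B.γ k ω = -(n : ℂ) := by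
  obtain ⟨u', u'', hu⟩ := (hφ.solvesRadial.solvesZ hβ).solvesHypergeometric
  obtain ⟨g, hg, hg0, hge⟩ := h0
  obtain ⟨f, hf, -, hfe⟩ := h1
  have hp : ∀ s, AnalyticAt ℝ (fun z : ℝ => powC (1 - z) s) 0 := fun s =>
    AnalyticAt.powC (f := fun z : ℝ => 1 - z) (by fun_prop) (by norm_num) s
  refine exists_nat_of_solvesHypergeometric (g₀ := fun z => g z * powC (1 - z) (-β))
    (g₁ := fun w => f w * powC (1 - w) (-B.α k ω)) hu hc (hg.mul (hp _)) ?_ ?_ (hf.mul (hp _)) ?_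
  · exact mul_ne_zero hg0 (powC_ne_zero _ _)
  · filter_upwards [hge] with z hz
    rw [hz, endFactor]
    linear_combination g z * powC (1 - z) (-β) * powC_neg_mul_self z (B.α k ω)
  · filter_upwards [hfe] with w hw
    rw [hw, endFactor, sub_sub_cancel]
    linear_combination f w * powC (1 - w) (-B.α k ω) * powC_neg_mul_self w β

theorem _root_.SolvesHypergeometric.swap {a b c : ℂ} {u u' u'' : ℝ → ℂ}
    (h : SolvesHypergeometric a b c u u' u'') : SolvesHypergeometric b a c u u' u'' := by
  intro x hx
  obtain ⟨h0, h1, h2⟩ := h x hx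
  exact ⟨h0, h1, by linear_combination h2⟩

/-- A polynomial solution, nonzero at `0` and `1`, gives a mode with pure exponents. -/
theorem exists_mode_of_hyperPoly {msq : ℝ} {k : ℤ} {ω β : ℂ} {P : Polynomial ℂ} {u' u'' : ℝ → ℂ}
    (hβ : β * (1 - β) = 3 * ((B.ν : ℂ) ^ 2 - 1) * ω ^ 2 / ((B.ν : ℂ) ^ 2 + 3) ^ 2
      - msq / ((B.ν : ℂ) ^ 2 + 3))
    (hu : SolvesHypergeometric (B.α k ω + β + B.γ k ω) (B.α k ω + β - B.γ k ω) (2 * B.α k ω + 1)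
      (fun x => P.eval (x : ℂ)) u' u'') (h0 : P.eval 0 ≠ 0) (h1 : P.eval 1 ≠ 0) :
    ∃ φ, B.IsModeSolution msq k ω φ ∧ PowerAtZero (B.α k ω) (fun z => φ (B.rOf z)) ∧
      PowerAtZero β (fun w => φ (B.rOf (1 - w))) := by
  obtain ⟨ψ', ψ'', hψ⟩ := hu.solvesZ
  have hp : ∀ s, AnalyticAt ℝ (fun z : ℝ => powC (1 - z) s) 0 := fun s =>
    AnalyticAt.powC (f := fun z : ℝ => 1 - z) (by fun_prop) (by norm_num) s
  refine ⟨_, (hψ.solvesRadial hβ).isModeSolution ?_, ?_, ?_⟩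
  · refine AnalyticOn.contDiffOn (AnalyticOnNhd.analyticOn fun r hr => ?_) (uniqueDiffOn_Ioi _)
    have hr' : B.rp < r := hr
    have hz : AnalyticAt ℝ B.zOf r := by
      unfold zOf
      exact AnalyticAt.div (by fun_prop) (by fun_prop) (by linarith [B.rm_lt_rp])
    have hm := B.zOf_mem hr'
    exact (P.analyticAt_eval_ofReal hz).mul ((hz.powC hm.1 _).mul
      (AnalyticAt.powC (f := fun r => 1 - B.zOf r) (analyticAt_const.sub hz) (sub_pos.mpr hm.2) _))
  · refine ⟨fun z => P.eval (z : ℂ) * powC (1 - z) β,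
      (P.analyticAt_eval_ofReal analyticAt_id).mul (hp _), ?_, ?_⟩
    · simpa using ⟨h0, powC_ne_zero _ _⟩
    · filter_upwards [Ioo_mem_nhdsGT (zero_lt_one : (0 : ℝ) < 1)] with z hz
      rw [B.zOf_rOf hz.2, endFactor]
      ring
  · refine ⟨fun w => P.eval ((1 - w : ℝ) : ℂ) * powC (1 - w) (B.α k ω),
      (P.analyticAt_eval_ofReal (f := fun w => 1 - w) (by fun_prop)).mul (hp _), ?_, ?_⟩
    · simpa using ⟨h1, powC_ne_zero _ _⟩
    · filter_upwards [Ioo_mem_nhdsGT (zero_lt_one : (0 : ℝ) < 1)] with w hw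
      rw [B.zOf_rOf (one_sub_mem hw).2, endFactor, sub_sub_cancel]
      ring

/-- The converse of `exists_nat_of_powerAtZero`. The hypothesis on `2 β` is the one that makes an
analytic solution at infinity unique, since `a + b - c + 1 = 2 β`. -/
theorem exists_mode_of_nat {msq : ℝ} {k : ℤ} {ω β : ℂ}
    (hβ : β * (1 - β) = 3 * ((B.ν : ℂ) ^ 2 - 1) * ω ^ 2 / ((B.ν : ℂ) ^ 2 + 3) ^ 2
      - msq / ((B.ν : ℂ) ^ 2 + 3)) (hc : ∀ j : ℕ, 2 * B.α k ω + 1 ≠ -(j : ℂ))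
    (hc' : ∀ j : ℕ, 2 * β ≠ -(j : ℂ)) {n : ℕ}
    (h : B.α k ω + β + B.γ k ω = -(n : ℂ) ∨ B.α k ω + β - B.γ k ω = -(n : ℂ)) :
    ∃ φ, B.IsModeSolution msq k ω φ ∧ PowerAtZero (B.α k ω) (fun z => φ (B.rOf z)) ∧
      PowerAtZero β (fun w => φ (B.rOf (1 - w))) := by
  have h0 : ∀ b : ℂ, (hyperPoly n b (2 * B.α k ω + 1)).eval 0 ≠ 0 := fun b => by
    rw [hyperPoly_eval_zero]
    exact one_ne_zero
  rcases h with h | h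
  · have hu := solvesHypergeometric_hyperPoly n (B.α k ω + β - B.γ k ω) hc
    rw [← h] at hu
    refine exists_mode_of_hyperPoly hβ hu (h0 _) (hyperPoly_eval_one_ne_zero n hc fun j e => ?_)
    exact hc' j (by rw [← e, ← h]; ring)
  · have hu := (solvesHypergeometric_hyperPoly n (B.α k ω + β + B.γ k ω) hc).swap
    rw [← h] at hu
    refine exists_mode_of_hyperPoly hβ hu (h0 _) (hyperPoly_eval_one_ne_zero n hc fun j e => ?_)
    exact hc' j (by rw [← e, ← h]; ring)

/-! ### Eigenfrequencies -/

variable (B)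

theorem isQuasinormalFreq_iff {msq : ℝ} (hm : -((B.ν ^ 2 + 3) / 4) ≤ msq) {k : ℤ} {ω : ℂ}
    (hc : ∀ j : ℕ, B.c k ω ≠ -(j : ℂ))
    (hc' : ∀ j : ℕ, B.c k ω - B.a msq k ω - B.b msq k ω ≠ (j : ℂ) + 1) :
    B.IsQuasinormalFreq msq k ω ↔
      ∃ n : ℕ, B.a msq k ω = -(n : ℂ) ∨ B.b msq k ω = -(n : ℂ) := by
  have hβ := B.β_mul_one_sub_β hm ω
  have hexp : 1 / 2 - Complex.I * B.omegaHat msq ω *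
      ((√(3 * (B.ν ^ 2 - 1)) / (B.ν ^ 2 + 3) : ℝ) : ℂ) = B.β msq ω := by
    rw [omegaHat, β]
    linear_combination (B.varpiHat msq ω * ((√(3 * (B.ν ^ 2 - 1)) / (B.ν ^ 2 + 3) : ℝ) : ℂ)) *
      Complex.I_sq
  unfold IsQuasinormalFreq IsQuasinormalMode
  simp only [pureAtHorizon_rescaled_iff, pureAtInfinity_rescaled_iff, hexp]
  constructor
  · rintro ⟨φ, hφ, h0, h1⟩
    exact exists_nat_of_powerAtZero hβ hc hφ h0 h1
  · rintro ⟨n, hn⟩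
    refine exists_mode_of_nat hβ hc (fun j hj => hc' j ?_) hn
    unfold c a b
    linear_combination -hj

theorem isBoundStateFreq_iff {msq : ℝ} (hm : -((B.ν ^ 2 + 3) / 4) ≤ msq) {k : ℤ} {ω : ℂ}
    (hc : ∀ j : ℕ, B.c k ω ≠ -(j : ℂ)) :
    B.IsBoundStateFreq msq k ω ↔
      ∃ n : ℕ, B.c k ω - B.a msq k ω = -(n : ℂ) ∨ B.c k ω - B.b msq k ω = -(n : ℂ) := by
  have hβ : (1 - B.β msq ω) * (1 - (1 - B.β msq ω)) = _ :=
    (by ring : _ = B.β msq ω * (1 - B.β msq ω)).trans (B.β_mul_one_sub_β hm ω)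
  have hexp : 1 / 2 - -B.varpiHat msq ω *
      ((√(3 * (B.ν ^ 2 - 1)) / (B.ν ^ 2 + 3) : ℝ) : ℂ) = 1 - B.β msq ω := by
    rw [β]
    ring
  have ea : B.c k ω - B.a msq k ω = B.α k ω + (1 - B.β msq ω) - B.γ k ω := by
    unfold c a
    ring
  have eb : B.c k ω - B.b msq k ω = B.α k ω + (1 - B.β msq ω) + B.γ k ω := by
    unfold c b
    ring
  unfold IsBoundStateFreq IsBoundStateMode
  simp only [pureAtHorizon_rescaled_iff, pureAtInfinity_rescaled_iff, hexp]
  constructor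
  · rintro ⟨φ, hφ, h0, -, h1⟩
    obtain ⟨n, hn⟩ := exists_nat_of_powerAtZero hβ hc hφ h0 h1
    exact ⟨n, by rw [ea, eb]; exact hn.symm⟩
  · rintro ⟨n, hn⟩
    have hpos : 0 < (B.varpiHat msq ω).re := by
      rw [c_sub_a_eq_neg_iff, c_sub_b_eq_neg_iff] at hn
      exact B.varpiHat_re_pos_of_condition hn.symm
    have hre : 0 < (2 * (1 - B.β msq ω)).re := by
      have e : 2 * (1 - B.β msq ω) = 1 + ((2 * (√(3 * (B.ν ^ 2 - 1)) / (B.ν ^ 2 + 3)) : ℝ) : ℂ) *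
          B.varpiHat msq ω := by
        rw [β]
        push_cast
        ring
      have hA := B.ν_sq_add_three_pos
      rw [e, Complex.add_re, Complex.one_re, Complex.re_ofReal_mul]
      positivity
    rw [ea, eb] at hn
    obtain ⟨φ, hφ, h0, h1⟩ := exists_mode_of_nat hβ hc (ne_neg_natCast_of_re_pos hre) hn.symm
    exact ⟨φ, hφ, h0, hpos, h1⟩

end StretchedBlackHole

theorem mainTheorem4 (B : StretchedBlackHole) (msq : ℝ) (hm : -((B.ν ^ 2 + 3) / 4) ≤ msq)
    (k : ℤ) (hD : B.d ^ 2 * B.δ ^ 2 ≠ 3 * (B.ν ^ 2 - 1)) :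
    -- quasinormal modes
    (∀ ω : ℂ, (∀ j : ℕ, B.c k ω ≠ -(j : ℂ)) →
      (∀ j : ℕ, B.c k ω - B.a msq k ω - B.b msq k ω ≠ (j : ℂ) + 1) →
      (B.IsQuasinormalFreq msq k ω ↔
        ∃ n : ℕ, B.a msq k ω = -(n : ℂ) ∨ B.b msq k ω = -(n : ℂ)) ∧
      (B.IsQuasinormalFreq msq k ω ↔
        ∃ n : ℕ, ω = B.rightFreq 1 msq k n ∨ ω = B.leftFreq 1 msq n)) ∧
    -- bound state modes
    (∀ ω : ℂ, (∀ j : ℕ, B.c k ω ≠ -(j : ℂ)) →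
      (B.IsBoundStateFreq msq k ω ↔
        ∃ n : ℕ, B.c k ω - B.a msq k ω = -(n : ℂ) ∨ B.c k ω - B.b msq k ω = -(n : ℂ)) ∧
      (B.IsBoundStateFreq msq k ω ↔
        ∃ n : ℕ, ω = B.rightFreq (-1) msq k n ∨ ω = B.leftFreq (-1) msq n)) ∧
    -- each condition gives one family of frequencies
    (∀ (ω : ℂ) (n : ℕ),
      (B.a msq k ω = -(n : ℂ) ↔ ω = B.rightFreq 1 msq k n) ∧
      (B.b msq k ω = -(n : ℂ) ↔ ω = B.leftFreq 1 msq n) ∧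
      (B.c k ω - B.b msq k ω = -(n : ℂ) ↔ ω = B.rightFreq (-1) msq k n) ∧
      (B.c k ω - B.a msq k ω = -(n : ℂ) ↔ ω = B.leftFreq (-1) msq n)) := by
  have key : ∀ (ω : ℂ) (n : ℕ),
      (B.a msq k ω = -(n : ℂ) ↔ ω = B.rightFreq 1 msq k n) ∧
      (B.b msq k ω = -(n : ℂ) ↔ ω = B.leftFreq 1 msq n) ∧
      (B.c k ω - B.b msq k ω = -(n : ℂ) ↔ ω = B.rightFreq (-1) msq k n) ∧
      (B.c k ω - B.a msq k ω = -(n : ℂ) ↔ ω = B.leftFreq (-1) msq n) := fun ω n => by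
    obtain ⟨r1, r2⟩ := B.scaledVarpi_eq_rightCondition_iff hm hD k n ω
    obtain ⟨l1, l2⟩ := B.scaledVarpi_eq_leftCondition_iff hm n ω
    rw [B.a_eq_neg_iff, B.b_eq_neg_iff, B.c_sub_b_eq_neg_iff, B.c_sub_a_eq_neg_iff]
    exact ⟨r1, l1, r2, l2⟩
  refine ⟨fun ω hc hc' => ?_, fun ω hc => ?_, key⟩
  · refine ⟨B.isQuasinormalFreq_iff hm hc hc', (B.isQuasinormalFreq_iff hm hc hc').trans ?_⟩
    exact exists_congr fun n => or_congr (key ω n).1 (key ω n).2.1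
  · refine ⟨B.isBoundStateFreq_iff hm hc, (B.isBoundStateFreq_iff hm hc).trans ?_⟩
    exact exists_congr fun n => (or_congr (key ω n).2.2.2 (key ω n).2.2.1).trans or_comm
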